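/- **Setting.** Fix integers $d,r\ge 1$. A $d$-mode tensor $X$ of size $I_1\times\dots\times I_d$ is given by a CP representation $X=\sum_{k=1}^r x_k^{(1)}\otimes\dots\otimes x_k^{(d)}$, $x_k^{(j)}\in\mathbb R^{I_j}$. For each mode $j$ let $K^{(j)}(a,b)=h^{(j)}(\|a-b\|^2)$ or $K^{(j)}(a,b)=h^{(j)}(\langle a,b\rangle)$ with $h^{(j)}$ Lipschitz (on $[0,\infty)$, respectively on $\mathbb R$), symmetric and positive semidefinite on $\mathbb R^m$ for every $m$. Let $K(X,Y)=\sum_{k,l=1}^r\prod_{j=1}^dK^{(j)}(x_k^{(j)},y_l^{(j)})$, with reproducing kernel Hilbert space $\mathcal F$ on tensors of a given size. Let $L(y,t)=\max(0,1-yt)^2$ be the squared hinge loss. Let $Q$ be the law of $(X,y)$, where $y\in\{-1,1\}$ and $\|x_k^{(j)}\|^2\le B$ for all $j,k$ almost surely; put $\mathcal R(f)=\mathbb E\,L(y,f(X))$ and let $\mathcal R^*$ be the infimum of $\mathcal R$ over all measurable functions. Let $0<\eta\le1$ and assume that $$D(\lambda)=\inf_{f\in\mathcal F}\{\mathcal R(f)-\mathcal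 R^*+\lambda\|f\|_{\mathcal F}^2\}\le c\,\lambda^\eta\qquad(0<\lambda\le1).$$ **Projected classifier.** Let $\mu\in(0,1)$, $\delta_1\in(0,\tfrac12)$, $\delta_2\in(0,1)$, $n\ge1$, $$\epsilon=n^{-\mu/(2d)},\qquad \lambda=n^{-\mu/(2\eta+3)},\qquad P_j=P=\Big\lceil 3r^{2/d}\epsilon^{-2}\big(\log\tfrac n{\delta_1}\big)^{1/d}\Big\rceil+1=\Big\lceil 3r^{2/d}n^{\mu/d}\big(\log\tfrac n{\delta_1}\big)^{1/d}\Big\rceil+1 .$$ Let $q\in\mathbb N$ and $\sigma:\{1,\dots,r\}\to\{1,\dots,q\}$ (for $q=1$ there is one projection matrix per mode, for $q=r$, $\sigma=\mathrm{id}$ one per mode and component). Let $A^{(j)}_m\in\mathbb R^{P\times I_j}$ ($j\le d$, $m\le q$) have independent $N(0,1)$ entries, and let $\mathscr A\circ X$ be the tensor with CP factors $P^{-1/2}A^{(j)}_{\sigma(k)}x_k^{(j)}$. Given a sample $(X_i,y_i)_{i\le n}$ of $n$ independent draws from $Q$, independent of the matrices, let $g_n^\lambda$ be the minimizer of $$g\mapsto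 \frac1n\sum_{i=1}^nL(y_i,g(\mathscr A\circ X_i))+\lambda\|g\|^2$$ over the reproducing kernel Hilbert space of $K$ on tensors of size $P\times\dots\times P$, and $\mathcal R(g_n^\lambda)=\mathbb E_{(X,y)}L(y,g_n^\lambda(\mathscr A\circ X))$. **Proposition.** With probability at least $(1-\delta_2)(1-2\delta_1)$ over the projection matrices and the sample, $g_n^\lambda$ exists, is unique, and $$\mathcal R(g_n^\lambda)-\mathcal R^*\le C\sqrt{\log(2/\delta_2)}\;n^{-\mu\eta/(2\eta+3)} .$$ More precisely: 1. for all $I_1,\dots,I_d,q,\sigma,\delta_1$ this holds for all $n\ge1$, all $\delta_2$ and all $Q$ as above with some $C>0$ that does not depend on $n$, $\delta_2$ or $Q$; 2. there is a $C>0$ that depends only on $d,r,B,c,\eta,\mu$ and the functions $h^{(j)}$ with their types (and not on $\delta_1,\delta_2,n,I_1,\dots,I_d,q,\sigma,Q$), such that for all $I_1,\dots,I_d,q,\sigma,\delta_1$ there is an $N\ge 1$ such that the bound holds for all $n\ge N$, all $\delta_2$ and all $Q$ as above. -/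

import Mathlib

open MeasureTheory ProbabilityTheory
open scoped ENNReal NNReal

/-- The squared hinge loss `L(y, t) = max(0, 1 - y t)²`. -/
noncomputable def sqHinge (y t : ℝ) : ℝ := (max 0 (1 - y * t)) ^ 2

/-- The two admissible shapes of a vector kernel: a function of the squared distance or a
function of the inner product. -/
inductive KernelForm
  | dist
  | inner

/-- The scalar argument, `‖a - b‖²` or `⟨a, b⟩`, at which the profile function is evaluated. -/
noncomputable def KernelForm.arg (F : KernelForm) {m : ℕ} (a b : EuclideanSpace ℝ (Fin m)) : ℝ :=
  match F with
  | .dist => ‖a - b‖ ^ 2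
  | .inner => Inner.inner ℝ a b

/-- The set of all values that the scalar argument can take. -/
def KernelForm.range (F : KernelForm) : Set ℝ :=
  match F with
  | .dist => Set.Ici 0
  | .inner => Set.univ

/-- A vector kernel `K(a, b) = h(‖a - b‖²)` or `K(a, b) = h(⟨a, b⟩)` with a Lipschitz profile `h`.
It is used on vectors of every length (original and projected), where it has to be a kernel,
that is, symmetric and positive semidefinite. -/
structure ModeKernel where
  form : KernelForm
  h : ℝ → ℝ
  lip : ℝ≥0
  lipschitz : LipschitzOnWith lip h form.range
  posSemidef : ∀ m : ℕ,
    (Matrix.of fun a b : EuclideanSpace ℝ (Fin m) => h (form.arg a b)).PosSemidef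

/-- The value `K(a, b)` of a vector kernel. -/
noncomputable def ModeKernel.eval (κ : ModeKernel) {m : ℕ} (a b : EuclideanSpace ℝ (Fin m)) : ℝ :=
  κ.h (κ.form.arg a b)

/-- A `d`-mode tensor of size `I 1 × ⋯ × I d`, given by a rank-`r` CP representation
`∑ₖ x_k^(1) ⊗ ⋯ ⊗ x_k^(d)`; the vector `x_k^(j)` is `X j k`. -/
abbrev CPTensor (r : ℕ) {d : ℕ} (I : Fin d → ℕ) : Type :=
  (j : Fin d) → Fin r → EuclideanSpace ℝ (Fin (I j))

/-- The tensor kernel `K(X, Y) = ∑_{k,l} ∏_j K^(j)(x_k^(j), y_l^(j))`. -/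
noncomputable def tensorKernel {d r : ℕ} (κ : Fin d → ModeKernel) {I : Fin d → ℕ} (X Y : CPTensor r I) : ℝ :=
  ∑ k, ∑ l, ∏ j, (κ j).eval (X j k) (Y j l)

/-- The tensor kernel, read as a kernel with values in the operators on `ℝ`
(multiplication by `K(X, Y)`), which is the form in which Mathlib takes kernels. -/
noncomputable def tensorKernelOp {d : ℕ} (r : ℕ) (κ : Fin d → ModeKernel) (I : Fin d → ℕ) :
    Matrix (CPTensor r I) (CPTensor r I) (ℝ →L[ℝ] ℝ) :=
  Matrix.of fun X Y => tensorKernel κ X Y • ContinuousLinearMap.id ℝ ℝ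

theorem posSemidef_prod_aux {ι α : Type*} (s : Finset α) (M : α → Matrix ι ι ℝ)
    (hM : ∀ a ∈ s, (M a).PosSemidef) :
    (Matrix.of fun x y => ∏ a ∈ s, M a x y).PosSemidef := by
  classical
  induction s using Finset.induction_on with
  | empty =>
    refine ⟨by ext; simp, fun x => ?_⟩
    have : (x.sum fun i xi => x.sum fun j xj => xi * xj)
        = (x.sum fun _ xi => xi) * (x.sum fun _ xi => xi) := by
      simp [Finsupp.sum, Finset.sum_mul_sum]
    simpa [this] using mul_self_nonneg _
  | insert a s ha ih =>
    have h1 := ih fun b hb => hM b (Finset.mem_insert_of_mem hb)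
    have h2 := (hM a (Finset.mem_insert_self a s)).hadamard h1
    have h3 : (Matrix.of fun x y => ∏ b ∈ insert a s, M b x y)
        = (M a).hadamard (Matrix.of fun x y => ∏ b ∈ s, M b x y) := by
      ext x y
      simp [Matrix.hadamard, Finset.prod_insert ha]
    rw [h3]
    exact h2

theorem tensorKernel_sum_nonneg {d r : ℕ} (κ : Fin d → ModeKernel) {I : Fin d → ℕ}
    (v : CPTensor r I →₀ ℝ) :
    0 ≤ ∑ X ∈ v.support, ∑ Y ∈ v.support, v X * tensorKernel κ X Y * v Y := by
  classical
  have hP : (Matrix.of fun p q : Fin r × v.support =>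
      ∏ j, (κ j).eval (p.2.1 j p.1) (q.2.1 j q.1)).PosSemidef := by
    refine posSemidef_prod_aux Finset.univ
      (fun j => Matrix.of fun p q : Fin r × v.support =>
        (κ j).eval (p.2.1 j p.1) (q.2.1 j q.1)) fun j _ => ?_
    exact ((κ j).posSemidef (I j)).submatrix fun p : Fin r × v.support => p.2.1 j p.1
  have h := hP.dotProduct_mulVec_nonneg (fun p => v p.2.1)
  refine h.trans_eq ?_
  simp only [dotProduct, Matrix.mulVec, Matrix.of_apply, Fintype.sum_prod_type, tensorKernel,
    Pi.star_apply, star_trivial]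
  rw [← Finset.sum_coe_sort v.support, Finset.sum_comm]
  refine Finset.sum_congr rfl fun X _ => ?_
  simp only [Finset.mul_sum, Finset.sum_mul]
  rw [← Finset.sum_coe_sort v.support, Finset.sum_comm]
  conv_lhs => rw [Finset.sum_comm]; enter [2, k]; rw [Finset.sum_comm]
  rw [Finset.sum_comm]
  refine Finset.sum_congr rfl fun Y _ => ?_
  refine Finset.sum_congr rfl fun k _ => Finset.sum_congr rfl fun l _ => ?_
  ring

theorem tensorKernel_comm {d r : ℕ} (κ : Fin d → ModeKernel) {I : Fin d → ℕ}
    (X Y : CPTensor r I) : tensorKernel κ X Y = tensorKernel κ Y X := by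
  unfold tensorKernel
  rw [Finset.sum_comm]
  refine Finset.sum_congr rfl fun k _ => Finset.sum_congr rfl fun l _ =>
    Finset.prod_congr rfl fun j _ => ?_
  simpa [ModeKernel.eval] using ((κ j).posSemidef (I j)).isHermitian.apply (Y j k) (X j l)

/-- The tensor kernel is symmetric and positive semidefinite. -/
instance tensorKernelOp_posSemidef {d : ℕ} (r : ℕ) (κ : Fin d → ModeKernel) (I : Fin d → ℕ) :
    Fact (tensorKernelOp r κ I).PosSemidef where
  out := by
    have key := (RKHS.posSemidef_tfae (K := tensorKernelOp r κ I)).out 0 2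
    refine key.mpr ⟨?_, fun v => ?_⟩
    · ext X Y
      have hs : star (ContinuousLinearMap.id ℝ ℝ) = ContinuousLinearMap.id ℝ ℝ :=
        star_one (ℝ →L[ℝ] ℝ)
      simp [tensorKernelOp, tensorKernel_comm κ X Y, hs]
    · have h := tensorKernel_sum_nonneg κ v
      simp only [tensorKernelOp, Finsupp.sum, Matrix.of_apply]
      refine h.trans_eq ?_
      simp only [RCLike.re_to_real]
      refine Finset.sum_congr rfl fun X _ => Finset.sum_congr rfl fun Y _ => ?_
      simp [tensorKernel_comm κ X Y]
      ring

/-- The reproducing kernel Hilbert space of the tensor kernel on tensors of size `I`. -/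
abbrev TensorRKHS {d : ℕ} (r : ℕ) (κ : Fin d → ModeKernel) (I : Fin d → ℕ) : Type :=
  RKHS.OfKernel (tensorKernelOp r κ I)

/-- The risk `R(f) = E L(y, f(X))` of a decision function under the law `Q` of `(X, y)`. -/
noncomputable def risk {𝒳 : Type*} [MeasurableSpace 𝒳] (Q : Measure (𝒳 × ℝ)) (f : 𝒳 → ℝ) : ℝ≥0∞ :=
  ∫⁻ z, ENNReal.ofReal (sqHinge z.2 (f z.1)) ∂Q

/-- The Bayes risk `R*`: the infimum of the risk over all measurable functions. -/
noncomputable def bayesRisk {𝒳 : Type*} [MeasurableSpace 𝒳] (Q : Measure (𝒳 × ℝ)) : ℝ≥0∞ :=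
  ⨅ (f : 𝒳 → ℝ) (_ : Measurable f), risk Q f

/-- The penalized approximation error `D(lam) = inf_f {R(f) - R* + lam ‖f‖²}` over the RKHS on
the original (not projected) tensors. -/
noncomputable def approxError {d r : ℕ} (κ : Fin d → ModeKernel) {I : Fin d → ℕ}
    (Q : Measure (CPTensor r I × ℝ)) (lam : ℝ) : ℝ≥0∞ :=
  ⨅ f : TensorRKHS r κ I, (risk Q f - bayesRisk Q + ENNReal.ofReal (lam * ‖f‖ ^ 2))

/-- Assumptions on the law of a labelled tensor: labels are `±1`, the CP factors satisfy
`‖x_k^(j)‖² ≤ B`, and `D(lam) ≤ c lam^η`. -/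
structure DataAssumptions {d r : ℕ} (κ : Fin d → ModeKernel) {I : Fin d → ℕ} (B c η : ℝ)
    (Q : Measure (CPTensor r I × ℝ)) : Prop where
  label : ∀ᵐ z ∂Q, z.2 = 1 ∨ z.2 = -1
  bounded : ∀ᵐ z ∂Q, ∀ j k, ‖z.1 j k‖ ^ 2 ≤ B
  approx : ∀ lam : ℝ, 0 < lam → lam ≤ 1 → approxError κ Q lam ≤ ENNReal.ofReal (c * lam ^ η)

/-- The projected dimension `⌈3 r^(2/d) ε⁻² (log (n/δ₁))^(1/d)⌉ + 1`, the same for every mode. -/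
noncomputable def projDim (d r : ℕ) (ε : ℝ) (n : ℕ) (δ₁ : ℝ) : ℕ :=
  ⌈3 * (r : ℝ) ^ (2 / (d : ℝ)) * (ε ^ 2)⁻¹ * (Real.log (n / δ₁)) ^ (1 / (d : ℝ))⌉₊ + 1

/-- The entries of `q` projection matrices of size `P × I j` for each mode `j`. -/
abbrev ProjMatrices {d : ℕ} (q P : ℕ) (I : Fin d → ℕ) : Type :=
  (j : Fin d) → Fin q → Fin P → Fin (I j) → ℝ

/-- The law of projection matrices whose entries are all independent standard normal. -/
noncomputable def projLaw {d : ℕ} (q P : ℕ) (I : Fin d → ℕ) : Measure (ProjMatrices q P I) :=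
  Measure.pi fun _ => Measure.pi fun _ => Measure.pi fun _ => Measure.pi fun _ => gaussianReal 0 1

/-- The random projection of a tensor in CP form. The factor `x_k^(j)` is mapped to
`P^(-1/2) A^(j)_{σ(k)} x_k^(j)`, with the usual normalization under which the squared length of a
vector is preserved in expectation. For `q = 1` all components share one matrix per mode;
for `q = r`, `σ = id` each component has its own matrix. -/
noncomputable def project {d r q P : ℕ} {I : Fin d → ℕ} (σ : Fin r → Fin q)
    (A : ProjMatrices q P I) (X : CPTensor r I) : CPTensor r (fun _ : Fin d => P) :=
  fun j k => (Real.sqrt P)⁻¹ • WithLp.toLp 2 ((Matrix.of (A j (σ k))).mulVec (X j k).ofLp)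

/-- The regularized empirical risk of `g` on the projected training set. -/
noncomputable def regEmpRisk {d r q P n : ℕ} {I : Fin d → ℕ} (κ : Fin d → ModeKernel)
    (σ : Fin r → Fin q) (lam : ℝ) (A : ProjMatrices q P I) (T : Fin n → CPTensor r I × ℝ)
    (g : TensorRKHS r κ (fun _ : Fin d => P)) : ℝ :=
  1 / (n : ℝ) * ∑ i, sqHinge (T i).2 (g (project σ A (T i).1)) + lam * ‖g‖ ^ 2

/-- The outcomes `(A, T)` (projection matrices, training set) for which the support tensor machine
trained on the projected data, i.e. the minimizer of the regularized empirical risk, exists, is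
unique, and has excess risk at most `b`. -/
def goodEvent {d r q : ℕ} {I : Fin d → ℕ} (κ : Fin d → ModeKernel) (σ : Fin r → Fin q)
    (Q : Measure (CPTensor r I × ℝ)) (P n : ℕ) (lam b : ℝ) :
    Set (ProjMatrices q P I × (Fin n → CPTensor r I × ℝ)) :=
  {ω | ∃ g : TensorRKHS r κ (fun _ : Fin d => P),
    (∀ g', g' ≠ g → regEmpRisk κ σ lam ω.1 ω.2 g < regEmpRisk κ σ lam ω.1 ω.2 g') ∧
    risk Q (fun X => g (project σ ω.1 X)) ≤ bayesRisk Q + ENNReal.ofReal b}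

/-- With projection error `ε = n^(-μ/(2d))`, regularization `lam = n^(-μ/(2η+3))`, the matching
projected dimension, a training set of `n` independent draws from `Q` and independent projection
matrices, the excess risk is at most `C √(log(2/δ₂)) n^(-μη/(2η+3))` with probability at least
`(1-δ₂)(1-2δ₁)`. This is stated for the exceptional set, whose (outer) measure is at most the
complementary probability. -/
def RateBound {d r q : ℕ} {I : Fin d → ℕ} (κ : Fin d → ModeKernel) (σ : Fin r → Fin q)
    (Q : Measure (CPTensor r I × ℝ)) (η μ : ℝ) (n : ℕ) (δ₁ δ₂ C : ℝ) : Prop :=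
  let P : ℕ := projDim d r ((1 / (n : ℝ)) ^ (μ / (2 * d))) n δ₁
  let lam : ℝ := (1 / (n : ℝ)) ^ (μ / (2 * η + 3))
  let b : ℝ := C * Real.sqrt (Real.log (2 / δ₂)) * (1 / (n : ℝ)) ^ (μ * η / (2 * η + 3))
  ((projLaw q P I).prod (Measure.pi fun _ : Fin n => Q)) (goodEvent κ σ Q P n lam b)ᶜ
    ≤ ENNReal.ofReal (1 - (1 - δ₂) * (1 - 2 * δ₁))

/-! Let `g₀` minimize the regularized population risk on the projected tensors. The excess risk of
the trained classifier splits into the bias of `g₀` and the deviation of the empirical minimizer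
from `g₀`. Both are transferred by `risk_add_le`: the losses at `t + s` and `t - s` add up to at
most twice the loss at `t` plus `2 s²`, and `f - δ` cannot beat the Bayes risk, so the excess risk
of `f + δ` is at most twice that of `f` plus twice the mean square of `δ`.

Bias. Kernel values before and after projection are not compared pointwise; the quadratic forms `φ ↦
‖∫ φ K(X, ·)‖²` are. A profile that is positive semidefinite in every dimension is very special: a
radial one is a limit of mixtures of `exp (-s t)` (Schoenberg), and a Lipschitz inner product one is
affine. Either way the kernel is a limit of second moments of functions of `⟨ζ, x⟩` with `ζ`
standard Gaussian, and so is the tensor kernel. Since `⟨ζ, V x⟩ = ⟨Vᵀ ζ, x⟩`, projecting only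
replaces the standard law of the frequency by the Gaussian law with covariance `Vᵀ V`. If `Vᵀ V` is
entrywise within `τ₀ / T` of the identity, the standard density is at most twice the other one on
the ball of squared radius `T`; outside, Gaussian moments leave `T⁻ᵖ` for any chosen `p`. This is
`exists_kernel_domination`: the form of the kernel is at most `2 r` times the projected form plus `C
T⁻ᵖ ∫ φ²`, the factor `r` being the price for components that are projected by different matrices.
Ridge regression (`exists_approximation`) turns the domination into an approximation of every `f` by
a function of the projected tensor, at cost `2 r λ ‖f‖²`, and the assumption on `D(λ)` bounds the
bias by a multiple of `λ^η` (`risk_minimizer_le`).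

By Chebyshev (`measure_nearIsometries_compl_le`) the entries of `Vᵀ V - 1` are at most `P^(-1/4)`
outside an event of probability `O(P^(-1/2))`. With `T` proportional to `P^(1/4)` and `p = 4 d` the
remainder is `O(P⁻ᵈ)`, hence `O(n^(-μ))`, while `λ ≥ n^(-μ/3)`. The constants depend on the tensor
sizes, on `q` and on `δ₁`, but they only affect how large `n` has to be.

Deviation. By strong convexity `λ ‖g - g₀‖` is at most the norm of the empirical gradient at `g₀`,
an average of independent centred vectors, to which a Hilbert space Bernstein inequality applies
(`measure_norm_sum_ge_le`). The variance is free of `λ` because the squared derivative of the loss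
is at most four times the loss. Interpolation with `‖g‖, ‖g₀‖ ≤ λ^(-1/2)` gives `‖g - g₀‖² ≲ √(log
(2/δ₂) / n) λ^(-3/2)`, and the choice of `λ` ensures `n^(-1/2) ≤ λ^(η + 3/2)`.

This proves the second claim. For the first, finitely many `n` remain; there `‖g‖ ≤ λ^(-1/2)` and
tightness of the law of the matrices give a crude bound that is absorbed in the constant. -/

/-! ### The squared hinge loss: convexity, smoothness, self-bounding derivative. -/

section Loss

/-- The derivative of the squared hinge loss in its second argument. -/
noncomputable def sqHingeDeriv (y t : ℝ) : ℝ := -2 * y * max 0 (1 - y * t)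

theorem sqHinge_nonneg (y t : ℝ) : 0 ≤ sqHinge y t := sq_nonneg _

theorem continuous_sqHinge : Continuous fun p : ℝ × ℝ => sqHinge p.1 p.2 := by
  unfold sqHinge; fun_prop

theorem continuous_sqHingeDeriv : Continuous fun p : ℝ × ℝ => sqHingeDeriv p.1 p.2 := by
  unfold sqHingeDeriv; fun_prop

theorem sqHinge_lower (y t s : ℝ) :
    sqHinge y t + sqHingeDeriv y t * (s - t) ≤ sqHinge y s := by
  unfold sqHinge sqHingeDeriv
  rcases le_total 0 (1 - y * t) with h | h <;> rcases le_total 0 (1 - y * s) with h' | h' <;>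
    simp only [max_eq_left, max_eq_right, h, h'] <;> nlinarith [sq_nonneg (y * (s - t))]

theorem sqHinge_upper (y t s : ℝ) :
    sqHinge y s ≤ sqHinge y t + sqHingeDeriv y t * (s - t) + y ^ 2 * (s - t) ^ 2 := by
  unfold sqHinge sqHingeDeriv
  rcases le_total 0 (1 - y * t) with h | h <;> rcases le_total 0 (1 - y * s) with h' | h' <;>
    simp only [max_eq_left, max_eq_right, h, h'] <;> nlinarith [sq_nonneg (y * (s - t))]

/-- The self-bounding property: a small loss forces a small derivative. It lets the risk control the
variance of the gradient noise, without a power of `1 / lam`. -/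
theorem sqHingeDeriv_sq (y t : ℝ) : sqHingeDeriv y t ^ 2 = 4 * y ^ 2 * sqHinge y t := by
  unfold sqHinge sqHingeDeriv; ring

/-- The first-order terms of the upper models at `t + s` and `t - s` cancel. This is what makes the
comparison in `risk_add_le` quadratic in the perturbation. -/
theorem sqHinge_add_sub (y t s : ℝ) :
    sqHinge y (t + s) + sqHinge y (t - s) ≤ 2 * sqHinge y t + 2 * (y ^ 2 * s ^ 2) := by
  have h1 := sqHinge_upper y t (t + s)
  have h2 := sqHinge_upper y t (t - s)
  nlinarith

theorem sqHinge_le {y t : ℝ} (hy : |y| ≤ 1) : sqHinge y t ≤ (1 + |t|) ^ 2 := by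
  have h : |y * t| ≤ |t| := by
    rw [abs_mul]; exact mul_le_of_le_one_left (abs_nonneg _) hy
  unfold sqHinge
  refine pow_le_pow_left₀ (le_max_left _ _) (max_le (by positivity) ?_) 2
  linarith [neg_abs_le (y * t)]

theorem abs_sqHingeDeriv_le {y t : ℝ} (hy : |y| ≤ 1) : |sqHingeDeriv y t| ≤ 2 * (1 + |t|) := by
  have h : sqHingeDeriv y t ^ 2 ≤ (2 * (1 + |t|)) ^ 2 := by
    rw [sqHingeDeriv_sq]
    have h1 := sqHinge_le (t := t) hy
    have h2 : y ^ 2 ≤ 1 := by rw [← sq_abs]; exact pow_le_one₀ (abs_nonneg _) hy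
    nlinarith [sqHinge_nonneg y t]
  exact abs_le_of_sq_le_sq h (by positivity)

theorem sqHinge_zero (y : ℝ) : sqHinge y 0 = 1 := by simp [sqHinge]

end Loss

/-! ### Strongly convex smooth functions on a Hilbert space. -/

section Minimizer

variable {H : Type*} [NormedAddCommGroup H] [InnerProductSpace ℝ H]

/-- A function between two quadratic models at every point, the lower one strongly convex, has a
point where the gradient of the models vanishes. -/
theorem exists_gradient_eq_zero [CompleteSpace H] {J : H → ℝ} {G : H → H} {lam M : ℝ}
    (hlam : 0 < lam)
    (lower : ∀ g₀ g, J g₀ + inner ℝ (G g₀) (g - g₀) + lam * ‖g - g₀‖ ^ 2 ≤ J g)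
    (upper : ∀ g₀ g, J g ≤ J g₀ + inner ℝ (G g₀) (g - g₀) + M * ‖g - g₀‖ ^ 2) :
    ∃ g, G g = 0 := by
  classical
  have bdd : BddBelow (Set.range J) := by
    refine ⟨J 0 - ‖G 0‖ ^ 2 / (4 * lam), ?_⟩
    rintro _ ⟨g, rfl⟩
    have h := lower 0 g
    have h1 : -(‖G 0‖ * ‖g - 0‖) ≤ inner ℝ (G 0) (g - 0) :=
      neg_le_of_abs_le (abs_real_inner_le_norm _ _)
    have h2 : 0 ≤ (‖G 0‖ - 2 * lam * ‖g - 0‖) ^ 2 / (4 * lam) := by positivity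
    have h3 : (‖G 0‖ - 2 * lam * ‖g - 0‖) ^ 2 / (4 * lam)
        = ‖G 0‖ ^ 2 / (4 * lam) - ‖G 0‖ * ‖g - 0‖ + lam * ‖g - 0‖ ^ 2 := by
      field_simp; ring
    linarith
  set m := ⨅ g, J g with hm
  have hmJ : ∀ g, m ≤ J g := fun g => ciInf_le bdd g
  -- the distance of two near-minimizers
  have key : ∀ a b : H, lam / 4 * ‖a - b‖ ^ 2 ≤ (J a - m) + (J b - m) := by
    intro a b
    set c := (2⁻¹ : ℝ) • (a + b)
    have ha := lower c a
    have hb := lower c b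
    have e1 : a - c = (2⁻¹ : ℝ) • (a - b) := by simp only [c]; module
    have e2 : b - c = -((2⁻¹ : ℝ) • (a - b)) := by simp only [c]; module
    rw [e1] at ha
    rw [e2, inner_neg_right, norm_neg] at hb
    rw [norm_smul, Real.norm_eq_abs, abs_of_pos (by norm_num : (0 : ℝ) < 2⁻¹)] at ha hb
    have := hmJ c
    nlinarith [sq_nonneg (‖a - b‖)]
  have hseq : ∀ n : ℕ, ∃ g, J g < m + 1 / ((n : ℝ) + 1) := fun n =>
    exists_lt_of_ciInf_lt (by rw [← hm]; linarith [Nat.one_div_pos_of_nat (α := ℝ) (n := n)])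
  choose u hu using hseq
  have hcau : CauchySeq u := by
    refine cauchySeq_of_le_tendsto_0 (fun n : ℕ => Real.sqrt (8 / lam * (1 / ((n : ℝ) + 1)))) ?_ ?_
    · intro n k N hn hk
      rw [dist_eq_norm]
      refine Real.le_sqrt_of_sq_le ?_
      have h := key (u n) (u k)
      have h1 : 1 / ((n : ℝ) + 1) ≤ 1 / ((N : ℝ) + 1) := by gcongr
      have h2 : 1 / ((k : ℝ) + 1) ≤ 1 / ((N : ℝ) + 1) := by gcongr
      have h3 : lam / 4 * ‖u n - u k‖ ^ 2 ≤ 2 * (1 / ((N : ℝ) + 1)) := by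
        linarith [hu n, hu k]
      calc ‖u n - u k‖ ^ 2 = 4 / lam * (lam / 4 * ‖u n - u k‖ ^ 2) := by field_simp
        _ ≤ 4 / lam * (2 * (1 / ((N : ℝ) + 1))) := by gcongr
        _ = _ := by ring
    · have : Filter.Tendsto (fun n : ℕ => 8 / lam * (1 / ((n : ℝ) + 1))) Filter.atTop (nhds 0) := by
        simpa using tendsto_one_div_add_atTop_nhds_zero_nat.const_mul (8 / lam)
      have h := (Real.continuous_sqrt.tendsto 0).comp this
      rwa [Real.sqrt_zero] at h
  obtain ⟨g, hg⟩ := cauchySeq_tendsto_of_complete hcau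
  -- Semicontinuity comes from the lower model at the limit `g`: it bounds `J g` by `J (u n)` plus
  -- an inner product that tends to zero.
  have hJg : J g ≤ m := by
    have hlim : Filter.Tendsto (fun n : ℕ => m + 1 / ((n : ℝ) + 1) + (-inner ℝ (G g) (u n - g)))
        Filter.atTop (nhds (m + 0 + -inner ℝ (G g) (g - g))) := by
      refine (tendsto_const_nhds.add tendsto_one_div_add_atTop_nhds_zero_nat).add ?_
      exact ((continuous_const.inner (continuous_id.sub continuous_const)).tendsto g).comp hg |>.neg
    simp only [sub_self, inner_zero_right, neg_zero, add_zero] at hlim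
    refine ge_of_tendsto' hlim fun n => ?_
    have := lower g (u n)
    have h0 : 0 ≤ lam * ‖u n - g‖ ^ 2 := by positivity
    linarith [hu n]
  refine ⟨g, ?_⟩
  by_contra hne
  have hpos : 0 < ‖G g‖ := norm_pos_iff.mpr hne
  have hM : 0 ≤ M := by
    have h1 := lower g (g + G g)
    have h2 := upper g (g + G g)
    have h3 : 0 < ‖G g‖ ^ 2 := by positivity
    simp only [add_sub_cancel_left] at h1 h2
    nlinarith
  -- A gradient step of length below `1 / M` would decrease the upper model strictly; the added `1`
  -- covers `M = 0`.
  set s := 1 / (M + 1)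
  have hs : 0 < s := by positivity
  have h := upper g (g - s • G g)
  have e : g - s • G g - g = -(s • G g) := by abel
  rw [e, inner_neg_right, inner_smul_right, real_inner_self_eq_norm_sq, norm_neg, norm_smul,
    Real.norm_eq_abs, abs_of_pos hs] at h
  have h2 := hmJ (g - s • G g)
  have h3 : M * s < 1 := by
    simp only [s]; rw [mul_one_div, div_lt_one (by positivity)]; linarith
  have h4 : 0 < s * ‖G g‖ ^ 2 := by positivity
  nlinarith [mul_pos h4 (sub_pos.mpr h3)]

/-- Stability: the gradient at `g₀` measures how far a better point can be. It is applied to the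
empirical risk at the population minimizer, and to the dependence of the minimizer on the matrices.
-/
theorem norm_sub_le_norm_gradient {J : H → ℝ} {G : H → H} {lam : ℝ}
    (lower : ∀ g₀ g, J g₀ + inner ℝ (G g₀) (g - g₀) + lam * ‖g - g₀‖ ^ 2 ≤ J g)
    {g₀ g : H} (h : J g ≤ J g₀) : lam * ‖g - g₀‖ ≤ ‖G g₀‖ := by
  rcases eq_or_ne g g₀ with rfl | hne
  · simp
  have hpos : 0 < ‖g - g₀‖ := norm_pos_iff.mpr (sub_ne_zero.mpr hne)
  have h1 := lower g₀ g
  have h2 : -(‖G g₀‖ * ‖g - g₀‖) ≤ inner ℝ (G g₀) (g - g₀) :=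
    neg_le_of_abs_le (abs_real_inner_le_norm _ _)
  have h3 : lam * ‖g - g₀‖ * ‖g - g₀‖ ≤ ‖G g₀‖ * ‖g - g₀‖ := by nlinarith
  exact le_of_mul_le_mul_right h3 hpos

end Minimizer

/-! ### The regularized risk and its quadratic models. -/

section Objective

variable {H : Type*} [NormedAddCommGroup H] [InnerProductSpace ℝ H] {Ω : Type*} [MeasurableSpace Ω]

/-- The regularized risk of the function `z ↦ ⟨Φ z, g⟩` with labels `Y z`. -/
noncomputable def regRisk (ρ : Measure Ω) (Y : Ω → ℝ) (Φ : Ω → H) (lam : ℝ) (g : H) : ℝ :=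
  ∫ z, sqHinge (Y z) (inner ℝ (Φ z) g) ∂ρ + lam * ‖g‖ ^ 2

/-- The gradient of the regularized risk. -/
noncomputable def regRiskGrad (ρ : Measure Ω) (Y : Ω → ℝ) (Φ : Ω → H) (lam : ℝ) (g : H) : H :=
  ∫ z, sqHingeDeriv (Y z) (inner ℝ (Φ z) g) • Φ z ∂ρ + (2 * lam) • g

variable {ρ : Measure Ω} [IsFiniteMeasure ρ] {Y : Ω → ℝ} {Φ : Ω → H} {κ : ℝ}

theorem abs_inner_le_of_norm_le {x g : H} (hx : ‖x‖ ≤ κ) : |inner ℝ x g| ≤ κ * ‖g‖ :=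
  (abs_real_inner_le_norm _ _).trans (by gcongr)

theorem integrable_sqHinge_inner (hYm : Measurable Y) (hΦm : StronglyMeasurable Φ)
    (hY : ∀ᵐ z ∂ρ, |Y z| ≤ 1) (hΦ : ∀ᵐ z ∂ρ, ‖Φ z‖ ≤ κ) (g : H) :
    Integrable (fun z => sqHinge (Y z) (inner ℝ (Φ z) g)) ρ := by
  refine Integrable.of_bound (C := (1 + κ * ‖g‖) ^ 2) ?_ ?_
  · exact (continuous_sqHinge.comp_stronglyMeasurable
      (hYm.stronglyMeasurable.prodMk (hΦm.inner stronglyMeasurable_const))).aestronglyMeasurable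
  · filter_upwards [hY, hΦ] with z h1 h2
    rw [Real.norm_of_nonneg (sqHinge_nonneg _ _)]
    refine (sqHinge_le h1).trans ?_
    have := abs_inner_le_of_norm_le (g := g) h2
    gcongr

theorem stronglyMeasurable_sqHingeDeriv_smul (hYm : Measurable Y) (hΦm : StronglyMeasurable Φ)
    (g : H) : StronglyMeasurable (fun z => sqHingeDeriv (Y z) (inner ℝ (Φ z) g) • Φ z) :=
  (continuous_sqHingeDeriv.comp_stronglyMeasurable
      (hYm.stronglyMeasurable.prodMk (hΦm.inner stronglyMeasurable_const))).smul hΦm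

theorem norm_sqHingeDeriv_smul_le {y : ℝ} {x g : H} (hy : |y| ≤ 1) (hx : ‖x‖ ≤ κ) :
    ‖sqHingeDeriv y (inner ℝ x g) • x‖ ≤ 2 * (1 + κ * ‖g‖) * κ := by
  rw [norm_smul, Real.norm_eq_abs]
  have h1 := abs_sqHingeDeriv_le (t := inner ℝ x g) hy
  have h2 := abs_inner_le_of_norm_le (g := g) hx
  have h0 : 0 ≤ κ := (norm_nonneg _).trans hx
  gcongr
  linarith

theorem integrable_sqHingeDeriv_smul (hYm : Measurable Y) (hΦm : StronglyMeasurable Φ)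
    (hY : ∀ᵐ z ∂ρ, |Y z| ≤ 1) (hΦ : ∀ᵐ z ∂ρ, ‖Φ z‖ ≤ κ) (g : H) :
    Integrable (fun z => sqHingeDeriv (Y z) (inner ℝ (Φ z) g) • Φ z) ρ := by
  refine Integrable.of_bound (C := 2 * (1 + κ * ‖g‖) * κ)
    (stronglyMeasurable_sqHingeDeriv_smul hYm hΦm g).aestronglyMeasurable ?_
  filter_upwards [hY, hΦ] with z h1 h2 using norm_sqHingeDeriv_smul_le h1 h2

theorem inner_regRiskGrad [CompleteSpace H] (hYm : Measurable Y) (hΦm : StronglyMeasurable Φ)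
    (hY : ∀ᵐ z ∂ρ, |Y z| ≤ 1) (hΦ : ∀ᵐ z ∂ρ, ‖Φ z‖ ≤ κ) (lam : ℝ) (g v : H) :
    inner ℝ (regRiskGrad ρ Y Φ lam g) v
      = ∫ z, sqHingeDeriv (Y z) (inner ℝ (Φ z) g) * inner ℝ (Φ z) v ∂ρ + 2 * lam * inner ℝ g v := by
  unfold regRiskGrad
  rw [inner_add_left, inner_smul_left, real_inner_comm, ← integral_inner
    (integrable_sqHingeDeriv_smul hYm hΦm hY hΦ g)]
  simp only [inner_smul_right, real_inner_comm v]
  simp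

theorem norm_sq_expand (g₀ g : H) :
    ‖g‖ ^ 2 = ‖g₀‖ ^ 2 + 2 * inner ℝ g₀ (g - g₀) + ‖g - g₀‖ ^ 2 := by
  rw [← norm_add_sq_real]; simp

theorem integrable_sqHingeDeriv_mul (hYm : Measurable Y) (hΦm : StronglyMeasurable Φ)
    (hY : ∀ᵐ z ∂ρ, |Y z| ≤ 1) (hΦ : ∀ᵐ z ∂ρ, ‖Φ z‖ ≤ κ) (g v : H) :
    Integrable (fun z => sqHingeDeriv (Y z) (inner ℝ (Φ z) g) * inner ℝ (Φ z) v) ρ := by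
  have h := (integrable_sqHingeDeriv_smul hYm hΦm hY hΦ g).inner_const (𝕜 := ℝ) v
  simpa [inner_smul_left] using h

theorem regRisk_lower [CompleteSpace H] (hYm : Measurable Y) (hΦm : StronglyMeasurable Φ)
    (hY : ∀ᵐ z ∂ρ, |Y z| ≤ 1) (hΦ : ∀ᵐ z ∂ρ, ‖Φ z‖ ≤ κ) (lam : ℝ) (g₀ g : H) :
    regRisk ρ Y Φ lam g₀ + inner ℝ (regRiskGrad ρ Y Φ lam g₀) (g - g₀) + lam * ‖g - g₀‖ ^ 2
      ≤ regRisk ρ Y Φ lam g := by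
  rw [inner_regRiskGrad hYm hΦm hY hΦ]
  unfold regRisk
  have h0 := integrable_sqHinge_inner hYm hΦm hY hΦ g₀
  have h1 := integrable_sqHingeDeriv_mul hYm hΦm hY hΦ g₀ (g - g₀)
  have h : ∫ z, (sqHinge (Y z) (inner ℝ (Φ z) g₀)
      + sqHingeDeriv (Y z) (inner ℝ (Φ z) g₀) * inner ℝ (Φ z) (g - g₀)) ∂ρ
      ≤ ∫ z, sqHinge (Y z) (inner ℝ (Φ z) g) ∂ρ := by
    refine integral_mono (h0.add h1) (integrable_sqHinge_inner hYm hΦm hY hΦ g) fun z => ?_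
    simpa only [inner_sub_right] using sqHinge_lower (Y z) (inner ℝ (Φ z) g₀) (inner ℝ (Φ z) g)
  rw [integral_add h0 h1] at h
  rw [norm_sq_expand g₀ g]
  linarith

theorem regRisk_upper [CompleteSpace H] (hYm : Measurable Y) (hΦm : StronglyMeasurable Φ)
    (hY : ∀ᵐ z ∂ρ, |Y z| ≤ 1) (hΦ : ∀ᵐ z ∂ρ, ‖Φ z‖ ≤ κ) (lam : ℝ) (g₀ g : H) :
    regRisk ρ Y Φ lam g ≤ regRisk ρ Y Φ lam g₀ + inner ℝ (regRiskGrad ρ Y Φ lam g₀) (g - g₀)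
      + (ρ.real Set.univ * κ ^ 2 + lam) * ‖g - g₀‖ ^ 2 := by
  rw [inner_regRiskGrad hYm hΦm hY hΦ]
  unfold regRisk
  have h0 := integrable_sqHinge_inner hYm hΦm hY hΦ g₀
  have h1 := integrable_sqHingeDeriv_mul hYm hΦm hY hΦ g₀ (g - g₀)
  have h : ∫ z, sqHinge (Y z) (inner ℝ (Φ z) g) ∂ρ ≤ ∫ z, (sqHinge (Y z) (inner ℝ (Φ z) g₀)
      + sqHingeDeriv (Y z) (inner ℝ (Φ z) g₀) * inner ℝ (Φ z) (g - g₀)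
      + κ ^ 2 * ‖g - g₀‖ ^ 2) ∂ρ := by
    refine integral_mono_ae (integrable_sqHinge_inner hYm hΦm hY hΦ g)
      ((h0.add h1).add (integrable_const _)) ?_
    filter_upwards [hY, hΦ] with z h2 h3
    have h4 := sqHinge_upper (Y z) (inner ℝ (Φ z) g₀) (inner ℝ (Φ z) g)
    rw [← inner_sub_right] at h4
    have h5 : Y z ^ 2 ≤ 1 := by rw [← sq_abs]; exact pow_le_one₀ (abs_nonneg _) h2
    have h6 : (inner ℝ (Φ z) (g - g₀) : ℝ) ^ 2 ≤ κ ^ 2 * ‖g - g₀‖ ^ 2 := by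
      rw [← sq_abs, ← mul_pow]
      exact pow_le_pow_left₀ (abs_nonneg _) (abs_inner_le_of_norm_le h3) 2
    have h7 : 0 ≤ (inner ℝ (Φ z) (g - g₀) : ℝ) ^ 2 := sq_nonneg _
    nlinarith
  rw [integral_add (f := fun z => sqHinge (Y z) (inner ℝ (Φ z) g₀)
      + sqHingeDeriv (Y z) (inner ℝ (Φ z) g₀) * inner ℝ (Φ z) (g - g₀)) (h0.add h1)
      (integrable_const _), integral_add h0 h1] at h
  simp only [integral_const, smul_eq_mul] at h
  rw [norm_sq_expand g₀ g]
  linarith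

theorem exists_regRiskGrad_eq_zero [CompleteSpace H] (hYm : Measurable Y)
    (hΦm : StronglyMeasurable Φ) (hY : ∀ᵐ z ∂ρ, |Y z| ≤ 1) (hΦ : ∀ᵐ z ∂ρ, ‖Φ z‖ ≤ κ) {lam : ℝ}
    (hlam : 0 < lam) : ∃ g, regRiskGrad ρ Y Φ lam g = 0 :=
  exists_gradient_eq_zero hlam (regRisk_lower hYm hΦm hY hΦ lam) (regRisk_upper hYm hΦm hY hΦ lam)

end Objective

/-! ### A Bernstein inequality in Hilbert space, by means of `cosh`. -/

section Concentration

/-- As a function of the square of its argument, `cosh` is a power series with nonnegative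
coefficients, hence convex. -/
theorem cosh_le_of_sq_eq {x u v p : ℝ} (hp : 0 ≤ p) (hp' : p ≤ 1)
    (h : x ^ 2 = p * u ^ 2 + (1 - p) * v ^ 2) :
    Real.cosh x ≤ p * Real.cosh u + (1 - p) * Real.cosh v := by
  refine hasSum_le (fun n => ?_) (Real.hasSum_cosh x)
    (((Real.hasSum_cosh u).mul_left p).add ((Real.hasSum_cosh v).mul_left (1 - p)))
  have hc := (convexOn_pow n).2 (sq_nonneg u) (sq_nonneg v) hp (sub_nonneg.mpr hp') (by ring)
  simp only [smul_eq_mul, ← h, ← pow_mul] at hc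
  calc x ^ (2 * n) / ((2 * n).factorial : ℝ)
      ≤ (p * u ^ (2 * n) + (1 - p) * v ^ (2 * n)) / ((2 * n).factorial : ℝ) := by gcongr
    _ = _ := by ring

variable {H : Type*} [NormedAddCommGroup H] [InnerProductSpace ℝ H]

/-- The smoothness of `cosh ‖·‖` on a Hilbert space. -/
theorem cosh_norm_add_le (x y : H) :
    Real.cosh ‖x + y‖ ≤ Real.cosh ‖x‖ * (Real.exp ‖y‖ - ‖y‖)
      + Real.sinh ‖x‖ / ‖x‖ * inner ℝ x y := by
  rcases eq_or_ne x 0 with rfl | hx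
  · have : Real.cosh ‖y‖ ≤ Real.exp ‖y‖ - ‖y‖ := by
      have h1 := Real.cosh_add_sinh ‖y‖
      have h2 : ‖y‖ ≤ Real.sinh ‖y‖ := Real.self_le_sinh_iff.mpr (norm_nonneg y)
      linarith
    simpa using this
  rcases eq_or_ne y 0 with rfl | hy
  · simp
  have ha : 0 < ‖x‖ := norm_pos_iff.mpr hx
  have hb : 0 < ‖y‖ := norm_pos_iff.mpr hy
  set a := ‖x‖
  set b := ‖y‖
  set t : ℝ := inner ℝ x y
  have hab : 0 < a * b := mul_pos ha hb
  have ht : |t| ≤ a * b := abs_real_inner_le_norm x y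
  set c := t / (a * b)
  have hc : c * (a * b) = t := div_mul_cancel₀ _ hab.ne'
  have hc1 : c ≤ 1 := (div_le_one hab).mpr ((le_abs_self _).trans ht)
  have hc2 : -1 ≤ c := by
    rw [le_div_iff₀ hab]; linarith [neg_abs_le t]
  -- With `c` the cosine of the angle, `‖x + y‖²` is the mean of `(a + b)²` and `(a - b)²` with
  -- weights `(1 ± c) / 2`, the values for parallel and antiparallel vectors.
  have h1 := cosh_le_of_sq_eq (x := ‖x + y‖) (u := a + b) (v := a - b) (p := (1 + c) / 2)
    (by linarith) (by linarith) (by rw [norm_add_sq_real]; change a ^ 2 + 2 * t + b ^ 2 = _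
                                    rw [← hc]; ring)
  rw [Real.cosh_add, Real.cosh_sub] at h1
  have h2 : Real.cosh ‖x + y‖ ≤ Real.cosh a * Real.cosh b + c * (Real.sinh a * Real.sinh b) := by
    linarith
  have hsb : b ≤ Real.sinh b := Real.self_le_sinh_iff.mpr hb.le
  have hsa : 0 < Real.sinh a := Real.sinh_pos_iff.mpr ha
  have h3 : c * (Real.sinh a * (Real.sinh b - b)) ≤ Real.cosh a * (Real.sinh b - b) := by
    calc c * (Real.sinh a * (Real.sinh b - b)) ≤ 1 * (Real.sinh a * (Real.sinh b - b)) := by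
          refine mul_le_mul_of_nonneg_right hc1 (mul_nonneg hsa.le (sub_nonneg.mpr hsb))
      _ ≤ _ := by
          rw [one_mul]
          exact mul_le_mul_of_nonneg_right (Real.sinh_lt_cosh a).le (sub_nonneg.mpr hsb)
  have h4 : Real.sinh a / a * t = c * (Real.sinh a * b) := by
    rw [← hc]; field_simp
  rw [h4, ← Real.cosh_add_sinh b]
  nlinarith

variable [CompleteSpace H] {Ω : Type*} [MeasurableSpace Ω] {ρ : Measure Ω} [IsProbabilityMeasure ρ]

theorem exp_sub_le {u : ℝ} (h0 : 0 ≤ u) (h1 : u ≤ 1) : Real.exp u - u ≤ 1 + u ^ 2 := by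
  have := Real.abs_exp_sub_one_sub_id_le (x := u) (by rwa [abs_of_nonneg h0])
  linarith [le_abs_self (Real.exp u - 1 - u)]

/-- The term of `cosh_norm_add_le` that is linear in the increment has mean zero, so one more
summand multiplies the expectation by at most `1 + v ≤ exp v`. -/
theorem lintegral_cosh_norm_add_le {ξ : Ω → H} (hξ : StronglyMeasurable ξ) {b v : ℝ}
    (hb : ∀ᵐ z ∂ρ, ‖ξ z‖ ≤ b) (hb1 : b ≤ 1) (h0 : ∫ z, ξ z ∂ρ = 0) (hv : ∫ z, ‖ξ z‖ ^ 2 ∂ρ ≤ v)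
    (S : H) :
    ∫⁻ z, ENNReal.ofReal (Real.cosh ‖S + ξ z‖) ∂ρ
      ≤ ENNReal.ofReal (Real.exp v) * ENNReal.ofReal (Real.cosh ‖S‖) := by
  have hint : Integrable ξ ρ := Integrable.of_bound hξ.aestronglyMeasurable b hb
  have hsq : Integrable (fun z => ‖ξ z‖ ^ 2) ρ := by
    refine Integrable.of_bound (hξ.norm.pow 2).aestronglyMeasurable (b ^ 2) ?_
    filter_upwards [hb] with z hz
    rw [Real.norm_of_nonneg (by positivity)]
    gcongr
  set F : Ω → ℝ := fun z => Real.cosh ‖S‖ * (1 + ‖ξ z‖ ^ 2) + Real.sinh ‖S‖ / ‖S‖ * inner ℝ S (ξ z)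
  have hF1 : Integrable (fun z => Real.cosh ‖S‖ * (1 + ‖ξ z‖ ^ 2)) ρ :=
    ((integrable_const 1).add hsq).const_mul _
  have hF2 : Integrable (fun z => Real.sinh ‖S‖ / ‖S‖ * inner ℝ S (ξ z)) ρ :=
    (hint.const_inner S).const_mul _
  have hle : ∀ᵐ z ∂ρ, Real.cosh ‖S + ξ z‖ ≤ F z := by
    filter_upwards [hb] with z hz
    refine (cosh_norm_add_le S (ξ z)).trans ?_
    have := exp_sub_le (norm_nonneg (ξ z)) (hz.trans hb1)
    have hc := Real.cosh_pos ‖S‖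
    simp only [F]
    gcongr
  calc ∫⁻ z, ENNReal.ofReal (Real.cosh ‖S + ξ z‖) ∂ρ
      ≤ ∫⁻ z, ENNReal.ofReal (F z) ∂ρ :=
        lintegral_mono_ae (hle.mono fun z hz => ENNReal.ofReal_le_ofReal hz)
    _ = ENNReal.ofReal (∫ z, F z ∂ρ) := by
        rw [ofReal_integral_eq_lintegral_ofReal (f := F) (hF1.add hF2)]
        exact hle.mono fun z hz => (Real.cosh_pos _).le.trans hz
    _ ≤ ENNReal.ofReal (Real.exp v * Real.cosh ‖S‖) := by
        refine ENNReal.ofReal_le_ofReal ?_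
        simp only [F]
        rw [integral_add hF1 hF2, integral_const_mul, integral_const_mul, integral_inner hint, h0,
          inner_zero_right, mul_zero, add_zero, integral_add (integrable_const _) hsq]
        simp only [integral_const, probReal_univ, smul_eq_mul, mul_one]
        rw [mul_comm]
        have := Real.add_one_le_exp v
        gcongr
        linarith
    _ = _ := ENNReal.ofReal_mul (Real.exp_pos v).le

theorem lintegral_cosh_norm_sum_le {ξ : Ω → H} (hξ : StronglyMeasurable ξ) {b v : ℝ}
    (hb : ∀ᵐ z ∂ρ, ‖ξ z‖ ≤ b) (hb1 : b ≤ 1) (h0 : ∫ z, ξ z ∂ρ = 0) (hv : ∫ z, ‖ξ z‖ ^ 2 ∂ρ ≤ v)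
    (n : ℕ) :
    ∫⁻ T, ENNReal.ofReal (Real.cosh ‖∑ i, ξ (T i)‖) ∂(Measure.pi fun _ : Fin n => ρ)
      ≤ ENNReal.ofReal (Real.exp v) ^ n := by
  induction n with
  | zero => simp
  | succ n ih =>
    -- Coordinate `0` is split off and integrated first, with the sum of the others in the role of
    -- the fixed vector `S`.
    have hmp := (measurePreserving_piFinSuccAbove (fun _ : Fin (n + 1) => ρ) 0).symm
    rw [← hmp.map_eq, lintegral_map_equiv]
    have hm : Measurable fun p : Ω × (Fin n → Ω) =>
        ENNReal.ofReal (Real.cosh ‖∑ i, ξ (p.2 i) + ξ p.1‖) := by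
      have h1 : StronglyMeasurable fun p : Ω × (Fin n → Ω) => ∑ i, ξ (p.2 i) + ξ p.1 := by
        refine StronglyMeasurable.add ?_ (hξ.comp_measurable measurable_fst)
        exact Finset.stronglyMeasurable_fun_sum _ fun i _ =>
          hξ.comp_measurable ((measurable_pi_apply i).comp measurable_snd)
      exact ENNReal.measurable_ofReal.comp (Real.continuous_cosh.measurable.comp
        h1.norm.measurable)
    have e : ∀ p : Ω × (Fin n → Ω),
        ∑ i, ξ ((MeasurableEquiv.piFinSuccAbove (fun _ : Fin (n + 1) => Ω) 0).symm p i)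
          = ∑ i, ξ (p.2 i) + ξ p.1 := by
      intro p
      rw [Fin.sum_univ_succ, add_comm]
      simp [MeasurableEquiv.piFinSuccAbove, Fin.insertNthEquiv]
    simp_rw [e]
    rw [lintegral_prod_symm' _ hm]
    calc _ ≤ ∫⁻ T, ENNReal.ofReal (Real.exp v) * ENNReal.ofReal (Real.cosh ‖∑ i, ξ (T i)‖)
            ∂(Measure.pi fun _ : Fin n => ρ) :=
          lintegral_mono fun T => lintegral_cosh_norm_add_le hξ hb hb1 h0 hv _
      _ = ENNReal.ofReal (Real.exp v) * ∫⁻ T, ENNReal.ofReal (Real.cosh ‖∑ i, ξ (T i)‖)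
            ∂(Measure.pi fun _ : Fin n => ρ) := lintegral_const_mul' _ _ ENNReal.ofReal_ne_top
      _ ≤ ENNReal.ofReal (Real.exp v) ^ (n + 1) := by
          rw [pow_succ']; gcongr

/-- A Bernstein type inequality for sums of independent bounded centred vectors in a Hilbert
space. -/
theorem measure_norm_sum_ge_le {ξ : Ω → H} (hξ : StronglyMeasurable ξ) {b v s : ℝ} (hs : 0 < s)
    (hb : ∀ᵐ z ∂ρ, ‖ξ z‖ ≤ b) (hsb : s * b ≤ 1) (h0 : ∫ z, ξ z ∂ρ = 0)
    (hv : ∫ z, ‖ξ z‖ ^ 2 ∂ρ ≤ v) (n : ℕ) (t : ℝ) :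
    (Measure.pi fun _ : Fin n => ρ) {T | t ≤ ‖∑ i, ξ (T i)‖}
      ≤ ENNReal.ofReal (2 * Real.exp (n * (s ^ 2 * v) - s * t)) := by
  have hξ' : StronglyMeasurable fun z => s • ξ z := hξ.const_smul s
  have key := lintegral_cosh_norm_sum_le (ρ := ρ) (b := s * b) (v := s ^ 2 * v) hξ' (by
    filter_upwards [hb] with z hz
    rw [norm_smul, Real.norm_of_nonneg hs.le]; gcongr) hsb
    (by rw [integral_smul, h0, smul_zero])
    (by simp_rw [norm_smul, Real.norm_of_nonneg hs.le, mul_pow]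
        rw [integral_const_mul]; gcongr) n
  have hm : Measurable fun T : Fin n → Ω =>
      ENNReal.ofReal (Real.cosh ‖∑ i, s • ξ (T i)‖) := by
    have h1 : StronglyMeasurable fun T : Fin n → Ω => ∑ i, s • ξ (T i) :=
      Finset.stronglyMeasurable_fun_sum _ fun i _ => hξ'.comp_measurable (measurable_pi_apply i)
    exact ENNReal.measurable_ofReal.comp (Real.continuous_cosh.measurable.comp h1.norm.measurable)
  -- Markov's inequality is applied to `cosh`; the bound `cosh u ≥ exp u / 2` is the origin of the
  -- factor `2`.
  have hsub : {T : Fin n → Ω | t ≤ ‖∑ i, ξ (T i)‖}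
      ⊆ {T | ENNReal.ofReal (Real.exp (s * t) / 2) ≤
          ENNReal.ofReal (Real.cosh ‖∑ i, s • ξ (T i)‖)} := by
    intro T hT
    simp only [Set.mem_ofPred_eq] at hT ⊢
    refine ENNReal.ofReal_le_ofReal ?_
    rw [← Finset.smul_sum, norm_smul, Real.norm_of_nonneg hs.le, Real.cosh_eq]
    have : Real.exp (s * t) ≤ Real.exp (s * ‖∑ i, ξ (T i)‖) := by gcongr
    have := Real.exp_pos (-(s * ‖∑ i, ξ (T i)‖))
    linarith
  have hpos : 0 < Real.exp (s * t) / 2 := by positivity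
  calc _ ≤ _ := measure_mono hsub
    _ ≤ (∫⁻ T, ENNReal.ofReal (Real.cosh ‖∑ i, s • ξ (T i)‖) ∂(Measure.pi fun _ : Fin n => ρ))
          / ENNReal.ofReal (Real.exp (s * t) / 2) :=
        meas_ge_le_lintegral_div hm.aemeasurable (by simpa using hpos) ENNReal.ofReal_ne_top
    _ ≤ ENNReal.ofReal (Real.exp (s ^ 2 * v)) ^ n / ENNReal.ofReal (Real.exp (s * t) / 2) := by
        gcongr
    _ = _ := by
        rw [← ENNReal.ofReal_pow (Real.exp_pos _).le, ← ENNReal.ofReal_div_of_pos hpos,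
          ← Real.exp_nat_mul, Real.exp_sub]
        congr 1
        field_simp

end Concentration

/-! ### The feature map of the tensor kernel: continuity and bounds. -/

section FeatureMap

variable {d r : ℕ} {κ : Fin d → ModeKernel} {I : Fin d → ℕ}

/-- The canonical feature map `X ↦ K(X, ·)` of the tensor kernel. -/
noncomputable def featureMap (κ : Fin d → ModeKernel) (X : CPTensor r I) : TensorRKHS r κ I :=
  RKHS.kerFun (TensorRKHS r κ I) X (1 : ℝ)

theorem inner_featureMap (X : CPTensor r I) (g : TensorRKHS r κ I) :
    inner ℝ (featureMap κ X) g = g X := by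
  unfold featureMap
  rw [RKHS.kerFun_inner]
  simp

theorem inner_featureMap_featureMap (X Y : CPTensor r I) :
    inner ℝ (featureMap κ X) (featureMap κ Y) = tensorKernel κ X Y := by
  rw [inner_featureMap, featureMap, RKHS.kerFun_apply, RKHS.OfKernel.kernel_ofKernel]
  simp [tensorKernelOp]

theorem norm_featureMap_sq (X : CPTensor r I) : ‖featureMap κ X‖ ^ 2 = tensorKernel κ X X := by
  rw [← real_inner_self_eq_norm_sq, inner_featureMap_featureMap]

theorem KernelForm.arg_mem_range (F : KernelForm) {m : ℕ} (a b : EuclideanSpace ℝ (Fin m)) :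
    F.arg a b ∈ F.range := by
  cases F <;> simp [KernelForm.arg, KernelForm.range]

theorem KernelForm.continuous_arg (F : KernelForm) {m : ℕ} :
    Continuous fun p : EuclideanSpace ℝ (Fin m) × EuclideanSpace ℝ (Fin m) => F.arg p.1 p.2 := by
  cases F <;> simp only [KernelForm.arg] <;> fun_prop

theorem ModeKernel.continuous_eval (κ : ModeKernel) {m : ℕ} :
    Continuous fun p : EuclideanSpace ℝ (Fin m) × EuclideanSpace ℝ (Fin m) => κ.eval p.1 p.2 :=
  κ.lipschitz.continuousOn.comp_continuous κ.form.continuous_arg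
    fun p => κ.form.arg_mem_range p.1 p.2

theorem continuous_comp_pair {𝒳 α β : Type*} [TopologicalSpace 𝒳] [TopologicalSpace α]
    [TopologicalSpace β] {F : α → α → β} (hF : Continuous fun p : α × α => F p.1 p.2)
    {f g : 𝒳 → α} (hf : Continuous f) (hg : Continuous g) :
    Continuous fun x => F (f x) (g x) :=
  hF.comp (hf.prodMk hg)

theorem continuous_tensorKernel :
    Continuous fun p : CPTensor r I × CPTensor r I => tensorKernel κ p.1 p.2 := by
  have h1 : ∀ j k, Continuous fun p : CPTensor r I × CPTensor r I => p.1 j k := fun j k => by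
    fun_prop
  have h2 : ∀ j k, Continuous fun p : CPTensor r I × CPTensor r I => p.2 j k := fun j k => by
    fun_prop
  unfold tensorKernel
  refine continuous_finsetSum _ fun k _ => continuous_finsetSum _ fun l _ =>
    continuous_finsetProd _ fun j _ => ?_
  exact continuous_comp_pair (F := fun a b => (κ j).eval a b) (κ j).continuous_eval (h1 j k)
    (h2 j l)

theorem continuous_of_continuous_inner {𝒳 H : Type*} [TopologicalSpace 𝒳] [NormedAddCommGroup H]
    [InnerProductSpace ℝ H] {Φ : 𝒳 → H}
    (h : Continuous fun p : 𝒳 × 𝒳 => (inner ℝ (Φ p.1) (Φ p.2) : ℝ)) : Continuous Φ := by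
  rw [continuous_iff_continuousAt]
  intro X
  rw [ContinuousAt, tendsto_iff_norm_sub_tendsto_zero]
  have hc : Continuous fun Y : 𝒳 => Real.sqrt ((inner ℝ (Φ Y) (Φ Y) : ℝ)
      - 2 * inner ℝ (Φ Y) (Φ X) + inner ℝ (Φ X) (Φ X)) := by
    have h1 := h.comp (continuous_id.prodMk continuous_id : Continuous fun Y : 𝒳 => (Y, Y))
    have h2 := h.comp (continuous_id.prodMk continuous_const : Continuous fun Y : 𝒳 => (Y, X))
    exact Real.continuous_sqrt.comp ((h1.sub (h2.const_mul 2)).add continuous_const)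
  have h3 := hc.tendsto X
  have e : (inner ℝ (Φ X) (Φ X) : ℝ) - 2 * inner ℝ (Φ X) (Φ X) + inner ℝ (Φ X) (Φ X) = 0 := by ring
  rw [e, Real.sqrt_zero] at h3
  refine h3.congr fun Y => ?_
  rw [real_inner_self_eq_norm_sq, real_inner_self_eq_norm_sq, ← norm_sub_sq_real,
    Real.sqrt_sq (norm_nonneg _)]

/-- The distance of two features is an expression in the continuous kernel. Continuity on the second
countable space of tensors yields the strong measurability needed for Bochner integrals in the
reproducing kernel Hilbert space. -/
theorem continuous_featureMap : Continuous (featureMap κ : CPTensor r I → TensorRKHS r κ I) := by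
  refine continuous_of_continuous_inner ?_
  simp_rw [inner_featureMap_featureMap]
  exact continuous_tensorKernel

theorem TensorRKHS.continuous (g : TensorRKHS r κ I) : Continuous g := by
  have h : (g : CPTensor r I → ℝ) = fun X => inner ℝ (featureMap κ X) g := by
    ext X; rw [inner_featureMap]
  rw [h]
  exact continuous_featureMap.inner continuous_const

theorem KernelForm.abs_arg_le (F : KernelForm) {m : ℕ} {a b : EuclideanSpace ℝ (Fin m)} {B : ℝ}
    (ha : ‖a‖ ^ 2 ≤ B) (hb : ‖b‖ ^ 2 ≤ B) : |F.arg a b| ≤ 4 * B := by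
  have h1 : ‖a‖ * ‖b‖ ≤ B := by nlinarith [sq_nonneg (‖a‖ - ‖b‖)]
  cases F
  · simp only [KernelForm.arg]
    rw [abs_of_nonneg (sq_nonneg _), norm_sub_sq_real]
    have := neg_le_of_abs_le (abs_real_inner_le_norm a b)
    nlinarith
  · simp only [KernelForm.arg]
    have := abs_real_inner_le_norm a b
    nlinarith [sq_nonneg ‖a‖]

theorem KernelForm.zero_mem_range (F : KernelForm) : (0 : ℝ) ∈ F.range := by
  cases F <;> simp [KernelForm.range]

theorem ModeKernel.abs_eval_le (κ : ModeKernel) {m : ℕ} {a b : EuclideanSpace ℝ (Fin m)} {B : ℝ}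
    (ha : ‖a‖ ^ 2 ≤ B) (hb : ‖b‖ ^ 2 ≤ B) : |κ.eval a b| ≤ |κ.h 0| + κ.lip * (4 * B) := by
  have h := κ.lipschitz.dist_le_mul _ (κ.form.arg_mem_range a b) 0 κ.form.zero_mem_range
  rw [Real.dist_eq, Real.dist_eq, sub_zero] at h
  have h1 := κ.form.abs_arg_le ha hb
  have h2 : |κ.eval a b| ≤ |κ.h 0| + |κ.h (κ.form.arg a b) - κ.h 0| := by
    have := abs_add_le (κ.h 0) (κ.h (κ.form.arg a b) - κ.h 0)
    rwa [add_sub_cancel] at this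
  refine h2.trans (add_le_add_right (h.trans ?_) _)
  gcongr

/-- A bound for the tensor kernel on tensors whose factors have squared norm at most `B`. -/
noncomputable def kernelBound (r : ℕ) (κ : Fin d → ModeKernel) (B : ℝ) : ℝ :=
  r ^ 2 * ∏ j, (|(κ j).h 0| + (κ j).lip * (4 * B))

theorem abs_tensorKernel_le {X Y : CPTensor r I} {B : ℝ} (hX : ∀ j k, ‖X j k‖ ^ 2 ≤ B)
    (hY : ∀ j k, ‖Y j k‖ ^ 2 ≤ B) : |tensorKernel κ X Y| ≤ kernelBound r κ B := by
  unfold tensorKernel kernelBound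
  have h : ∀ k l, |∏ j, (κ j).eval (X j k) (Y j l)|
      ≤ ∏ j, (|(κ j).h 0| + (κ j).lip * (4 * B)) := by
    intro k l
    rw [Finset.abs_prod]
    exact Finset.prod_le_prod (fun _ _ => abs_nonneg _) fun j _ =>
      (κ j).abs_eval_le (hX j k) (hY j l)
  calc _ ≤ ∑ k : Fin r, ∑ l : Fin r, |∏ j, (κ j).eval (X j k) (Y j l)| :=
        (Finset.abs_sum_le_sum_abs _ _).trans
          (Finset.sum_le_sum fun k _ => Finset.abs_sum_le_sum_abs _ _)
    _ ≤ ∑ k : Fin r, ∑ l : Fin r, ∏ j, (|(κ j).h 0| + (κ j).lip * (4 * B)) :=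
        Finset.sum_le_sum fun k _ => Finset.sum_le_sum fun l _ => h k l
    _ = _ := by simp; ring

theorem kernelBound_nonneg {B : ℝ} (hB : 0 ≤ B) : 0 ≤ kernelBound r κ B := by
  unfold kernelBound
  exact mul_nonneg (by positivity) (Finset.prod_nonneg fun j _ => by positivity)

theorem norm_featureMap_le {X : CPTensor r I} {B : ℝ} (hX : ∀ j k, ‖X j k‖ ^ 2 ≤ B) :
    ‖featureMap κ X‖ ≤ Real.sqrt (kernelBound r κ B) := by
  refine Real.le_sqrt_of_sq_le ?_
  rw [norm_featureMap_sq]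
  exact (le_abs_self _).trans (abs_tensorKernel_le hX hX)

theorem continuous_project {q P : ℕ} (σ : Fin r → Fin q) :
    Continuous fun p : ProjMatrices q P I × CPTensor r I => project σ p.1 p.2 := by
  refine continuous_pi fun j => continuous_pi fun k => ?_
  have h : Continuous fun p : ProjMatrices q P I × CPTensor r I =>
      (Matrix.of (p.1 j (σ k))).mulVec (p.2 j k).ofLp := by
    refine continuous_pi fun i => ?_
    simp only [Matrix.mulVec, dotProduct, Matrix.of_apply]
    refine continuous_finsetSum _ fun l _ => ?_
    fun_prop
  exact ((PiLp.continuous_toLp 2 (fun _ : Fin P => ℝ)).comp h).const_smul (Real.sqrt P)⁻¹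

end FeatureMap

/-! ### The excess risk of a perturbed decision function. -/

section Comparison

variable {𝒳 : Type*} [MeasurableSpace 𝒳] {Q : Measure (𝒳 × ℝ)}

theorem measurable_sqHinge_comp {f : 𝒳 → ℝ} (hf : Measurable f) :
    Measurable fun z : 𝒳 × ℝ => ENNReal.ofReal (sqHinge z.2 (f z.1)) :=
  ENNReal.measurable_ofReal.comp (continuous_sqHinge.measurable.comp
    (measurable_snd.prodMk (hf.comp measurable_fst)))

theorem bayesRisk_le {f : 𝒳 → ℝ} (hf : Measurable f) : bayesRisk Q ≤ risk Q f :=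
  iInf₂_le f hf

/-- The excess risk of `f + δ` is controlled by that of `f` and the mean square of `δ`. -/
theorem risk_add_le (hQ : ∀ᵐ z ∂Q, z.2 = 1 ∨ z.2 = -1) {f δ : 𝒳 → ℝ} (hf : Measurable f)
    (hδ : Measurable δ) :
    risk Q (fun x => f x + δ x) + bayesRisk Q
      ≤ 2 * risk Q f + 2 * ∫⁻ z, ENNReal.ofReal (δ z.1 ^ 2) ∂Q := by
  -- The Bayes risk is estimated by the risk of the mirrored function `f - δ`, so that the terms
  -- linear in `δ` cancel.
  calc risk Q (fun x => f x + δ x) + bayesRisk Q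
      ≤ risk Q (fun x => f x + δ x) + risk Q (fun x => f x - δ x) := by
        gcongr; exact bayesRisk_le (hf.sub hδ)
    _ = ∫⁻ z, (ENNReal.ofReal (sqHinge z.2 (f z.1 + δ z.1))
          + ENNReal.ofReal (sqHinge z.2 (f z.1 - δ z.1))) ∂Q :=
        (lintegral_add_left (measurable_sqHinge_comp (hf.add hδ)) _).symm
    _ ≤ ∫⁻ z, (2 * ENNReal.ofReal (sqHinge z.2 (f z.1))
          + 2 * ENNReal.ofReal (δ z.1 ^ 2)) ∂Q := by
        refine lintegral_mono_ae ?_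
        filter_upwards [hQ] with z hz
        have hy : z.2 ^ 2 = 1 := by rcases hz with h | h <;> rw [h] <;> norm_num
        have h := sqHinge_add_sub z.2 (f z.1) (δ z.1)
        rw [hy, one_mul] at h
        rw [← ENNReal.ofReal_add (sqHinge_nonneg _ _) (sqHinge_nonneg _ _)]
        refine (ENNReal.ofReal_le_ofReal h).trans_eq ?_
        rw [ENNReal.ofReal_add (by have := sqHinge_nonneg z.2 (f z.1); positivity) (by positivity),
          ENNReal.ofReal_mul (by norm_num), ENNReal.ofReal_mul (by norm_num)]
        simp
    _ = _ := by
        rw [lintegral_add_left ((measurable_sqHinge_comp hf).const_mul 2),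
          lintegral_const_mul _ (measurable_sqHinge_comp hf), lintegral_const_mul]
        · rfl
        · exact ENNReal.measurable_ofReal.comp ((hδ.comp measurable_fst).pow_const 2)

end Comparison

/-! ### From domination of quadratic forms to approximation of functions. -/

section LeastSquares

variable {F H Ω : Type*} [NormedAddCommGroup F] [InnerProductSpace ℝ F] [CompleteSpace F]
  [NormedAddCommGroup H] [InnerProductSpace ℝ H]
  [MeasurableSpace Ω] {ρ : Measure Ω}

theorem integrable_smul_of_bound [IsFiniteMeasure ρ] {φ : Ω → ℝ} {Ψ : Ω → H} {b κ : ℝ} (hφm : Measurable φ)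
    (hΨm : StronglyMeasurable Ψ) (hφ : ∀ᵐ z ∂ρ, |φ z| ≤ b) (hΨ : ∀ᵐ z ∂ρ, ‖Ψ z‖ ≤ κ) :
    Integrable (fun z => φ z • Ψ z) ρ := by
  refine Integrable.of_bound (C := b * κ) (hφm.stronglyMeasurable.smul hΨm).aestronglyMeasurable ?_
  filter_upwards [hφ, hΨ] with z h1 h2
  rw [norm_smul, Real.norm_eq_abs]
  exact mul_le_mul h1 h2 (norm_nonneg _) ((abs_nonneg _).trans h1)

theorem integrable_mul_of_bound [IsFiniteMeasure ρ] {φ ψ : Ω → ℝ} {b κ : ℝ} (hφm : Measurable φ)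
    (hψm : Measurable ψ) (hφ : ∀ᵐ z ∂ρ, |φ z| ≤ b) (hψ : ∀ᵐ z ∂ρ, |ψ z| ≤ κ) :
    Integrable (fun z => φ z * ψ z) ρ :=
  integrable_smul_of_bound hφm hψm.stronglyMeasurable hφ hψ

theorem integral_mul_inner [CompleteSpace H] {φ : Ω → ℝ} {Ψ : Ω → H}
    (h : Integrable (fun z => φ z • Ψ z) ρ) (g : H) :
    ∫ z, φ z * inner ℝ (Ψ z) g ∂ρ = inner ℝ (∫ z, φ z • Ψ z ∂ρ) g := by
  rw [real_inner_comm, ← integral_inner h]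
  simp only [inner_smul_right, real_inner_comm g]

/-- If the integral operator of the features `Φ` is dominated, up to a multiple of the identity,
by that of the features `Ψ`, then functions represented by `Φ` are approximated in mean square by
functions represented by `Ψ`. -/
theorem exists_approximation [CompleteSpace H] [IsFiniteMeasure ρ] {Φ : Ω → F} {Ψ : Ω → H} {κ C lam : ℝ} (hlam : 0 < lam) (hC : 0 ≤ C)
    (hΦm : StronglyMeasurable Φ) (hΨm : StronglyMeasurable Ψ) (hΦ : ∀ᵐ z ∂ρ, ‖Φ z‖ ≤ κ)
    (hΨ : ∀ᵐ z ∂ρ, ‖Ψ z‖ ≤ κ)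
    (dom : ∀ (φ : Ω → ℝ) (b : ℝ), Measurable φ → (∀ᵐ z ∂ρ, |φ z| ≤ b) →
      ‖∫ z, φ z • Φ z ∂ρ‖ ^ 2 ≤ C * (‖∫ z, φ z • Ψ z ∂ρ‖ ^ 2 + lam * ∫ z, φ z ^ 2 ∂ρ))
    (f : F) :
    ∃ g : H, ∫ z, (inner ℝ (Ψ z) g - inner ℝ (Φ z) f) ^ 2 ∂ρ + lam * ‖g‖ ^ 2
      ≤ C * lam * ‖f‖ ^ 2 := by
  set e : H → Ω → ℝ := fun g z => inner ℝ (Ψ z) g - inner ℝ (Φ z) f with he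
  have hem : ∀ g, Measurable (e g) := fun g =>
    ((hΨm.inner stronglyMeasurable_const).sub (hΦm.inner stronglyMeasurable_const)).measurable
  have heb : ∀ g, ∀ᵐ z ∂ρ, |e g z| ≤ κ * ‖g‖ + κ * ‖f‖ := by
    intro g
    filter_upwards [hΦ, hΨ] with z h1 h2
    exact (abs_sub _ _).trans (add_le_add (abs_inner_le_of_norm_le h2) (abs_inner_le_of_norm_le h1))
  have hpm : ∀ g, Measurable fun z => inner ℝ (Ψ z) g := fun g =>
    (hΨm.inner stronglyMeasurable_const).measurable
  have hpb : ∀ g, ∀ᵐ z ∂ρ, |inner ℝ (Ψ z) g| ≤ κ * ‖g‖ := fun g =>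
    hΨ.mono fun z h => abs_inner_le_of_norm_le h
  have hint : ∀ g, Integrable (fun z => e g z • Ψ z) ρ := fun g =>
    integrable_smul_of_bound (hem g) hΨm (heb g) hΨ
  have hsq : ∀ g, Integrable (fun z => e g z ^ 2) ρ := fun g => by
    simpa only [sq] using integrable_mul_of_bound (hem g) (hem g) (heb g) (heb g)
  have hpsq : ∀ g, Integrable (fun z => (inner ℝ (Ψ z) g : ℝ) ^ 2) ρ := fun g => by
    simpa only [sq] using integrable_mul_of_bound (hpm g) (hpm g) (hpb g) (hpb g)
  set J : H → ℝ := fun g => ∫ z, e g z ^ 2 ∂ρ + lam * ‖g‖ ^ 2 with hJ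
  set G : H → H := fun g => (2 : ℝ) • (∫ z, e g z • Ψ z ∂ρ) + (2 * lam) • g with hG
  -- The ridge regression objective is quadratic, so its expansion is exact and gives the lower and
  -- upper models at once.
  have expand : ∀ g₀ g, J g = J g₀ + inner ℝ (G g₀) (g - g₀)
      + (∫ z, (inner ℝ (Ψ z) (g - g₀) : ℝ) ^ 2 ∂ρ + lam * ‖g - g₀‖ ^ 2) := by
    intro g₀ g
    have h1 : ∀ z, e g z ^ 2 = e g₀ z ^ 2 + 2 * (e g₀ z * inner ℝ (Ψ z) (g - g₀))
        + (inner ℝ (Ψ z) (g - g₀) : ℝ) ^ 2 := by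
      intro z; simp only [he, inner_sub_right]; ring
    have hm := (integrable_mul_of_bound (hem g₀) (hpm (g - g₀)) (heb g₀) (hpb (g - g₀))).const_mul 2
    have h2 : ∫ z, e g z ^ 2 ∂ρ = ∫ z, e g₀ z ^ 2 ∂ρ
        + 2 * ∫ z, e g₀ z * inner ℝ (Ψ z) (g - g₀) ∂ρ
        + ∫ z, (inner ℝ (Ψ z) (g - g₀) : ℝ) ^ 2 ∂ρ := by
      rw [← integral_const_mul, ← integral_add (hsq g₀) hm, ← integral_add
        (f := fun z => e g₀ z ^ 2 + 2 * (e g₀ z * inner ℝ (Ψ z) (g - g₀)))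
        ((hsq g₀).add hm) (hpsq _)]
      exact integral_congr_ae (Filter.Eventually.of_forall h1)
    simp only [hJ, hG]
    rw [h2, integral_mul_inner (hint g₀), norm_sq_expand g₀ g, inner_add_left, inner_smul_left,
      inner_smul_left]
    simp only [conj_trivial]
    ring
  obtain ⟨g, hg⟩ := exists_gradient_eq_zero (J := J) (G := G) (M := ρ.real Set.univ * κ ^ 2 + lam)
    hlam (fun g₀ g => by
      rw [expand g₀ g]
      have : 0 ≤ ∫ z, (inner ℝ (Ψ z) (g - g₀) : ℝ) ^ 2 ∂ρ := integral_nonneg fun z => sq_nonneg _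
      linarith) (fun g₀ g => by
      rw [expand g₀ g]
      have : ∫ z, (inner ℝ (Ψ z) (g - g₀) : ℝ) ^ 2 ∂ρ ≤ ∫ _, κ ^ 2 * ‖g - g₀‖ ^ 2 ∂ρ := by
        refine integral_mono_ae (hpsq _) (integrable_const _) ?_
        filter_upwards [hpb (g - g₀)] with z hz
        rw [← sq_abs, ← mul_pow]
        exact pow_le_pow_left₀ (abs_nonneg _) hz 2
      simp only [integral_const, smul_eq_mul] at this
      linarith)
  refine ⟨g, ?_⟩
  set w := ∫ z, e g z • Ψ z ∂ρ with hw
  -- The normal equation of ridge regression.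
  have hwg : w = -(lam • g) := by
    have h2 : (2 : ℝ) • (w + lam • g) = 0 := by
      rw [smul_add, smul_smul]; exact hg
    rw [smul_eq_zero] at h2
    exact eq_neg_of_add_eq_zero_left (h2.resolve_left two_ne_zero)
  set V := ∫ z, e g z ^ 2 ∂ρ + lam * ‖g‖ ^ 2 with hV
  change V ≤ _
  -- By the normal equation the penalty cancels the part of the residual paired with `g`; the
  -- optimal value is the pairing of the residual with the target alone.
  have hV1 : V = -inner ℝ (∫ z, e g z • Φ z ∂ρ) f := by
    have hΦi := integrable_smul_of_bound (hem g) hΦm (heb g) hΦ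
    have h1 : ∫ z, e g z ^ 2 ∂ρ = ∫ z, e g z * inner ℝ (Ψ z) g ∂ρ
        - ∫ z, e g z * inner ℝ (Φ z) f ∂ρ := by
      rw [← integral_sub]
      · refine integral_congr_ae (Filter.Eventually.of_forall fun z => ?_)
        simp only [he]; ring
      · exact integrable_mul_of_bound (hem g) (hpm g) (heb g) (hpb g)
      · exact integrable_mul_of_bound (hem g) (hΦm.inner stronglyMeasurable_const).measurable
          (heb g) (hΦ.mono fun z h => abs_inner_le_of_norm_le h)
    rw [hV, h1, integral_mul_inner (hint g), integral_mul_inner hΦi, ← hw, hwg, inner_neg_left,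
      inner_smul_left, real_inner_self_eq_norm_sq]
    simp only [conj_trivial]
    ring
  -- The domination is tested on the residual itself. There its right side is `C * lam * V`, so with
  -- Cauchy-Schwarz `V²` is at most `C * lam * ‖f‖² * V`.
  have hd := dom (e g) _ (hem g) (heb g)
  rw [← hw, hwg, norm_neg, norm_smul, Real.norm_of_nonneg hlam.le] at hd
  have hV0 : 0 ≤ V := add_nonneg (integral_nonneg fun z => sq_nonneg _) (by positivity)
  have hd2 : ‖∫ z, e g z • Φ z ∂ρ‖ ^ 2 ≤ C * lam * V := by
    refine hd.trans_eq ?_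
    rw [hV]; ring
  have h3 : V ^ 2 ≤ (C * lam * ‖f‖ ^ 2) * V := by
    have h4 : V ≤ ‖∫ z, e g z • Φ z ∂ρ‖ * ‖f‖ := by
      rw [hV1]; exact (neg_le_abs _).trans (abs_real_inner_le_norm _ _)
    calc V ^ 2 ≤ (‖∫ z, e g z • Φ z ∂ρ‖ * ‖f‖) ^ 2 := by gcongr
      _ = ‖∫ z, e g z • Φ z ∂ρ‖ ^ 2 * ‖f‖ ^ 2 := by ring
      _ ≤ C * lam * V * ‖f‖ ^ 2 := by gcongr
      _ = _ := by ring
  rcases hV0.eq_or_lt with h | h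
  · rw [← h]; positivity
  · rw [sq] at h3
    exact le_of_mul_le_mul_right h3 h

end LeastSquares

/-! ### Profiles that are positive semidefinite in every dimension. -/

section PositiveDefinite

/-- `f(‖x - y‖²)` is a positive semidefinite kernel on every Euclidean space. -/
def IsRadialPosSemidef (f : ℝ → ℝ) : Prop :=
  ∀ (ι α : Type) [Fintype ι] [Fintype α] (p : α → EuclideanSpace ℝ ι) (w : α → ℝ),
    0 ≤ ∑ a, ∑ b, w a * w b * f (‖p a - p b‖ ^ 2)

/-- `f(⟨x, y⟩)` is a positive semidefinite kernel on every Euclidean space. -/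
def IsInnerPosSemidef (f : ℝ → ℝ) : Prop :=
  ∀ (ι α : Type) [Fintype ι] [Fintype α] (p : α → EuclideanSpace ℝ ι) (w : α → ℝ),
    0 ≤ ∑ a, ∑ b, w a * w b * f (inner ℝ (p a) (p b))

theorem ModeKernel.sum_nonneg (κ : ModeKernel) {m : ℕ} {α : Type} [Fintype α]
    (p : α → EuclideanSpace ℝ (Fin m)) (w : α → ℝ) :
    0 ≤ ∑ a, ∑ b, w a * w b * κ.eval (p a) (p b) := by
  have h := ((κ.posSemidef m).submatrix p).dotProduct_mulVec_nonneg w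
  refine h.trans_eq ?_
  simp only [dotProduct, Matrix.mulVec, Matrix.submatrix_apply, Matrix.of_apply, Pi.star_apply,
    star_trivial, Finset.mul_sum, ModeKernel.eval]
  exact Finset.sum_congr rfl fun a _ => Finset.sum_congr rfl fun b _ => by ring

theorem ModeKernel.isRadialPosSemidef {κ : ModeKernel} (hκ : κ.form = .dist) :
    IsRadialPosSemidef κ.h := by
  intro ι α _ _ p w
  let e := LinearIsometryEquiv.piLpCongrLeft 2 ℝ ℝ (Fintype.equivFin ι)
  have h := κ.sum_nonneg (fun a => e (p a)) w
  simp only [ModeKernel.eval, hκ, KernelForm.arg, ← map_sub, LinearIsometryEquiv.norm_map] at h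
  exact h

theorem ModeKernel.isInnerPosSemidef {κ : ModeKernel} (hκ : κ.form = .inner) :
    IsInnerPosSemidef κ.h := by
  intro ι α _ _ p w
  let e := LinearIsometryEquiv.piLpCongrLeft 2 ℝ ℝ (Fintype.equivFin ι)
  have h := κ.sum_nonneg (fun a => e (p a)) w
  simp only [ModeKernel.eval, hκ, KernelForm.arg, LinearIsometryEquiv.inner_map_map] at h
  exact h

/-- The point of a Euclidean space with one more coordinate. -/
noncomputable def appendCoord {ι : Type} (x : EuclideanSpace ℝ ι) (c : ℝ) :
    EuclideanSpace ℝ (ι ⊕ Unit) :=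
  WithLp.toLp 2 (Sum.elim x.ofLp fun _ => c)

theorem norm_appendCoord_sub {ι : Type} [Fintype ι] (x y : EuclideanSpace ℝ ι) (c e : ℝ) :
    ‖appendCoord x c - appendCoord y e‖ ^ 2 = ‖x - y‖ ^ 2 + (c - e) ^ 2 := by
  simp [appendCoord, EuclideanSpace.real_norm_sq_eq]

theorem inner_appendCoord {ι : Type} [Fintype ι] (x y : EuclideanSpace ℝ ι) (c e : ℝ) :
    (inner ℝ (appendCoord x c) (appendCoord y e) : ℝ) = inner ℝ x y + c * e := by
  simp [appendCoord, PiLp.inner_apply, mul_comm]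

/-- Each point is doubled in a new orthogonal direction at distance `√δ`, with the opposite weight.
Equal sheets see `f s`, opposite sheets `f (s + δ)`. Iteration gives complete monotonicity. -/
theorem IsRadialPosSemidef.sub_shift {f : ℝ → ℝ} (hf : IsRadialPosSemidef f) {δ : ℝ}
    (hδ : 0 ≤ δ) : IsRadialPosSemidef fun s => f s - f (s + δ) := by
  intro ι α _ _ p w
  have h := hf (ι ⊕ Unit) (α × Bool)
    (fun a => appendCoord (p a.1) (if a.2 then Real.sqrt δ else 0))
    (fun a => if a.2 then w a.1 else -w a.1)
  simp only [norm_appendCoord_sub, Fintype.sum_prod_type, Fintype.sum_bool, if_true, sub_self,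
    zero_sub, sub_zero, neg_sq, Real.sq_sqrt hδ, if_false, Bool.false_eq_true, ne_eq,
    OfNat.ofNat_ne_zero, not_false_eq_true, zero_pow, add_zero] at h
  simp only [← Finset.sum_add_distrib] at h
  have e : ∑ a, ∑ b, (w a * w b * f (‖p a - p b‖ ^ 2) + w a * -w b * f (‖p a - p b‖ ^ 2 + δ)
      + (-w a * w b * f (‖p a - p b‖ ^ 2 + δ) + -w a * -w b * f (‖p a - p b‖ ^ 2)))
      = 2 * ∑ a, ∑ b, w a * w b * (f (‖p a - p b‖ ^ 2) - f (‖p a - p b‖ ^ 2 + δ)) := by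
    rw [Finset.mul_sum]
    refine Finset.sum_congr rfl fun a _ => ?_
    rw [Finset.mul_sum]
    exact Finset.sum_congr rfl fun b _ => by ring
  rw [e] at h
  linarith

/-- The vertices of a regular simplex with squared edge `t`, all with weight one: in high dimension
the off-diagonal terms outweigh the diagonal. -/
theorem IsRadialPosSemidef.nonneg {f : ℝ → ℝ} (hf : IsRadialPosSemidef f) {t : ℝ} (ht : 0 ≤ t) :
    0 ≤ f t := by
  have key : ∀ n : ℕ, 0 ≤ f 0 + n * f t := by
    intro n
    have h := hf (Fin (n + 1)) (Fin (n + 1))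
      (fun a => EuclideanSpace.single a (Real.sqrt (t / 2))) (fun _ => 1)
    have e : ∀ a b : Fin (n + 1), (1 : ℝ) * 1 * f (‖(EuclideanSpace.single a (Real.sqrt (t / 2)) :
        EuclideanSpace ℝ (Fin (n + 1))) - EuclideanSpace.single b (Real.sqrt (t / 2))‖ ^ 2)
        = f t + if a = b then f 0 - f t else 0 := by
      intro a b
      split_ifs with hab
      · subst hab; simp
      · rw [norm_sub_sq_real]
        simp only [PiLp.norm_single, EuclideanSpace.inner_single_left]
        rw [PiLp.single_apply, if_neg hab]
        simp only [Real.norm_eq_abs, sq_abs, mul_zero, sub_zero, one_mul, add_zero]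
        rw [Real.sq_sqrt (by linarith)]
        congr 1; ring
    simp only [e, Finset.sum_add_distrib, Finset.sum_ite_eq, Finset.mem_univ, if_true,
      Finset.sum_const, Finset.card_univ, Fintype.card_fin, nsmul_eq_mul] at h
    have h' : 0 ≤ ((n : ℝ) + 1) * (f 0 + n * f t) := by push_cast at h; linarith
    exact nonneg_of_mul_nonneg_right h' (by positivity)
  by_contra hneg
  push Not at hneg
  obtain ⟨n, hn⟩ := exists_nat_gt (f 0 / (-f t))
  rw [div_lt_iff₀ (by linarith)] at hn
  linarith [key n]

/-- The same doubling as in the radial case; here the new coordinate adds `δ` only when both points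
lie on the shifted sheet, so the difference has the other sign. -/
theorem IsInnerPosSemidef.shift_sub {f : ℝ → ℝ} (hf : IsInnerPosSemidef f) {δ : ℝ}
    (hδ : 0 ≤ δ) : IsInnerPosSemidef fun s => f (s + δ) - f s := by
  intro ι α _ _ p w
  have h := hf (ι ⊕ Unit) (α × Bool)
    (fun a => appendCoord (p a.1) (if a.2 then Real.sqrt δ else 0))
    (fun a => if a.2 then w a.1 else -w a.1)
  simp only [inner_appendCoord, Fintype.sum_prod_type, Fintype.sum_bool, if_true,
    Real.mul_self_sqrt hδ, if_false, Bool.false_eq_true, mul_zero, zero_mul, add_zero] at h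
  simp only [← Finset.sum_add_distrib] at h
  refine h.trans_eq (Finset.sum_congr rfl fun a _ => Finset.sum_congr rfl fun b _ => ?_)
  ring

/-- Each point `p` is accompanied by `-p` with weight multiplied by `ε`. For `ε = 1` and `ε = -1`
this isolates the even and the odd part. -/
theorem IsInnerPosSemidef.add_reflect {f : ℝ → ℝ} (hf : IsInnerPosSemidef f) {ε : ℝ}
    (hε : ε ^ 2 = 1) : IsInnerPosSemidef fun s => f s + ε * f (-s) := by
  intro ι α _ _ p w
  have h := hf ι (α × Bool) (fun a => if a.2 then p a.1 else -p a.1)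
    (fun a => if a.2 then w a.1 else ε * w a.1)
  simp only [Fintype.sum_prod_type, Fintype.sum_bool, if_true, if_false, Bool.false_eq_true,
    inner_neg_left, inner_neg_right, neg_neg] at h
  simp only [← Finset.sum_add_distrib] at h
  have e : ∑ a, ∑ b, (w a * w b * f (inner ℝ (p a) (p b))
      + w a * (ε * w b) * f (-inner ℝ (p a) (p b)) + (ε * w a * w b * f (-inner ℝ (p a) (p b))
      + ε * w a * (ε * w b) * f (inner ℝ (p a) (p b))))
      = 2 * ∑ a, ∑ b, w a * w b * (f (inner ℝ (p a) (p b)) + ε * f (-inner ℝ (p a) (p b))) := by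
    rw [Finset.mul_sum]
    refine Finset.sum_congr rfl fun a _ => ?_
    rw [Finset.mul_sum]
    refine Finset.sum_congr rfl fun b _ => ?_
    linear_combination w a * w b * f (inner ℝ (p a) (p b)) * hε
  rw [e] at h
  linarith

theorem IsInnerPosSemidef.nonneg {f : ℝ → ℝ} (hf : IsInnerPosSemidef f) {t : ℝ} (ht : 0 ≤ t) :
    0 ≤ f t := by
  have h := hf Unit Unit (fun _ => EuclideanSpace.single () (Real.sqrt t)) (fun _ => 1)
  simpa [EuclideanSpace.inner_single_left, Real.sq_sqrt ht] using h

/-- A Lipschitz inner product kernel profile is affine on the nonnegative half-line. -/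
theorem IsInnerPosSemidef.exists_affine {f : ℝ → ℝ} (hf : IsInnerPosSemidef f) {L : ℝ}
    (hL : ∀ x y, |f x - f y| ≤ L * |x - y|) : ∃ b, 0 ≤ b ∧ ∀ t, 0 ≤ t → f t = f 0 + b * t := by
  -- The second difference `g` is nonnegative, and nondecreasing along the grid because the third
  -- difference is nonnegative too. Its sum over `n` grid points telescopes to first differences,
  -- which the Lipschitz condition bounds independently of `n`; hence `g` vanishes.
  have second : ∀ δ, 0 ≤ δ → ∀ t, 0 ≤ t → f (t + δ + δ) - f (t + δ) - (f (t + δ) - f t) = 0 := by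
    intro δ hδ t ht
    set g : ℝ → ℝ := fun s => f (s + δ + δ) - f (s + δ) - (f (s + δ) - f s) with hg
    have hgP : IsInnerPosSemidef g := (hf.shift_sub hδ).shift_sub hδ
    have hmono : ∀ n : ℕ, g t ≤ g (t + n * δ) := by
      intro n
      induction n with
      | zero => simp
      | succ n ih =>
        have h := (hgP.shift_sub hδ).nonneg (t := t + n * δ) (by positivity)
        have e : t + (n + 1 : ℕ) * δ = t + n * δ + δ := by push_cast; ring
        rw [e]
        linarith
    have hsum : ∀ n : ℕ, n * g t ≤ (f (t + n * δ + δ) - f (t + n * δ)) - (f (t + δ) - f t) := by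
      intro n
      induction n with
      | zero => simp
      | succ n ih =>
        have e : t + (n + 1 : ℕ) * δ = t + n * δ + δ := by push_cast; ring
        rw [e]
        have := hmono n
        simp only [hg] at this ih ⊢
        push_cast
        linarith
    have hb : ∀ n : ℕ, n * g t ≤ 2 * (L * δ) := by
      intro n
      have h1 := hL (t + n * δ + δ) (t + n * δ)
      have h2 := hL t (t + δ)
      rw [add_sub_cancel_left, abs_of_nonneg hδ] at h1
      rw [sub_add_cancel_left, abs_neg, abs_of_nonneg hδ] at h2
      have := (abs_le.mp h1).2
      have := (abs_le.mp h2).2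
      linarith [hsum n]
    refine le_antisymm ?_ (hgP.nonneg ht)
    change g t ≤ 0
    by_contra hpos
    push Not at hpos
    obtain ⟨n, hn⟩ := exists_nat_gt (2 * (L * δ) / g t)
    rw [div_lt_iff₀ hpos] at hn
    linarith [hb n]
  set b := f 1 - f 0
  set e : ℝ → ℝ := fun t => f t - f 0 - b * t with he
  -- Vanishing second differences make the deviation `e` from the line additive. It vanishes at `1`,
  -- hence at all integers, and is bounded on the unit interval; a bounded additive function is
  -- zero.
  have hmid : ∀ x y, 0 ≤ x → x ≤ y → e (x + y) = e x + e y := by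
    intro x y hx hxy
    have h1 := second ((y - x) / 2) (by linarith) x hx
    have h2 := second ((x + y) / 2) (by linarith) 0 le_rfl
    have e1 : x + (y - x) / 2 = (x + y) / 2 := by ring
    have e2 : (x + y) / 2 + (y - x) / 2 = y := by ring
    have e3 : (x + y) / 2 + (x + y) / 2 = x + y := by ring
    rw [e1, e2] at h1
    rw [zero_add, e3] at h2
    simp only [he]
    linarith
  have hadd : ∀ x y, 0 ≤ x → 0 ≤ y → e (x + y) = e x + e y := by
    intro x y hx hy
    rcases le_total x y with h | h
    · exact hmid x y hx h
    · rw [add_comm, hmid y x hy h, add_comm]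
  have hmul : ∀ (n : ℕ) x, 0 ≤ x → e (n * x) = n * e x := by
    intro n x hx
    induction n with
    | zero => simp [he]
    | succ n ih =>
      have e1 : ((n + 1 : ℕ) : ℝ) * x = n * x + x := by push_cast; ring
      rw [e1, hadd _ _ (by positivity) hx, ih]; push_cast; ring
  have h1 : e 1 = 0 := by simp [he, b]
  have hbd : ∀ y, 0 ≤ y → |e y| ≤ L + |b| := by
    intro y hy
    have hfr := Nat.floor_le hy
    have hfr' := Nat.lt_floor_add_one y
    set z := y - ⌊y⌋₊
    have hz : e y = e z := by
      have := hadd (⌊y⌋₊ * 1) z (by positivity) (by simp only [z]; linarith)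
      rw [hmul _ _ zero_le_one, h1, mul_zero, zero_add] at this
      rw [← this]; congr 1; simp only [z]; ring
    rw [hz]
    have hz0 : 0 ≤ z := by simp only [z]; linarith
    have hz1 : z ≤ 1 := by simp only [z]; linarith
    have h2 := hL z 0
    rw [sub_zero, abs_of_nonneg hz0] at h2
    have hL0 : 0 ≤ L := by
      have := (abs_nonneg _).trans (hL 1 0); simpa using this
    calc |e z| ≤ |f z - f 0| + |b * z| := abs_sub _ _
      _ ≤ L * z + |b| * z := by rw [abs_mul, abs_of_nonneg hz0]; linarith
      _ ≤ L * 1 + |b| * 1 := by gcongr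
      _ = _ := by ring
  refine ⟨b, ?_, fun t ht => ?_⟩
  · have := (hf.shift_sub zero_le_one).nonneg (t := 0) le_rfl
    simpa [b] using this
  · have h0 : e t = 0 := by
      by_contra hne
      have hpos : 0 < |e t| := abs_pos.mpr hne
      obtain ⟨n, hn⟩ := exists_nat_gt ((L + |b|) / |e t|)
      rw [div_lt_iff₀ hpos] at hn
      have := hbd (n * t) (by positivity)
      rw [hmul n t ht, abs_mul, Nat.abs_cast] at this
      linarith
    simp only [he] at h0
    linarith

/-- A Lipschitz function of the inner product that is positive semidefinite in every dimension is
affine with nonnegative coefficients. -/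
theorem ModeKernel.exists_affine {κ : ModeKernel} (hκ : κ.form = .inner) :
    ∃ a b, 0 ≤ a ∧ 0 ≤ b ∧ ∀ t, κ.h t = a + b * t := by
  have hP := κ.isInnerPosSemidef hκ
  have hL : ∀ x y, |κ.h x - κ.h y| ≤ κ.lip * |x - y| := by
    intro x y
    have := κ.lipschitz.dist_le_mul x (by rw [hκ]; trivial) y (by rw [hκ]; trivial)
    simpa [Real.dist_eq] using this
  have hL' : ∀ ε : ℝ, |ε| = 1 → ∀ x y,
      |(κ.h x + ε * κ.h (-x)) - (κ.h y + ε * κ.h (-y))| ≤ 2 * κ.lip * |x - y| := by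
    intro ε hε x y
    have h1 := hL x y
    have h2 := hL (-x) (-y)
    have e1 : -x - -y = -(x - y) := by ring
    rw [e1, abs_neg] at h2
    calc _ = |(κ.h x - κ.h y) + ε * (κ.h (-x) - κ.h (-y))| := by ring_nf
      _ ≤ |κ.h x - κ.h y| + |ε * (κ.h (-x) - κ.h (-y))| := abs_add_le _ _
      _ ≤ _ := by rw [abs_mul, hε]; linarith
  -- The even and odd parts are both affine on the half-line. It remains to exclude a multiple of
  -- `|s|` in the even part.
  have hPe : IsInnerPosSemidef fun s => κ.h s + 1 * κ.h (-s) := hP.add_reflect (by norm_num)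
  obtain ⟨e, he0, he⟩ := hPe.exists_affine (hL' 1 (by norm_num))
  obtain ⟨b, hb0, hb⟩ := (hP.add_reflect (ε := -1) (by norm_num)).exists_affine
    (hL' (-1) (by norm_num))
  simp only [neg_zero, one_mul] at he hPe
  simp only [neg_zero] at hb
  have heven : e ≤ 0 := by
    -- These weights sum to zero, which kills constants, and the quadratic form of `|⟨x, y⟩|` at
    -- these points is `6 - 8 = -2`. So the slope cannot be positive.
    have h := hPe (Fin 2) (Fin 4)
      ![!₂[1, 0], !₂[0, 1], !₂[1, 1], !₂[1, -1]] ![1, 1, -1, -1]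
    simp only [Fin.sum_univ_four, PiLp.inner_apply, Fin.sum_univ_two, Matrix.cons_val] at h
    norm_num at h
    have h1 := he 1 zero_le_one
    have h2 := he 2 zero_le_two
    linarith
  have he' : e = 0 := le_antisymm heven he0
  refine ⟨κ.h 0, b / 2, hP.nonneg le_rfl, by linarith, fun t => ?_⟩
  rcases le_total 0 t with ht | ht
  · have h1 := he t ht
    have h2 := hb t ht
    rw [he'] at h1
    linarith
  · have h1 := he (-t) (by linarith)
    have h2 := hb (-t) (by linarith)
    rw [he'] at h1
    rw [neg_neg] at h1 h2
    linarith

end PositiveDefinite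

/-! ### An approximate Schoenberg theorem, through Hausdorff moments. -/

section ExponentialMixture

/-- The shift by `δ` as a linear operator on functions. -/
def shiftOp (δ : ℝ) : Module.End ℝ (ℝ → ℝ) where
  toFun f := fun s => f (s + δ)
  map_add' _ _ := rfl
  map_smul' _ _ := rfl

theorem shiftOp_pow_apply (δ : ℝ) (n : ℕ) (f : ℝ → ℝ) (t : ℝ) :
    (shiftOp δ ^ n) f t = f (t + n * δ) := by
  induction n generalizing f t with
  | zero => simp
  | succ n ih =>
    rw [pow_succ, Module.End.mul_apply, ih]
    change f (t + n * δ + δ) = _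
    congr 1; push_cast; ring

theorem IsRadialPosSemidef.pow_sub_shift {f : ℝ → ℝ} (hf : IsRadialPosSemidef f) {δ : ℝ}
    (hδ : 0 ≤ δ) (n : ℕ) : IsRadialPosSemidef (((1 - shiftOp δ) ^ n) f) := by
  induction n with
  | zero => simpa using hf
  | succ n ih =>
    rw [pow_succ', Module.End.mul_apply]
    exact ih.sub_shift hδ

/-- The binomial theorem for the identity, written as the sum of the commuting operators `shiftOp δ`
and `1 - shiftOp δ`. -/
theorem eq_sum_choose_sub_shift (f : ℝ → ℝ) (δ t : ℝ) (n : ℕ) :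
    f t = ∑ i ∈ Finset.range (n + 1),
      (n.choose i : ℝ) * ((1 - shiftOp δ) ^ (n - i)) f (t + i * δ) := by
  have hc : Commute (shiftOp δ) (1 - shiftOp δ) :=
    (Commute.one_right _).sub_right (Commute.refl _)
  have h := hc.add_pow n
  rw [add_sub_cancel, one_pow] at h
  have h2 := congrFun (LinearMap.congr_fun h f) t
  rw [Module.End.one_apply] at h2
  rw [h2, LinearMap.sum_apply, Finset.sum_apply]
  refine Finset.sum_congr rfl fun i _ => ?_
  rw [← Nat.cast_comm, Module.End.mul_apply, Module.End.mul_apply, Module.End.natCast_apply,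
    Pi.smul_apply, nsmul_eq_mul, shiftOp_pow_apply]

/-- The weights of the Hausdorff moment approximation. -/
noncomputable def momentWeight (f : ℝ → ℝ) (δ : ℝ) (N m : ℕ) : ℝ :=
  (N.choose m : ℝ) * ((1 - shiftOp δ) ^ (N - m)) f (m * δ)

theorem IsRadialPosSemidef.momentWeight_nonneg {f : ℝ → ℝ} (hf : IsRadialPosSemidef f) {δ : ℝ}
    (hδ : 0 ≤ δ) (N m : ℕ) : 0 ≤ momentWeight f δ N m :=
  mul_nonneg (Nat.cast_nonneg _) ((hf.pow_sub_shift hδ _).nonneg (by positivity))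

/-- On the grid, `f` is the sequence of factorial moments of one nonnegative weight. The ratio of
falling factorials is close to `(m / N) ^ j`, a value of an exponential in `j`. -/
theorem eq_sum_momentWeight (f : ℝ → ℝ) (δ : ℝ) {N j : ℕ} (hj : j ≤ N) :
    f (j * δ) = ∑ m ∈ Finset.range (N + 1),
      momentWeight f δ N m * ((m.descFactorial j : ℝ) / (N.descFactorial j : ℝ)) := by
  rw [eq_sum_choose_sub_shift f δ (j * δ) (N - j)]
  have h1 : N + 1 = j + (N - j + 1) := by omega
  have h0 : ∑ m ∈ Finset.range j,
      momentWeight f δ N m * ((m.descFactorial j : ℝ) / (N.descFactorial j : ℝ)) = 0 := by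
    refine Finset.sum_eq_zero fun m hm => ?_
    rw [Nat.descFactorial_eq_zero_iff_lt.mpr (Finset.mem_range.mp hm)]
    simp
  conv_rhs => rw [h1, Finset.sum_range_add, h0, zero_add]
  refine Finset.sum_congr rfl fun i hi => ?_
  have hi' : i ≤ N - j := Nat.lt_succ_iff.mp (Finset.mem_range.mp hi)
  unfold momentWeight
  have e1 : N - (j + i) = N - j - i := by omega
  have e2 : (j : ℝ) * δ + i * δ = ((j + i : ℕ) : ℝ) * δ := by push_cast; ring
  rw [e1, e2]
  have hN : (N.descFactorial j : ℝ) ≠ 0 := by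
    rw [Nat.cast_ne_zero, Ne, Nat.descFactorial_eq_zero_iff_lt]; omega
  have key : (N.choose (j + i) : ℝ) * (j + i).descFactorial j
      = ((N - j).choose i : ℝ) * N.descFactorial j := by
    have h2 := Nat.choose_mul (n := N) (k := j + i) (s := j) (by omega) 
    rw [Nat.add_sub_cancel_left] at h2
    rw [Nat.descFactorial_eq_factorial_mul_choose, Nat.descFactorial_eq_factorial_mul_choose]
    have h3 : (N.choose (j + i) : ℝ) * ((j + i).choose j) = N.choose j * (N - j).choose i := by
      exact_mod_cast h2
    push_cast
    linear_combination (j.factorial : ℝ) * h3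
  field_simp
  linear_combination -(((1 - shiftOp δ) ^ (N - j - i)) f (((j + i : ℕ) : ℝ) * δ)) * key

/-- The falling factorials are compared factor by factor, each at cost `J / N`. The maximum with `1`
keeps the base positive, since its logarithm becomes an exponent in the mixture. -/
theorem abs_descFactorial_div_sub_le {N J m : ℕ} (hJ : J < N) (hm : m ≤ N) {j : ℕ} (hj : j ≤ J) :
    |(m.descFactorial j : ℝ) / (N.descFactorial j : ℝ) - (max (m : ℝ) 1 / N) ^ j|
      ≤ j * (J / N) := by
  induction j with
  | zero => simp
  | succ j ih =>
    have ih := ih (by omega)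
    have hN : (0 : ℝ) < N := by exact_mod_cast (by omega : 0 < N)
    have hNj : (0 : ℝ) < ((N - j : ℕ) : ℝ) := by exact_mod_cast (by omega : 0 < N - j)
    set x := max (m : ℝ) 1 / N
    set Qj := (m.descFactorial j : ℝ) / (N.descFactorial j : ℝ)
    set y := ((m - j : ℕ) : ℝ) / ((N - j : ℕ) : ℝ)
    have hx0 : 0 ≤ x := by positivity
    have hx1 : x ≤ 1 := by
      rw [div_le_one hN]
      exact max_le (by exact_mod_cast hm) (by exact_mod_cast (by omega : 1 ≤ N))
    have e : (m.descFactorial (j + 1) : ℝ) / (N.descFactorial (j + 1) : ℝ) = Qj * y := by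
      rw [Nat.descFactorial_succ, Nat.descFactorial_succ]
      push_cast
      rw [mul_div_mul_comm, mul_comm]
    have hQ0 : 0 ≤ Qj := by positivity
    have hQ1 : Qj ≤ 1 := by
      refine div_le_one_of_le₀ ?_ (by positivity)
      exact_mod_cast Nat.descFactorial_le j hm
    have hNj' : ((N - j : ℕ) : ℝ) = N - j := by rw [Nat.cast_sub (by omega)]
    have hxy0 : y ≤ x := by
      have h1 : y ≤ (m : ℝ) / N := by
        rw [div_le_div_iff₀ hNj hN]
        rcases le_total j m with h | h
        · rw [Nat.cast_sub h, hNj']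
          have : (m : ℝ) ≤ N := by exact_mod_cast hm
          nlinarith [(Nat.cast_nonneg j : (0 : ℝ) ≤ j)]
        · rw [Nat.sub_eq_zero_of_le h]; simp; positivity
      refine h1.trans ?_
      simp only [x]; gcongr; exact le_max_left _ _
    have hxy1 : x - y ≤ J / N := by
      have h1 : ((m : ℝ) - j) / N ≤ y := by
        rcases le_total j m with h | h
        · simp only [y]
          rw [Nat.cast_sub h]
          have : (0 : ℝ) ≤ (m : ℝ) - j := by
            rw [sub_nonneg]; exact_mod_cast h
          refine div_le_div_of_nonneg_left this hNj ?_
          rw [hNj']; linarith [(Nat.cast_nonneg j : (0 : ℝ) ≤ j)]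
        · have h2 : ((m : ℝ) - j) / N ≤ 0 := by
            refine div_nonpos_of_nonpos_of_nonneg ?_ hN.le
            rw [sub_nonpos]; exact_mod_cast h
          exact h2.trans (by positivity)
      have h2 : x - ((m : ℝ) - j) / N ≤ J / N := by
        simp only [x]
        rw [← sub_div]
        gcongr
        -- One unit pays for the maximum with `1`, the other `j` for the shift in the falling
        -- factorial.
        have : (j : ℝ) + 1 ≤ J := by exact_mod_cast hj
        have : max (m : ℝ) 1 ≤ m + 1 :=
          max_le (by linarith) (by linarith [(Nat.cast_nonneg m : (0 : ℝ) ≤ m)])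
        linarith
      linarith
    rw [e, pow_succ]
    have e2 : Qj * y - x ^ j * x = (Qj - x ^ j) * x + Qj * (y - x) := by ring
    rw [e2]
    calc |(Qj - x ^ j) * x + Qj * (y - x)| ≤ |(Qj - x ^ j) * x| + |Qj * (y - x)| := abs_add_le _ _
      _ = |Qj - x ^ j| * x + Qj * (x - y) := by
          rw [abs_mul, abs_mul, abs_of_nonneg hx0, abs_of_nonneg hQ0,
            abs_of_nonpos (a := y - x) (by linarith)]
          ring
      _ ≤ j * (J / N) * 1 + 1 * (J / N) := by
          have : (0 : ℝ) ≤ J / N := by positivity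
          have : (0 : ℝ) ≤ j * (J / N) := by positivity
          gcongr
      _ = _ := by push_cast; ring

/-- A continuous radial positive semidefinite profile is, uniformly on bounded sets, a limit of
mixtures of exponentials. -/
theorem IsRadialPosSemidef.exists_exp_mixture {f : ℝ → ℝ} (hf : IsRadialPosSemidef f) {L : ℝ}
    (hL : ∀ x y, 0 ≤ x → 0 ≤ y → |f x - f y| ≤ L * |x - y|) (R : ℝ) {ε : ℝ} (hε : 0 < ε) :
    ∃ (n : ℕ) (w s : Fin n → ℝ), (∀ i, 0 ≤ w i) ∧ (∀ i, 0 ≤ s i) ∧ ∑ i, w i = f 0 ∧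
      ∀ t, 0 ≤ t → t ≤ R → |f t - ∑ i, w i * Real.exp (-(s i * t))| ≤ ε := by
  -- The mesh is so fine that `f` varies by at most `ε / 2` on a cell; the other half is for the
  -- error on the grid, made small by taking `N` large.
  set δ := ε / (2 * (|L| + 1)) with hδdef
  have hδ : 0 < δ := by positivity
  have hLδ : L * δ ≤ ε / 2 := by
    have h1 : L * δ ≤ (|L| + 1) * δ := by gcongr; linarith [le_abs_self L]
    refine h1.trans_eq ?_
    rw [hδdef]; field_simp
  set J := ⌈|R| / δ⌉₊ + 1 with hJ
  have hf0 : 0 ≤ f 0 := hf.nonneg le_rfl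
  obtain ⟨N', hN'⟩ := exists_nat_gt (f 0 * J * J / (ε / 2))
  set N := max N' (J + 1) with hNdef
  have hJN : J < N := lt_of_lt_of_le (Nat.lt_succ_self J) (le_max_right _ _)
  have hN0 : (0 : ℝ) < N := by exact_mod_cast (by omega : 0 < N)
  have hsmall : f 0 * (J * (J / N)) ≤ ε / 2 := by
    have h1 : f 0 * J * J / (ε / 2) < N := hN'.trans_le (by exact_mod_cast le_max_left _ _)
    rw [div_lt_iff₀ (by positivity)] at h1
    have e : f 0 * (J * (J / N)) = f 0 * J * J / N := by ring
    rw [e, div_le_iff₀ hN0]; linarith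
  set x : ℕ → ℝ := fun m => max (m : ℝ) 1 / N with hx
  have hx0 : ∀ m, 0 < x m := fun m => by simp only [hx]; positivity
  have hx1 : ∀ m, m ≤ N → x m ≤ 1 := fun m hm => by
    simp only [hx]
    rw [div_le_one hN0]
    exact max_le (by exact_mod_cast hm) (by exact_mod_cast (by omega : 1 ≤ N))
  -- The exponents are chosen so that the exponential at `j * δ` equals `x i ^ j`.
  refine ⟨N + 1, fun i => momentWeight f δ N i, fun i => -Real.log (x i) / δ,
    fun i => hf.momentWeight_nonneg hδ.le _ _, fun i => ?_, ?_, ?_⟩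
  · refine div_nonneg (neg_nonneg.mpr (Real.log_nonpos (hx0 _).le (hx1 _ ?_))) hδ.le
    exact Nat.lt_succ_iff.mp i.2
  · rw [Fin.sum_univ_eq_sum_range (fun m => momentWeight f δ N m)]
    have h := eq_sum_momentWeight f δ (N := N) (j := 0) (Nat.zero_le _)
    simpa using h.symm
  have hsum : ∑ i : Fin (N + 1), momentWeight f δ N i = f 0 := by
    rw [Fin.sum_univ_eq_sum_range (fun m => momentWeight f δ N m)]
    have h := eq_sum_momentWeight f δ (N := N) (j := 0) (Nat.zero_le _)
    simpa using h.symm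
  set mix : ℝ → ℝ := fun t => ∑ i : Fin (N + 1),
    momentWeight f δ N i * Real.exp (-(-Real.log (x i) / δ * t)) with hmix
  have hgrid : ∀ j : ℕ, j ≤ J → |f (j * δ) - mix (j * δ)| ≤ ε / 2 := by
    intro j hj
    rw [eq_sum_momentWeight f δ (N := N) (hj.trans hJN.le),
      ← Fin.sum_univ_eq_sum_range (fun m => momentWeight f δ N m *
        ((m.descFactorial j : ℝ) / (N.descFactorial j : ℝ))) (N + 1)]
    simp only [hmix]
    rw [← Finset.sum_sub_distrib]
    calc _ ≤ ∑ i : Fin (N + 1), momentWeight f δ N i * (J * (J / N)) := by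
          refine (Finset.abs_sum_le_sum_abs _ _).trans (Finset.sum_le_sum fun i _ => ?_)
          rw [← mul_sub, abs_mul, abs_of_nonneg (hf.momentWeight_nonneg hδ.le _ _)]
          refine mul_le_mul_of_nonneg_left ?_ (hf.momentWeight_nonneg hδ.le _ _)
          have e : Real.exp (-(-Real.log (x i) / δ * (j * δ))) = x i ^ j := by
            have : -(-Real.log (x i) / δ * (j * δ)) = j * Real.log (x i) := by
              field_simp
            rw [this, Real.exp_nat_mul, Real.exp_log (hx0 _)]
          rw [e]
          refine (abs_descFactorial_div_sub_le hJN (Nat.lt_succ_iff.mp i.2) hj).trans ?_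
          gcongr
      _ = f 0 * (J * (J / N)) := by rw [← Finset.sum_mul, hsum]
      _ ≤ _ := hsmall
  -- Between grid points the mixture is controlled by monotonicity alone, without any bound on its
  -- exponents.
  have hanti : ∀ t t', t ≤ t' → mix t' ≤ mix t := by
    intro t t' htt
    refine Finset.sum_le_sum fun i _ => ?_
    refine mul_le_mul_of_nonneg_left ?_ (hf.momentWeight_nonneg hδ.le _ _)
    refine Real.exp_le_exp.mpr (neg_le_neg ?_)
    refine mul_le_mul_of_nonneg_left htt ?_
    exact div_nonneg (neg_nonneg.mpr (Real.log_nonpos (hx0 _).le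
      (hx1 _ (Nat.lt_succ_iff.mp i.2)))) hδ.le
  intro t ht htR
  change |f t - mix t| ≤ ε
  set j := ⌊t / δ⌋₊
  have hj1 : (j : ℝ) * δ ≤ t := by
    have := Nat.floor_le (div_nonneg ht hδ.le)
    rwa [le_div_iff₀ hδ] at this
  have hj2 : t ≤ ((j + 1 : ℕ) : ℝ) * δ := by
    have := Nat.lt_floor_add_one (t / δ)
    rw [div_lt_iff₀ hδ] at this
    push_cast; exact this.le
  have hjJ : j + 1 ≤ J := by
    rw [hJ]
    refine Nat.add_le_add_right ?_ 1
    refine (Nat.floor_le_floor (div_le_div_of_nonneg_right (htR.trans (le_abs_self R)) hδ.le)).trans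
      (Nat.floor_le_ceil _)
  have hg1 := abs_le.mp (hgrid j (by omega))
  have hg2 := abs_le.mp (hgrid (j + 1) hjJ)
  have hm1 := hanti _ _ hj1
  have hm2 := hanti _ _ hj2
  have hstep : ((j + 1 : ℕ) : ℝ) * δ = j * δ + δ := by push_cast; ring
  have hLnn : 0 ≤ L := by
    have := (abs_nonneg _).trans (hL 1 0 zero_le_one le_rfl); simpa using this
  have hl1 := hL t (j * δ) ht (by positivity)
  have hl2 := hL t (((j + 1 : ℕ) : ℝ) * δ) ht (by positivity)
  have hb1 : L * |t - j * δ| ≤ ε / 2 := by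
    refine le_trans ?_ hLδ
    gcongr
    rw [abs_of_nonneg (by linarith)]; linarith
  have hb2 : L * |t - ((j + 1 : ℕ) : ℝ) * δ| ≤ ε / 2 := by
    refine le_trans ?_ hLδ
    gcongr
    rw [abs_of_nonpos (by linarith)]; linarith
  have hl1 := abs_le.mp (hl1.trans hb1)
  have hl2 := abs_le.mp (hl2.trans hb2)
  rw [abs_le]
  constructor <;> linarith [hg1.1, hg1.2, hg2.1, hg2.2, hl1.1, hl1.2, hl2.1, hl2.2]

end ExponentialMixture

/-! ### Gaussian random features for one mode. -/

section RandomFeatures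

/-- The standard Gaussian measure on `ℝ^ι`. -/
noncomputable def stdNormal (ι : Type*) [Fintype ι] : Measure (ι → ℝ) :=
  Measure.pi fun _ => gaussianReal 0 1

instance (ι : Type*) [Fintype ι] : IsProbabilityMeasure (stdNormal ι) := by
  unfold stdNormal; infer_instance

theorem integral_cos_stdNormal {m : ℕ} (a : EuclideanSpace ℝ (Fin m)) :
    ∫ ζ, Real.cos (∑ i, ζ i * a i) ∂(stdNormal (Fin m)) = Real.exp (-(‖a‖ ^ 2 / 2)) := by
  have h := charFun_stdGaussian a
  rw [charFun_apply, ← map_pi_eq_stdGaussian, integral_map (by fun_prop) (by fun_prop)] at h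
  have h2 := congrArg Complex.re h
  have e : Complex.exp (-(‖a‖ : ℂ) ^ 2 / 2) = (Real.exp (-(‖a‖ ^ 2 / 2)) : ℂ) := by
    push_cast; ring_nf
  rw [e, Complex.ofReal_re] at h2
  rw [← h2, ← RCLike.re_eq_complex_re, ← integral_re]
  · refine integral_congr_ae (Filter.Eventually.of_forall fun ζ => ?_)
    simp only [PiLp.inner_apply, RCLike.re_eq_complex_re, Complex.exp_ofReal_mul_I_re]
    congr 1
    exact Finset.sum_congr rfl fun i _ => by simp [mul_comm]
  · refine Integrable.of_bound (C := 1) (by fun_prop) (Filter.Eventually.of_forall fun ζ => ?_)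
    rw [Complex.norm_exp_ofReal_mul_I]

end RandomFeatures

section RandomFeatures

theorem integral_mul_stdNormal {m : ℕ} (a b : EuclideanSpace ℝ (Fin m)) :
    ∫ ζ, (∑ i, ζ i * a i) * (∑ i, ζ i * b i) ∂(stdNormal (Fin m)) = inner ℝ a b := by
  have h : covarianceBilin (stdGaussian (EuclideanSpace ℝ (Fin m))) a b = inner ℝ a b := by
    rw [covarianceBilin_stdGaussian, innerSL_apply_apply]
  rw [covarianceBilin_apply IsGaussian.memLp_two_id] at h
  simp only [id, integral_id_stdGaussian, sub_zero] at h
  rw [← map_pi_eq_stdGaussian, integral_map (by fun_prop) (by fun_prop)] at h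
  rw [← h]
  refine integral_congr_ae (Filter.Eventually.of_forall fun ζ => ?_)
  simp [PiLp.inner_apply]

/-- Bochner's representation of the Gaussian kernel: the cosine of a difference is split by the
addition formula. The scale `√(2 s)` compensates the `1 / 2` in the Gaussian characteristic
function. -/
theorem integral_cos_add_sin {m : ℕ} {s : ℝ} (hs : 0 ≤ s) (a b : EuclideanSpace ℝ (Fin m)) :
    ∫ ζ, Real.cos (Real.sqrt (2 * s) * ∑ i, ζ i * a i) * Real.cos (Real.sqrt (2 * s) * ∑ i, ζ i * b i)
      ∂(stdNormal (Fin m))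
    + ∫ ζ, Real.sin (Real.sqrt (2 * s) * ∑ i, ζ i * a i) * Real.sin (Real.sqrt (2 * s) * ∑ i, ζ i * b i)
      ∂(stdNormal (Fin m)) = Real.exp (-(s * ‖a - b‖ ^ 2)) := by
  rw [← integral_add]
  · have h := integral_cos_stdNormal (Real.sqrt (2 * s) • (a - b))
    rw [norm_smul, mul_pow, Real.norm_eq_abs, sq_abs, Real.sq_sqrt (by positivity)] at h
    have e : -(2 * s * ‖a - b‖ ^ 2 / 2) = -(s * ‖a - b‖ ^ 2) := by ring
    rw [e] at h
    rw [← h]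
    refine integral_congr_ae (Filter.Eventually.of_forall fun ζ => ?_)
    simp only
    rw [← Real.cos_sub, ← mul_sub, ← Finset.sum_sub_distrib, Finset.mul_sum]
    congr 1
    refine Finset.sum_congr rfl fun i _ => ?_
    simp only [PiLp.smul_apply, PiLp.sub_apply, smul_eq_mul]
    ring
  · refine Integrable.of_bound (C := 1) (Continuous.aestronglyMeasurable (by fun_prop))
      (Filter.Eventually.of_forall fun ζ => ?_)
    rw [norm_mul, Real.norm_eq_abs, Real.norm_eq_abs]
    exact mul_le_one₀ (Real.abs_cos_le_one _) (abs_nonneg _) (Real.abs_cos_le_one _)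
  · refine Integrable.of_bound (C := 1) (Continuous.aestronglyMeasurable (by fun_prop))
      (Filter.Eventually.of_forall fun ζ => ?_)
    rw [norm_mul, Real.norm_eq_abs, Real.norm_eq_abs]
    exact mul_le_one₀ (Real.abs_sin_le_one _) (abs_nonneg _) (Real.abs_sin_le_one _)

/-- Every mode kernel is, uniformly on bounded sets, a limit of kernels given by finitely many
functions of a Gaussian linear form, with a uniform bound on these functions. -/
theorem ModeKernel.exists_random_features (κ : ModeKernel) :
    ∃ M : ℝ, 0 ≤ M ∧ ∀ R ε : ℝ, 0 < ε → ∃ (β : Type) (_ : Fintype β) (u : β → ℝ → ℝ),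
      (∀ i, Continuous (u i)) ∧ (∀ z, ∑ i, u i z ^ 2 ≤ M * (1 + z ^ 2)) ∧
      ∀ (m : ℕ) (a b : EuclideanSpace ℝ (Fin m)), ‖a‖ ^ 2 ≤ R → ‖b‖ ^ 2 ≤ R →
        |κ.eval a b - ∑ i, ∫ ζ, u i (∑ l, ζ l * a l) * u i (∑ l, ζ l * b l) ∂(stdNormal (Fin m))|
          ≤ ε := by
  rcases hκ : κ.form with _ | _
  · have hP := κ.isRadialPosSemidef hκ
    have h0 : 0 ≤ κ.h 0 := hP.nonneg le_rfl
    have hL : ∀ x y, 0 ≤ x → 0 ≤ y → |κ.h x - κ.h y| ≤ κ.lip * |x - y| := by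
      intro x y hx hy
      have := κ.lipschitz.dist_le_mul x (by rw [hκ]; exact hx) y (by rw [hκ]; exact hy)
      simpa [Real.dist_eq] using this
    -- The total weight of the mixture is `κ.h 0` for every radius and accuracy, and `cos² + sin² =
    -- 1`. So the growth constant does not depend on `ε`, which can therefore be sent to zero later.
    refine ⟨κ.h 0, h0, fun R ε hε => ?_⟩
    obtain ⟨n, w, s, hw, hs, hsum, happ⟩ := hP.exists_exp_mixture hL (4 * R) hε
    refine ⟨Fin n ⊕ Fin n, inferInstance,
      Sum.elim (fun i z => Real.sqrt (w i) * Real.cos (Real.sqrt (2 * s i) * z))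
        (fun i z => Real.sqrt (w i) * Real.sin (Real.sqrt (2 * s i) * z)), ?_, ?_, ?_⟩
    · rintro (i | i) <;> simp only [Sum.elim_inl, Sum.elim_inr] <;> fun_prop
    · intro z
      rw [Fintype.sum_sum_type]
      simp only [Sum.elim_inl, Sum.elim_inr, mul_pow, Real.sq_sqrt (hw _)]
      rw [← Finset.sum_add_distrib]
      simp only [← mul_add, Real.cos_sq_add_sin_sq, mul_one, hsum]
      nlinarith [sq_nonneg z]
    · intro m a b ha hb
      rw [Fintype.sum_sum_type]
      simp only [Sum.elim_inl, Sum.elim_inr]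
      have e : ∀ i, (∫ ζ, Real.sqrt (w i) * Real.cos (Real.sqrt (2 * s i) * ∑ l, ζ l * a l)
            * (Real.sqrt (w i) * Real.cos (Real.sqrt (2 * s i) * ∑ l, ζ l * b l))
            ∂(stdNormal (Fin m)))
          + ∫ ζ, Real.sqrt (w i) * Real.sin (Real.sqrt (2 * s i) * ∑ l, ζ l * a l)
            * (Real.sqrt (w i) * Real.sin (Real.sqrt (2 * s i) * ∑ l, ζ l * b l))
            ∂(stdNormal (Fin m)) = w i * Real.exp (-(s i * ‖a - b‖ ^ 2)) := by
        intro i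
        rw [← integral_cos_add_sin (hs i), mul_add, ← integral_const_mul, ← integral_const_mul]
        congr 1 <;>
        · refine integral_congr_ae (Filter.Eventually.of_forall fun ζ => ?_)
          simp only
          rw [mul_mul_mul_comm, Real.mul_self_sqrt (hw i)]
      rw [← Finset.sum_add_distrib, Finset.sum_congr rfl fun i _ => e i]
      have h4 := κ.form.abs_arg_le ha hb
      simp only [hκ, KernelForm.arg] at h4
      simp only [ModeKernel.eval, hκ, KernelForm.arg]
      exact happ _ (sq_nonneg _) ((le_abs_self _).trans h4)
  -- An affine profile has exact features: a constant and a multiple of the Gaussian form.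
  · obtain ⟨a₀, b₀, ha₀, hb₀, hh⟩ := ModeKernel.exists_affine hκ
    refine ⟨a₀ + b₀, by positivity, fun R ε hε => ?_⟩
    refine ⟨Bool, inferInstance,
      fun i z => if i then Real.sqrt a₀ else Real.sqrt b₀ * z, ?_, ?_, ?_⟩
    · rintro (_ | _) <;> simp <;> fun_prop
    · intro z
      simp only [Fintype.sum_bool, if_true, Bool.false_eq_true, if_false, mul_pow,
        Real.sq_sqrt ha₀, Real.sq_sqrt hb₀]
      nlinarith [sq_nonneg z, mul_nonneg ha₀ (sq_nonneg z)]
    · intro m a b _ _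
      simp only [Fintype.sum_bool, if_true, Bool.false_eq_true, if_false, integral_const,
        probReal_univ, smul_eq_mul, one_mul, Real.mul_self_sqrt ha₀]
      have e : ∫ ζ, Real.sqrt b₀ * (∑ l, ζ l * a l) * (Real.sqrt b₀ * ∑ l, ζ l * b l)
          ∂(stdNormal (Fin m)) = b₀ * inner ℝ a b := by
        rw [← integral_mul_stdNormal, ← integral_const_mul]
        refine integral_congr_ae (Filter.Eventually.of_forall fun ζ => ?_)
        simp only
        rw [mul_mul_mul_comm, Real.mul_self_sqrt hb₀]
      rw [e]
      simp only [ModeKernel.eval, hκ, KernelForm.arg, hh]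
      simpa using hε.le

end RandomFeatures

/-! ### Gaussian laws with nearby covariances. -/

section GaussianComparison

theorem stdNormal_eq_withDensity (N : Type*) [Fintype N] :
    stdNormal N = volume.withDensity fun ζ : N → ℝ =>
      ENNReal.ofReal ((Real.sqrt (2 * Real.pi))⁻¹ ^ Fintype.card N
        * Real.exp (-(∑ i, ζ i ^ 2) / 2)) := by
  have e : ∀ ζ : N → ℝ, (Real.sqrt (2 * Real.pi))⁻¹ ^ Fintype.card N
      * Real.exp (-(∑ i, ζ i ^ 2) / 2) = ∏ i, gaussianPDFReal 0 1 (ζ i) := by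
    intro ζ
    simp only [gaussianPDFReal, Finset.prod_mul_distrib, Finset.prod_const, Finset.card_univ,
      NNReal.coe_one, mul_one, sub_zero]
    rw [← Real.exp_sum]
    congr 2
    rw [neg_div, Finset.sum_div, ← Finset.sum_neg_distrib]
    exact Finset.sum_congr rfl fun i _ => by ring
  simp_rw [e]
  refine (Measure.pi_eq fun s hs => ?_)
  rw [withDensity_apply _ (MeasurableSet.univ_pi hs), ← ofReal_integral_eq_lintegral_ofReal,
    volume_pi, Measure.restrict_pi_pi, integral_fintype_prod_eq_prod,
    ENNReal.ofReal_prod_of_nonneg]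
  · exact Finset.prod_congr rfl fun i _ => (gaussianReal_apply_eq_integral 0 one_ne_zero _).symm
  · exact fun i _ => integral_nonneg fun x => gaussianPDFReal_nonneg 0 1 x
  · rw [volume_pi, Measure.restrict_pi_pi]
    exact Integrable.fintype_prod fun i => (integrable_gaussianPDFReal 0 1).restrict
  · exact Filter.Eventually.of_forall fun ζ =>
      Finset.prod_nonneg fun i _ => gaussianPDFReal_nonneg 0 1 _

theorem charFun_map_mulVec {N Θ : Type*} [Fintype N] [Fintype Θ] (W : Matrix N Θ ℝ)
    (t : EuclideanSpace ℝ N) :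
    charFun ((stdNormal Θ).map fun ζ => WithLp.toLp 2 (W.mulVec ζ)) t
      = Complex.exp (-((t.ofLp ⬝ᵥ (W * W.transpose).mulVec t.ofLp : ℝ) : ℂ) / 2) := by
  have hm : Measurable fun ζ : Θ → ℝ => (WithLp.toLp 2 (W.mulVec ζ) : EuclideanSpace ℝ N) := by
    refine Continuous.measurable ((PiLp.continuous_toLp 2 (fun _ : N => ℝ)).comp ?_)
    exact continuous_const.matrix_mulVec continuous_id
  set s : EuclideanSpace ℝ Θ := WithLp.toLp 2 (W.transpose.mulVec t.ofLp) with hs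
  have h := charFun_stdGaussian s
  rw [charFun_apply, ← map_pi_eq_stdGaussian, integral_map (by fun_prop) (by fun_prop)] at h
  rw [charFun_apply, integral_map hm.aemeasurable (by fun_prop)]
  have e1 : ∀ ζ : Θ → ℝ, (inner ℝ (WithLp.toLp 2 (W.mulVec ζ) : EuclideanSpace ℝ N) t : ℝ)
      = inner ℝ (WithLp.toLp 2 ζ : EuclideanSpace ℝ Θ) s := by
    intro ζ
    rw [EuclideanSpace.inner_eq_star_dotProduct, EuclideanSpace.inner_eq_star_dotProduct]
    simp only [star_trivial, hs]
    rw [Matrix.dotProduct_mulVec, ← Matrix.mulVec_transpose]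
  simp_rw [e1]
  refine h.trans ?_
  congr 2
  rw [← Complex.ofReal_pow, ← Complex.ofReal_neg, ← Complex.ofReal_neg, EuclideanSpace.real_norm_sq_eq]
  congr 2
  rw [← Matrix.mulVec_mulVec, Matrix.dotProduct_mulVec, ← Matrix.mulVec_transpose]
  simp [dotProduct, hs, sq]

/-- A centred Gaussian law is determined by its covariance. This replaces the rectangular projection
by a square matrix, for which a density is available. -/
theorem map_mulVec_stdNormal_eq {N Θ Θ' : Type*} [Fintype N] [Fintype Θ] [Fintype Θ']
    {W : Matrix N Θ ℝ} {W' : Matrix N Θ' ℝ} (h : W * W.transpose = W' * W'.transpose) :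
    (stdNormal Θ).map W.mulVec = (stdNormal Θ').map W'.mulVec := by
  have hm : ∀ (Θ : Type _) [Fintype Θ] (W : Matrix N Θ ℝ), Measurable fun ζ : Θ → ℝ => W.mulVec ζ :=
    fun Θ _ W => (continuous_const.matrix_mulVec continuous_id).measurable
  have hm' : ∀ (Θ : Type _) [Fintype Θ] (W : Matrix N Θ ℝ), Measurable fun ζ : Θ → ℝ => W.mulVec ζ :=
    fun Θ _ W => (continuous_const.matrix_mulVec continuous_id).measurable
  have key : ((stdNormal Θ).map W.mulVec).map (WithLp.toLp 2)
      = ((stdNormal Θ').map W'.mulVec).map (WithLp.toLp 2 : (N → ℝ) → EuclideanSpace ℝ N) := by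
    rw [Measure.map_map (by fun_prop) (hm _ _), Measure.map_map (by fun_prop) (hm' _ _)]
    have i1 : IsProbabilityMeasure ((stdNormal Θ).map
        ((WithLp.toLp 2 : (N → ℝ) → EuclideanSpace ℝ N) ∘ W.mulVec)) :=
      Measure.isProbabilityMeasure_map (Measurable.comp (by fun_prop) (hm _ _)).aemeasurable
    have i2 : IsProbabilityMeasure ((stdNormal Θ').map
        ((WithLp.toLp 2 : (N → ℝ) → EuclideanSpace ℝ N) ∘ W'.mulVec)) :=
      Measure.isProbabilityMeasure_map (Measurable.comp (by fun_prop) (hm' _ _)).aemeasurable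
    refine Measure.ext_of_charFun (funext fun t => ?_)
    refine (charFun_map_mulVec W t).trans ?_
    rw [h]
    exact (charFun_map_mulVec W' t).symm
  exact (MeasurableEquiv.toLp 2 (N → ℝ)).map_measurableEquiv_injective key

open Matrix in
theorem dotProduct_mulVec_abs_le {N : Type*} [Fintype N] {E : Matrix N N ℝ} {τ : ℝ}
    (hE : ∀ i j, |E i j| ≤ τ) (x y : N → ℝ) :
    |x ⬝ᵥ E *ᵥ y| ≤ τ * Fintype.card N * (Real.sqrt (∑ i, x i ^ 2) * Real.sqrt (∑ i, y i ^ 2)) := by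
  have habs : ∀ x : N → ℝ, ∑ i, |x i| ≤ Real.sqrt (Fintype.card N) * Real.sqrt (∑ i, x i ^ 2) := by
    intro x
    rw [← Real.sqrt_mul (Nat.cast_nonneg _)]
    refine Real.le_sqrt_of_sq_le ?_
    have := sq_sum_le_card_mul_sum_sq (s := Finset.univ) (f := fun i => |x i|)
    simpa using this
  rcases isEmpty_or_nonempty N with hN | ⟨⟨i₀⟩⟩
  · simp [dotProduct]
  have hτ : 0 ≤ τ := (abs_nonneg _).trans (hE i₀ i₀)
  calc |x ⬝ᵥ E *ᵥ y| = |∑ i, ∑ j, x i * (E i j * y j)| := by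
        simp only [dotProduct, mulVec, Finset.mul_sum]
    _ ≤ ∑ i, ∑ j, |x i| * (τ * |y j|) := by
        refine (Finset.abs_sum_le_sum_abs _ _).trans (Finset.sum_le_sum fun i _ => ?_)
        refine (Finset.abs_sum_le_sum_abs _ _).trans (Finset.sum_le_sum fun j _ => ?_)
        rw [abs_mul, abs_mul]
        gcongr
        exact hE i j
    _ = τ * ((∑ i, |x i|) * ∑ j, |y j|) := by
        rw [Finset.sum_mul_sum, Finset.mul_sum]
        refine Finset.sum_congr rfl fun i _ => ?_
        rw [Finset.mul_sum]
        exact Finset.sum_congr rfl fun j _ => by ring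
    _ ≤ τ * ((Real.sqrt (Fintype.card N) * Real.sqrt (∑ i, x i ^ 2))
          * (Real.sqrt (Fintype.card N) * Real.sqrt (∑ i, y i ^ 2))) := by
        have := Finset.sum_nonneg (s := Finset.univ) fun (i : N) _ => abs_nonneg (y i)
        gcongr
        · exact habs x
        · exact habs y
    _ = _ := by
        have := Real.mul_self_sqrt (Nat.cast_nonneg (Fintype.card N) : (0 : ℝ) ≤ Fintype.card N)
        linear_combination τ * Real.sqrt (∑ i, x i ^ 2) * Real.sqrt (∑ i, y i ^ 2) * this

open Matrix in
/-- The density of a Gaussian law with covariance near the identity, compared with the standard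
one on a ball. -/
theorem sq_inv_mulVec_le {N : Type*} [Fintype N] [DecidableEq N] {S : Matrix N N ℝ} {τ T : ℝ}
    (hdet : IsUnit S.det) (hS : ∀ i j, |(S * Sᵀ - 1) i j| ≤ τ) (hτ : τ * Fintype.card N ≤ 1 / 2)
    (hτT : 2 * (τ * Fintype.card N) * T ≤ 1 / 2) (hτ0 : 0 ≤ τ) {ζ : N → ℝ} (hζ : ∑ i, ζ i ^ 2 ≤ T) :
    ∑ i, (S⁻¹ *ᵥ ζ) i ^ 2 ≤ ∑ i, ζ i ^ 2 + 1 / 2 := by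
  set w := S⁻¹ *ᵥ ζ with hw
  -- Here `v` is `(S Sᵀ)⁻¹ ζ`. The quantity to bound is `⟨v, ζ⟩`, and `ζ - v` is the small matrix `S
  -- Sᵀ - 1` applied to `v`.
  set v := (Sᵀ)⁻¹ *ᵥ w with hv
  have hST : Sᵀ *ᵥ v = w := by
    rw [hv, mulVec_mulVec, Matrix.mul_nonsing_inv _ (by rwa [det_transpose]), one_mulVec]
  have hSw : S *ᵥ w = ζ := by
    rw [hw, mulVec_mulVec, Matrix.mul_nonsing_inv _ hdet, one_mulVec]
  have hζv : ζ = v + (S * Sᵀ - 1) *ᵥ v := by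
    rw [Matrix.sub_mulVec, one_mulVec, ← mulVec_mulVec, hST, hSw]; abel
  have hsq : ∀ x : N → ℝ, ∑ i, x i ^ 2 = x ⬝ᵥ x := fun x => by simp [dotProduct, sq]
  have hww : w ⬝ᵥ w = v ⬝ᵥ ζ := by
    nth_rw 1 [← hST]
    rw [← hSw, dotProduct_mulVec v S w, ← Matrix.mulVec_transpose]
  set nv := Real.sqrt (∑ i, v i ^ 2)
  set nz := Real.sqrt (∑ i, ζ i ^ 2)
  have hnv : nv ^ 2 = v ⬝ᵥ v := by
    rw [← hsq, Real.sq_sqrt (Finset.sum_nonneg fun i _ => sq_nonneg _)]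
  have hnz : nz ^ 2 = ∑ i, ζ i ^ 2 := Real.sq_sqrt (Finset.sum_nonneg fun i _ => sq_nonneg _)
  have hnv0 : 0 ≤ nv := Real.sqrt_nonneg _
  have hnz0 : 0 ≤ nz := Real.sqrt_nonneg _
  have h1 := dotProduct_mulVec_abs_le hS v v
  have h2 := dotProduct_mulVec_abs_le hS ζ v
  have hcs : v ⬝ᵥ ζ ≤ nv * nz := Real.sum_mul_le_sqrt_mul_sqrt _ _ _
  have h3 : v ⬝ᵥ ζ = nv ^ 2 + v ⬝ᵥ (S * Sᵀ - 1) *ᵥ v := by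
    nth_rw 1 [hζv]
    rw [dotProduct_add, hnv]
  have h4 : nv ^ 2 / 2 ≤ nv * nz := by
    have := (abs_le.mp h1).1
    have h5 : τ * Fintype.card N * (nv * nv) ≤ 1 / 2 * (nv * nv) := by gcongr
    nlinarith
  have h5 : nv ≤ 2 * nz := by
    rcases hnv0.eq_or_lt with h | h
    · rw [← h]; positivity
    · nlinarith
  have h6 : w ⬝ᵥ w = ∑ i, ζ i ^ 2 - ζ ⬝ᵥ (S * Sᵀ - 1) *ᵥ v := by
    rw [hww, hsq, dotProduct_comm v ζ]
    nth_rw 3 [hζv]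
    rw [dotProduct_add]; ring
  rw [hsq, h6]
  have h7 := (abs_le.mp h2).1
  have h8 : τ * Fintype.card N * (nz * nv) ≤ τ * Fintype.card N * (nz * (2 * nz)) := by gcongr
  have h9 : τ * Fintype.card N * (nz * (2 * nz)) ≤ 2 * (τ * Fintype.card N) * T := by
    have : nz ^ 2 ≤ T := hnz.trans_le hζ
    have h0 : 0 ≤ τ * Fintype.card N := by positivity
    nlinarith
  linarith

open Matrix in
-- By the change of variables formula the ratio of the densities is `|det S|` times the exponential
-- of half the growth of the squared norm under `S⁻¹`. On the ball this is at most `√2 * exp (1 / 4)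
-- < 2`.
theorem stdNormal_le_map_of_near_one {N : Type*} [Fintype N] [DecidableEq N] {S : Matrix N N ℝ}
    {T : ℝ} (hdet : S.det ≠ 0) (hdet2 : S.det ^ 2 ≤ 2)
    (hS : ∀ ζ : N → ℝ, ∑ i, ζ i ^ 2 ≤ T → ∑ i, (S⁻¹ *ᵥ ζ) i ^ 2 ≤ ∑ i, ζ i ^ 2 + 1 / 2)
    {s : Set (N → ℝ)} (hs : MeasurableSet s) (hsT : ∀ ζ ∈ s, ∑ i, ζ i ^ 2 ≤ T) :
    stdNormal N s ≤ 2 * (stdNormal N).map S.mulVec s := by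
  have hSm : Measurable fun ζ : N → ℝ => S *ᵥ ζ :=
    (continuous_const.matrix_mulVec continuous_id).measurable
  have hSim : Measurable fun ζ : N → ℝ => S⁻¹ *ᵥ ζ :=
    (continuous_const.matrix_mulVec continuous_id).measurable
  rw [Measure.map_apply hSm hs]
  set c : ℝ := (Real.sqrt (2 * Real.pi))⁻¹ ^ Fintype.card N with hc
  have hc0 : 0 ≤ c := by positivity
  set ρ : (N → ℝ) → ℝ≥0∞ := fun ζ => ENNReal.ofReal (c * Real.exp (-(∑ i, ζ i ^ 2) / 2)) with hρ
  have hρm : Measurable ρ := by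
    refine ENNReal.measurable_ofReal.comp (Continuous.measurable ?_)
    fun_prop
  have hγ : stdNormal N = volume.withDensity ρ := stdNormal_eq_withDensity N
  rw [hγ, withDensity_apply _ hs, withDensity_apply _ (hSm hs)]
  have hmap := Real.map_matrix_volume_pi_eq_smul_volume_pi hdet
  have e1 : ∫⁻ η in (S.mulVec) ⁻¹' s, ρ η = ENNReal.ofReal |S.det⁻¹| * ∫⁻ ζ in s, ρ (S⁻¹ *ᵥ ζ) := by
    have h1 : ∫⁻ η in (S.mulVec) ⁻¹' s, ρ η
        = ∫⁻ η, s.indicator (fun ζ => ρ (S⁻¹ *ᵥ ζ)) (S *ᵥ η) := by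
      rw [← lintegral_indicator (hSm hs)]
      refine lintegral_congr fun η => ?_
      by_cases hη : S *ᵥ η ∈ s
      · rw [Set.indicator_of_mem (by exact hη), Set.indicator_of_mem hη, mulVec_mulVec,
          Matrix.nonsing_inv_mul _ (isUnit_iff_ne_zero.mpr hdet), one_mulVec]
      · rw [Set.indicator_of_notMem (by exact hη), Set.indicator_of_notMem hη]
    rw [h1, ← lintegral_indicator hs, ← lintegral_map (f := s.indicator fun ζ => ρ (S⁻¹ *ᵥ ζ))
      ((hρm.comp hSim).indicator hs) hSm]
    have e2 : Measure.map (fun ζ : N → ℝ => S *ᵥ ζ) volume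
        = ENNReal.ofReal |S.det⁻¹| • (volume : Measure (N → ℝ)) := hmap
    rw [e2, lintegral_smul_measure, smul_eq_mul]
  rw [e1, ← mul_assoc, ← lintegral_const_mul (f := fun ζ => ρ (S⁻¹ *ᵥ ζ)) _ (hρm.comp hSim)]
  refine setLIntegral_mono ((hρm.comp hSim).const_mul _) fun ζ hζ => ?_
  have e3 : (2 : ℝ≥0∞) = ENNReal.ofReal 2 := by simp
  simp only [hρ]
  rw [e3, ← ENNReal.ofReal_mul zero_le_two, ← ENNReal.ofReal_mul (by positivity)]
  refine ENNReal.ofReal_le_ofReal ?_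
  have h1 := hS ζ (hsT ζ hζ)
  have hd : 0 < |S.det| := abs_pos.mpr hdet
  have h2 : Real.exp (1 / 4) * |S.det| ≤ 2 := by
    have h3 : Real.exp (1 / 4) ^ 2 ≤ 2 := by
      rw [← Real.exp_nat_mul]
      have h4 : Real.exp ((2 : ℕ) * (1 / 4)) ^ 2 ≤ 2 ^ 2 := by
        rw [← Real.exp_nat_mul]
        norm_num
        linarith [Real.exp_one_lt_d9]
      exact le_of_sq_le_sq h4 zero_le_two
    have h5 : (Real.exp (1 / 4) * |S.det|) ^ 2 ≤ 2 ^ 2 := by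
      rw [mul_pow, sq_abs]
      nlinarith [sq_nonneg (Real.exp (1 / 4)), sq_nonneg S.det]
    exact le_of_sq_le_sq h5 zero_le_two
  have h6 : Real.exp (-(∑ i, ζ i ^ 2) / 2)
      ≤ Real.exp (1 / 4) * Real.exp (-(∑ i, (S⁻¹ *ᵥ ζ) i ^ 2) / 2) := by
    rw [← Real.exp_add]
    refine Real.exp_le_exp.mpr ?_
    linarith
  have h7 : Real.exp (1 / 4) ≤ 2 * |S.det⁻¹| := by
    rw [abs_inv, ← div_eq_mul_inv, le_div_iff₀ hd]; exact h2
  calc c * Real.exp (-(∑ i, ζ i ^ 2) / 2)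
      ≤ c * (Real.exp (1 / 4) * Real.exp (-(∑ i, (S⁻¹ *ᵥ ζ) i ^ 2) / 2)) := by gcongr
    _ ≤ c * (2 * |S.det⁻¹| * Real.exp (-(∑ i, (S⁻¹ *ᵥ ζ) i ^ 2) / 2)) := by gcongr
    _ = _ := by ring

open Matrix in
/-- The standard Gaussian law on a ball is dominated by twice the law of `Vᵀ ζ` when `Vᵀ V` is close
enough to the identity. -/
theorem exists_stdNormal_restrict_le (N : Type*) [Fintype N] [DecidableEq N] :
    ∃ τ₀ : ℝ, 0 < τ₀ ∧ ∀ T : ℝ, 1 ≤ T → ∀ (Θ : Type) [Fintype Θ] (V : Matrix Θ N ℝ),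
      (∀ i j, |(Vᵀ * V - 1 : Matrix N N ℝ) i j| ≤ τ₀ / T) →
      (stdNormal N).restrict {ζ | ∑ i, ζ i ^ 2 ≤ T} ≤ (2 : ℝ≥0∞) • (stdNormal Θ).map Vᵀ.mulVec := by
  have hcont : Continuous fun M : Matrix N N ℝ => M.det := Continuous.matrix_det continuous_id
  have hnhds : ∀ᶠ M : Matrix N N ℝ in nhds 1, M.det ∈ Set.Ioo (0 : ℝ) 2 := by
    refine (hcont.tendsto 1).eventually (isOpen_Ioo.mem_nhds ?_)
    simp
  have hball : ∃ τ₁ > 0, ∀ M : Matrix N N ℝ, (∀ i j, |(M - 1) i j| ≤ τ₁) →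
      M.det ∈ Set.Ioo (0 : ℝ) 2 := by
    have h2 : ∀ᶠ M : N → N → ℝ in nhds (fun i j => (1 : Matrix N N ℝ) i j),
      (Matrix.of M).det ∈ Set.Ioo (0 : ℝ) 2 := hnhds
    obtain ⟨τ₁, hτ₁, h3⟩ := Metric.eventually_nhds_iff.mp h2
    refine ⟨τ₁ / 2, by positivity, fun M hM => h3 (y := fun i j => M i j) ?_⟩
    refine lt_of_le_of_lt ?_ (half_lt_self hτ₁)
    refine (dist_pi_le_iff (by positivity)).mpr fun i => (dist_pi_le_iff (by positivity)).mpr fun j => ?_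
    exact hM i j
  obtain ⟨τ₁, hτ₁, hdet⟩ := hball
  set n : ℝ := (Fintype.card N : ℝ) with hn
  have hn0 : 0 ≤ n := Nat.cast_nonneg _
  -- The first bound keeps the determinant below `2`. The second, divided by `T`, makes the change
  -- of the squared norm on the ball at most `1 / 2`.
  refine ⟨min τ₁ (1 / (4 * (n + 1))), by positivity, fun T hT Θ _ V hV => ?_⟩
  set τ := min τ₁ (1 / (4 * (n + 1))) / T
  have hτ0 : 0 ≤ τ := by positivity
  have hτ1 : τ ≤ min τ₁ (1 / (4 * (n + 1))) := div_le_self (by positivity) hT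
  have hτT : τ * T ≤ 1 / (4 * (n + 1)) := by
    simp only [τ]
    rw [div_mul_cancel₀ _ (by linarith)]
    exact min_le_right _ _
  obtain ⟨B, hB⟩ : ∃ B : Matrix N N ℝ, Vᵀ * V = Bᵀ * B := by
    have hP : (Vᵀ * V).PosSemidef := by
      have := Matrix.posSemidef_conjTranspose_mul_self V
      rwa [Matrix.conjTranspose_eq_transpose_of_trivial] at this
    open scoped MatrixOrder in
    obtain ⟨B, hB⟩ := CStarAlgebra.nonneg_iff_eq_star_mul_self.mp hP.nonneg
    exact ⟨B, hB⟩
  have hmap : (stdNormal Θ).map Vᵀ.mulVec = (stdNormal N).map Bᵀ.mulVec :=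
    map_mulVec_stdNormal_eq (by rw [transpose_transpose, transpose_transpose, hB])
  have hVd := hdet (Vᵀ * V) fun i j => (hV i j).trans (hτ1.trans (min_le_left _ _))
  have hdetB : Bᵀ.det ^ 2 = (Vᵀ * V).det := by
    rw [hB, det_mul, det_transpose]; ring
  have hdet0 : Bᵀ.det ≠ 0 := by
    intro h0
    rw [h0] at hdetB
    have := hVd.1
    rw [← hdetB] at this
    norm_num at this
  have hmeas : MeasurableSet {ζ : N → ℝ | ∑ i, ζ i ^ 2 ≤ T} :=
    measurableSet_le (Continuous.measurable (by fun_prop)) measurable_const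
  rw [Measure.le_iff]
  intro s hs
  rw [Measure.restrict_apply hs, Measure.smul_apply, smul_eq_mul, hmap]
  refine (stdNormal_le_map_of_near_one (T := T) hdet0 (hdetB.trans_le hVd.2.le) ?_ (hs.inter hmeas)
    fun ζ hζ => hζ.2).trans (by gcongr; exact Set.inter_subset_left)
  intro ζ hζ
  have h4 : (1 / (4 * (n + 1))) * n ≤ 1 / 4 := by
    rw [div_mul_eq_mul_div, div_le_div_iff₀ (by positivity) (by norm_num)]; linarith
  refine sq_inv_mulVec_le (τ := τ) (T := T) (isUnit_iff_ne_zero.mpr hdet0) ?_ ?_ ?_ hτ0 hζ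
  · intro i j
    rw [transpose_transpose, ← hB]; exact hV i j
  · have := mul_le_mul_of_nonneg_right (hτ1.trans (min_le_right _ _)) hn0
    linarith
  · have := mul_le_mul_of_nonneg_right hτT hn0
    nlinarith

end GaussianComparison

/-! ### Quadratic forms as second moments of random features. -/

section QuadraticForms

variable {Ω Z : Type*} [MeasurableSpace Ω] [MeasurableSpace Z]

theorem sq_integral_abs_le {Q : Measure Ω} [IsProbabilityMeasure Q] {φ : Ω → ℝ} {b : ℝ}
    (hφm : Measurable φ) (hφ : ∀ᵐ ω ∂Q, |φ ω| ≤ b) :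
    (∫ ω, |φ ω| ∂Q) ^ 2 ≤ ∫ ω, φ ω ^ 2 ∂Q := by
  have hL : MemLp (fun ω => |φ ω|) 2 Q :=
    MemLp.of_bound hφm.abs.aestronglyMeasurable b (by simpa using hφ)
  have h1 := variance_eq_sub hL
  have h2 := variance_nonneg (fun ω => |φ ω|) Q
  have h3 : (∫ ω, ((fun ω => |φ ω|) ^ 2) ω ∂Q) = ∫ ω, φ ω ^ 2 ∂Q := by simp
  rw [h1, h3] at h2
  linarith

theorem sq_integral_mul_le {Q : Measure Ω} {φ ψ : Ω → ℝ} (hφ : MemLp φ 2 Q) (hψ : MemLp ψ 2 Q) :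
    (∫ ω, φ ω * ψ ω ∂Q) ^ 2 ≤ (∫ ω, φ ω ^ 2 ∂Q) * ∫ ω, ψ ω ^ 2 ∂Q := by
  have e : ∀ {f g : Ω → ℝ} (hf : MemLp f 2 Q) (hg : MemLp g 2 Q),
      (inner ℝ (hf.toLp f) (hg.toLp g) : ℝ) = ∫ ω, f ω * g ω ∂Q := by
    intro f g hf hg
    rw [L2.inner_def]
    refine integral_congr_ae ?_
    filter_upwards [hf.coeFn_toLp, hg.coeFn_toLp] with ω h1 h2
    rw [h1, h2]
    simp [mul_comm]
  have h := real_inner_mul_inner_self_le (hφ.toLp φ) (hψ.toLp ψ)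
  rw [e, e, e] at h
  simpa only [sq] using h

theorem norm_integral_sq_eq {H : Type*} [NormedAddCommGroup H] [InnerProductSpace ℝ H]
    [CompleteSpace H] {Q : Measure Ω} [IsProbabilityMeasure Q] {Φ : Ω → H} {κ b : ℝ} {φ : Ω → ℝ}
    (hΦm : StronglyMeasurable Φ) (hΦ : ∀ ω, ‖Φ ω‖ ≤ κ) (hφm : Measurable φ)
    (hφ : ∀ᵐ ω ∂Q, |φ ω| ≤ b) :
    ‖∫ ω, φ ω • Φ ω ∂Q‖ ^ 2
      = ∫ p, φ p.1 * φ p.2 * inner ℝ (Φ p.1) (Φ p.2) ∂(Q.prod Q)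
    ∧ Integrable (fun p : Ω × Ω => φ p.1 * φ p.2 * (inner ℝ (Φ p.1) (Φ p.2) : ℝ)) (Q.prod Q) := by
  have hint : Integrable (fun ω => φ ω • Φ ω) Q :=
    integrable_smul_of_bound hφm hΦm hφ (Filter.Eventually.of_forall hΦ)
  have hi2 : Integrable (fun p : Ω × Ω => φ p.1 * φ p.2 * (inner ℝ (Φ p.1) (Φ p.2) : ℝ))
      (Q.prod Q) := by
    refine Integrable.of_bound (C := b * b * (κ * κ)) ?_ ?_
    · refine StronglyMeasurable.aestronglyMeasurable ?_
      exact ((hφm.comp measurable_fst).mul (hφm.comp measurable_snd)).stronglyMeasurable.mul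
        ((hΦm.comp_measurable measurable_fst).inner (hΦm.comp_measurable measurable_snd))
    · filter_upwards [Measure.quasiMeasurePreserving_fst.ae hφ,
        Measure.quasiMeasurePreserving_snd.ae hφ] with p h1 h2
      rw [Real.norm_eq_abs, abs_mul, abs_mul]
      have h3 : |inner ℝ (Φ p.1) (Φ p.2)| ≤ κ * κ :=
        (abs_real_inner_le_norm _ _).trans
          (mul_le_mul (hΦ _) (hΦ _) (norm_nonneg _) ((norm_nonneg _).trans (hΦ p.1)))
      have hb : 0 ≤ b := (abs_nonneg _).trans h1
      gcongr
  refine ⟨?_, hi2⟩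
  rw [integral_prod _ hi2, ← real_inner_self_eq_norm_sq, ← integral_mul_inner hint]
  refine integral_congr_ae (Filter.Eventually.of_forall fun ω => ?_)
  simp only
  rw [real_inner_comm, ← integral_mul_inner hint, ← integral_const_mul]
  refine integral_congr_ae (Filter.Eventually.of_forall fun ω' => ?_)
  simp only [real_inner_comm (Φ ω) (Φ ω')]
  ring

/-- If the Gram function of `Φ` is approximated by the second moments of the random features `U`,
then so are the quadratic forms. -/
theorem abs_norm_integral_sq_sub_le {H β : Type*} [NormedAddCommGroup H] [InnerProductSpace ℝ H]
    [CompleteSpace H] [Fintype β] {Q : Measure Ω} [IsProbabilityMeasure Q] {μ : Measure Z}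
    [IsProbabilityMeasure μ] {Φ : Ω → H} {κ b ε : ℝ} {φ : Ω → ℝ} {U : β → Z → Ω → ℝ} {g : Z → ℝ}
    (hΦm : StronglyMeasurable Φ) (hΦ : ∀ ω, ‖Φ ω‖ ≤ κ) (hφm : Measurable φ)
    (hφ : ∀ᵐ ω ∂Q, |φ ω| ≤ b) (hUm : ∀ i, Measurable (Function.uncurry (U i)))
    (hg : MemLp g 2 μ) (hU : ∀ i z ω, |U i z ω| ≤ g z)
    (happ : ∀ ω ω', |inner ℝ (Φ ω) (Φ ω') - ∑ i, ∫ z, U i z ω * U i z ω' ∂μ| ≤ ε) :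
    |‖∫ ω, φ ω • Φ ω ∂Q‖ ^ 2 - ∑ i, ∫ z, (∫ ω, φ ω * U i z ω ∂Q) ^ 2 ∂μ|
      ≤ ε * ∫ ω, φ ω ^ 2 ∂Q := by
  obtain ⟨e1, hi1⟩ := norm_integral_sq_eq hΦm hΦ hφm hφ
  have hε : 0 ≤ ε := by
    obtain ⟨ω⟩ : Nonempty Ω := nonempty_of_isProbabilityMeasure Q
    exact (abs_nonneg _).trans (happ ω ω)
  have hi3 : ∀ i, Integrable (fun w : Z × (Ω × Ω) =>
      (φ w.2.1 * U i w.1 w.2.1) * (φ w.2.2 * U i w.1 w.2.2)) (μ.prod (Q.prod Q)) := by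
    intro i
    have hgi : Integrable (fun w : Z × (Ω × Ω) => g w.1 ^ 2 * (b * b)) (μ.prod (Q.prod Q)) :=
      hg.integrable_sq.mul_prod (integrable_const (b * b))
    refine hgi.mono' ?_ ?_
    · refine Measurable.aestronglyMeasurable ?_
      have h1 : Measurable fun w : Z × (Ω × Ω) => U i w.1 w.2.1 :=
        (hUm i).comp (measurable_fst.prodMk (measurable_fst.comp measurable_snd))
      have h2 : Measurable fun w : Z × (Ω × Ω) => U i w.1 w.2.2 :=
        (hUm i).comp (measurable_fst.prodMk (measurable_snd.comp measurable_snd))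
      have h3 : Measurable fun w : Z × (Ω × Ω) => φ w.2.1 :=
        hφm.comp (measurable_fst.comp measurable_snd)
      have h4 : Measurable fun w : Z × (Ω × Ω) => φ w.2.2 :=
        hφm.comp (measurable_snd.comp measurable_snd)
      exact (h3.mul h1).mul (h4.mul h2)
    · have h0 : ∀ᵐ p : Ω × Ω ∂(Q.prod Q), |φ p.1| ≤ b ∧ |φ p.2| ≤ b := by
        filter_upwards [Measure.quasiMeasurePreserving_fst.ae hφ,
          Measure.quasiMeasurePreserving_snd.ae hφ] with p h1 h2 using ⟨h1, h2⟩
      filter_upwards [Measure.quasiMeasurePreserving_snd.ae h0] with w h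
      have h5 := hU i w.1 w.2.1
      have h6 := hU i w.1 w.2.2
      have hb : 0 ≤ b := (abs_nonneg _).trans h.1
      have hg0 : 0 ≤ g w.1 := (abs_nonneg _).trans h5
      rw [Real.norm_eq_abs, abs_mul, abs_mul, abs_mul]
      calc _ ≤ (b * g w.1) * (b * g w.1) := by
            gcongr
            exacts [h.1, h.2]
        _ = _ := by ring
  have e2 : ∀ i, ∫ z, (∫ ω, φ ω * U i z ω ∂Q) ^ 2 ∂μ
      = ∫ p, φ p.1 * φ p.2 * ∫ z, U i z p.1 * U i z p.2 ∂μ ∂(Q.prod Q) := by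
    intro i
    have h1 : ∀ z, (∫ ω, φ ω * U i z ω ∂Q) ^ 2
        = ∫ p : Ω × Ω, (φ p.1 * U i z p.1) * (φ p.2 * U i z p.2) ∂(Q.prod Q) := by
      intro z
      rw [sq, ← integral_prod_mul (fun ω => φ ω * U i z ω) fun ω => φ ω * U i z ω]
    simp_rw [h1]
    rw [integral_integral_swap (f := fun z (p : Ω × Ω) =>
      (φ p.1 * U i z p.1) * (φ p.2 * U i z p.2)) (hi3 i)]
    refine integral_congr_ae (Filter.Eventually.of_forall fun p => ?_)
    simp only
    rw [← integral_const_mul]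
    refine integral_congr_ae (Filter.Eventually.of_forall fun z => ?_)
    simp only
    ring
  have hi4 : ∀ i, Integrable (fun p : Ω × Ω => φ p.1 * φ p.2 * ∫ z, U i z p.1 * U i z p.2 ∂μ)
      (Q.prod Q) := by
    intro i
    refine (hi3 i).integral_prod_right.congr (Filter.Eventually.of_forall fun p => ?_)
    simp only
    rw [← integral_const_mul]
    refine integral_congr_ae (Filter.Eventually.of_forall fun z => ?_)
    simp only
    ring
  have hφa : Integrable (fun ω => |φ ω|) Q :=
    Integrable.of_bound (C := b) hφm.abs.aestronglyMeasurable (by simpa using hφ)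
  rw [e1, Finset.sum_congr rfl fun i _ => e2 i, ← integral_finsetSum _ fun i _ => hi4 i,
    ← integral_sub hi1 (integrable_finsetSum _ fun i _ => hi4 i)]
  calc _ ≤ ∫ p : Ω × Ω, ε * (|φ p.1| * |φ p.2|) ∂(Q.prod Q) := by
        rw [← Real.norm_eq_abs]
        refine norm_integral_le_of_norm_le ((hφa.mul_prod hφa).const_mul ε)
          (Filter.Eventually.of_forall fun p => ?_)
        rw [← Finset.mul_sum, ← mul_sub, Real.norm_eq_abs, abs_mul, abs_mul, mul_comm ε]
        gcongr
        exact happ _ _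
    _ = ε * (∫ ω, |φ ω| ∂Q) ^ 2 := by
        rw [integral_const_mul, integral_prod_mul (fun ω => |φ ω|) fun ω => |φ ω|, sq]
    _ ≤ _ := by
        gcongr
        exact sq_integral_abs_le hφm hφ

/-- Replacing the common argument of the summands by independent copies decreases the second moment
by at most the number of summands. -/
theorem integral_sq_sum_le_independent {q : Type*} [Fintype q] {μ : Measure Z}
    [IsProbabilityMeasure μ] {W : q → Z → ℝ} (hWm : ∀ m, Measurable (W m))
    (hW : ∀ m, MemLp (W m) 2 μ) {s : Finset q} {r : ℝ} (hs : ∀ m ∉ s, W m = 0) (hr : 1 ≤ r)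
    (hsr : (s.card : ℝ) ≤ r) :
    ∫ z, (∑ m, W m z) ^ 2 ∂μ ≤ r * ∫ z, (∑ m, W m (z m)) ^ 2 ∂(Measure.pi fun _ : q => μ) := by
  classical
  have hcomp : ∀ m, MemLp (fun z : q → Z => W m (z m)) 2 (Measure.pi fun _ : q => μ) := fun m =>
    (hW m).comp_measurePreserving (measurePreserving_eval (fun _ : q => μ) m)
  have hs1 : MemLp (fun z => ∑ m, W m z) 2 μ := memLp_finsetSum _ fun m _ => hW m
  have hs2 : MemLp (fun z : q → Z => ∑ m, W m (z m)) 2 (Measure.pi fun _ : q => μ) :=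
    memLp_finsetSum _ fun m _ => hcomp m
  -- Both sums have the mean `a`, so only the variances differ. The independent sum has the sum of
  -- the variances; the dependent one has at most `r` times that, by Cauchy-Schwarz over the indices
  -- in `s`.
  set a : ℝ := ∑ m, ∫ z, W m z ∂μ with ha
  have v1 := variance_eq_sub hs1
  have v2 := variance_eq_sub hs2
  have m1 : ∫ z, ∑ m, W m z ∂μ = a :=
    integral_finsetSum _ fun m _ => (hW m).integrable one_le_two
  have m2 : ∫ z, ∑ m, W m (z m) ∂(Measure.pi fun _ : q => μ) = a := by
    rw [integral_finsetSum _ fun m _ => (hcomp m).integrable one_le_two]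
    refine Finset.sum_congr rfl fun m _ => ?_
    exact integral_comp_eval (μ := fun _ : q => μ) (hWm m).aestronglyMeasurable
  have v3 : Var[fun z : q → Z => ∑ m, W m (z m); Measure.pi fun _ : q => μ]
      = ∑ m, Var[W m; μ] := by
    have := variance_sum_pi (μ := fun _ : q => μ) (X := W) hW
    rw [← this]
    congr 1
    ext z
    simp
  have v4 : Var[fun z => ∑ m, W m z; μ] ≤ r * ∑ m, Var[W m; μ] := by
    rw [variance_eq_integral hs1.aemeasurable, m1]
    have hci : ∀ m, Integrable (fun z => (W m z - ∫ z, W m z ∂μ) ^ 2) μ := fun m =>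
      ((hW m).sub (memLp_const _)).integrable_sq
    have e : ∑ m, Var[W m; μ] = ∫ z, ∑ m, (W m z - ∫ z, W m z ∂μ) ^ 2 ∂μ := by
      rw [integral_finsetSum _ fun m _ => hci m]
      exact Finset.sum_congr rfl fun m _ => variance_eq_integral (hW m).aemeasurable
    rw [e, ← integral_const_mul]
    refine integral_mono ((hs1.sub (memLp_const a)).integrable_sq)
      ((integrable_finsetSum _ fun m _ => hci m).const_mul r) fun z => ?_
    simp only
    have e3 : ∀ f : q → ℝ, (∀ m ∉ s, f m = 0) → ∑ m, f m = ∑ m ∈ s, f m := fun f hf =>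
      (Finset.sum_subset (Finset.subset_univ s) fun m _ hm => hf m hm).symm
    have e2 : (∑ m, W m z) - a = ∑ m ∈ s, (W m z - ∫ z, W m z ∂μ) := by
      rw [ha, ← Finset.sum_sub_distrib]
      exact e3 _ fun m hm => by simp [hs m hm]
    rw [e2, e3 _ fun m hm => by simp [hs m hm]]
    refine sq_sum_le_card_mul_sum_sq.trans ?_
    exact mul_le_mul_of_nonneg_right hsr (Finset.sum_nonneg fun m _ => sq_nonneg _)
  rw [m1] at v1
  rw [m2, v3] at v2
  have s1 : (∫ z, ((fun z => ∑ m, W m z) ^ 2) z ∂μ) = ∫ z, (∑ m, W m z) ^ 2 ∂μ := rfl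
  have s2 : (∫ z, ((fun z : q → Z => ∑ m, W m (z m)) ^ 2) z ∂(Measure.pi fun _ : q => μ))
    = ∫ z, (∑ m, W m (z m)) ^ 2 ∂(Measure.pi fun _ : q => μ) := rfl
  rw [s1] at v1
  rw [s2] at v2
  nlinarith [sq_nonneg a]

theorem map_curry_stdNormal (ι κ : Type*) [Fintype ι] [Fintype κ] :
    (stdNormal (ι × κ)).map (MeasurableEquiv.curry ι κ ℝ) = Measure.pi fun _ : ι => stdNormal κ := by
  have h := Measure.infinitePi_map_curry (ι := ι) (κ := κ) (X := ℝ) fun _ _ => gaussianReal 0 1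
  simp only [Measure.infinitePi_eq_pi] at h
  exact h

theorem map_piCurry_stdNormal {ι : Type} [Fintype ι] (κ : ι → Type) [∀ i, Fintype (κ i)] :
    (stdNormal (Σ i, κ i)).map (MeasurableEquiv.piCurry fun (i : ι) (_ : κ i) => ℝ)
      = Measure.pi fun i => stdNormal (κ i) := by
  have h := Measure.infinitePi_map_piCurry (ι := ι) (κ := κ) (X := fun _ _ => ℝ)
    fun _ _ => gaussianReal 0 1
  simp only [Measure.infinitePi_eq_pi] at h
  exact h

end QuadraticForms

/-! ### Random features for products of modes and for tensors. -/

section TensorFeatures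

theorem abs_prod_sub_prod_le {ι : Type*} (s : Finset ι) {x y : ι → ℝ} {L ε : ℝ} (hL : 1 ≤ L)
    (hx : ∀ i ∈ s, |x i| ≤ L) (hy : ∀ i ∈ s, |y i| ≤ L) (h : ∀ i ∈ s, |x i - y i| ≤ ε) :
    |∏ i ∈ s, x i - ∏ i ∈ s, y i| ≤ s.card * L ^ s.card * ε := by
  classical
  induction s using Finset.induction_on with
  | empty => simp
  | insert a s ha ih =>
    have ih' := ih (fun i hi => hx i (Finset.mem_insert_of_mem hi))
      (fun i hi => hy i (Finset.mem_insert_of_mem hi)) fun i hi => h i (Finset.mem_insert_of_mem hi)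
    have hε : 0 ≤ ε := (abs_nonneg _).trans (h a (Finset.mem_insert_self a s))
    have hp : |∏ i ∈ s, y i| ≤ L ^ s.card := by
      rw [Finset.abs_prod]
      refine (Finset.prod_le_prod (fun i _ => abs_nonneg _) fun i hi =>
        hy i (Finset.mem_insert_of_mem hi)).trans_eq ?_
      simp
    rw [Finset.prod_insert ha, Finset.prod_insert ha, Finset.card_insert_of_notMem ha]
    have e : x a * ∏ i ∈ s, x i - y a * ∏ i ∈ s, y i
        = x a * (∏ i ∈ s, x i - ∏ i ∈ s, y i) + (x a - y a) * ∏ i ∈ s, y i := by ring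
    rw [e]
    refine (abs_add_le _ _).trans ?_
    rw [abs_mul, abs_mul]
    have h1 : |x a| * |∏ i ∈ s, x i - ∏ i ∈ s, y i| ≤ L * (s.card * L ^ s.card * ε) :=
      mul_le_mul (hx a (Finset.mem_insert_self a s)) ih' (abs_nonneg _) (by linarith)
    have h2 : |x a - y a| * |∏ i ∈ s, y i| ≤ ε * L ^ s.card :=
      mul_le_mul (h a (Finset.mem_insert_self a s)) hp (abs_nonneg _) hε
    have h3 : ε * L ^ s.card ≤ ε * L ^ (s.card + 1) := by
      gcongr
      exact Nat.le_succ _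
    push_cast
    rw [pow_succ] at h3 ⊢
    linarith

theorem integrable_pow_stdNormal (N : Type*) [Fintype N] (p : ℕ) :
    Integrable (fun ζ : N → ℝ => (1 + ∑ i, ζ i ^ 2) ^ p) (stdNormal N) := by
  have h0 : MemLp (fun x : EuclideanSpace ℝ N => x) ((2 * p : ℕ) : ℝ≥0∞)
      (stdGaussian (EuclideanSpace ℝ N)) :=
    IsGaussian.memLp_id _ _ (ENNReal.natCast_ne_top _)
  have h1 : MemLp (fun x : EuclideanSpace ℝ N => 1 + ‖x‖) ((2 * p : ℕ) : ℝ≥0∞)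
      (stdGaussian (EuclideanSpace ℝ N)) :=
    MemLp.add (memLp_const 1) h0.norm
  have h2 := h1.integrable_norm_pow'
  rw [← map_pi_eq_stdGaussian, integrable_map_measure (by fun_prop) (by fun_prop)] at h2
  refine h2.mono' (Continuous.aestronglyMeasurable (by fun_prop))
    (Filter.Eventually.of_forall fun ζ => ?_)
  have h3 : ∑ i, ζ i ^ 2 = ‖(WithLp.toLp 2 ζ : EuclideanSpace ℝ N)‖ ^ 2 := by
    rw [EuclideanSpace.real_norm_sq_eq]
  simp only [Function.comp_apply]
  rw [h3, Real.norm_of_nonneg (by positivity), Real.norm_of_nonneg (by positivity), pow_mul]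
  gcongr
  nlinarith [norm_nonneg (WithLp.toLp 2 ζ : EuclideanSpace ℝ N)]

theorem integrable_of_abs_le_pow {N : Type*} [Fintype N] {f : (N → ℝ) → ℝ} (hf : Measurable f) {C : ℝ}
    {p : ℕ} (h : ∀ ζ, |f ζ| ≤ C * (1 + ∑ i, ζ i ^ 2) ^ p) : Integrable f (stdNormal N) :=
  ((integrable_pow_stdNormal N p).const_mul C).mono' hf.aestronglyMeasurable
    (Filter.Eventually.of_forall h)

/-- Random features for the product of the mode kernels: bounded by `M` times a polynomial, and
accurate up to `ε` on vectors of squared norm at most `R`. -/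
structure IsProductFeatures {d : ℕ} (κ : Fin d → ModeKernel) (M R ε : ℝ) {β : Type} [Fintype β]
    (u : β → Fin d → ℝ → ℝ) : Prop where
  continuous : ∀ i j, Continuous (u i j)
  sum_sq_le : ∀ z : Fin d → ℝ, ∑ i, (∏ j, u i j (z j)) ^ 2 ≤ M * ∏ j, (1 + z j ^ 2)
  approx : ∀ (I : Fin d → ℕ) (a b : (j : Fin d) → EuclideanSpace ℝ (Fin (I j))),
    (∀ j, ‖a j‖ ^ 2 ≤ R) → (∀ j, ‖b j‖ ^ 2 ≤ R) →
    |∏ j, (κ j).eval (a j) (b j)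
      - ∑ i, ∫ ζ, (∏ j, u i j (∑ l, ζ ⟨j, l⟩ * a j l)) * (∏ j, u i j (∑ l, ζ ⟨j, l⟩ * b j l))
          ∂(stdNormal (Σ j, Fin (I j)))| ≤ ε

/-- A product feature is indexed by one feature per mode. The modes use independent blocks of the
frequency, so expectations and sums of squares factor, and the growth constant `∏ M j` is again
independent of the accuracy. -/
theorem exists_product_features {d : ℕ} (κ : Fin d → ModeKernel) :
    ∃ M : ℝ, 0 ≤ M ∧ ∀ R ε : ℝ, 0 < ε → ∃ (β : Type) (_ : Fintype β) (u : β → Fin d → ℝ → ℝ),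
      IsProductFeatures κ M R ε u := by
  choose M hM0 hM using fun j => (κ j).exists_random_features
  refine ⟨∏ j, M j, Finset.prod_nonneg fun j _ => hM0 j, fun R ε hε => ?_⟩
  -- Kernel values are at most `L - 2`, hence their approximations are at most `L` once `ε' ≤ 1`;
  -- this suffices to compare the products.
  set L : ℝ := 2 + ∑ j, (|(κ j).h 0| + (κ j).lip * (4 * |R|)) with hL
  have hL0 : ∀ j, |(κ j).h 0| + (κ j).lip * (4 * |R|) ≤ L - 2 := by
    intro j
    rw [hL, add_sub_cancel_left]
    exact Finset.single_le_sum (f := fun j => |(κ j).h 0| + (κ j).lip * (4 * |R|))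
      (fun j _ => by positivity) (Finset.mem_univ j)
  have hL2 : 2 ≤ L := by
    rw [hL]
    have : 0 ≤ ∑ j, (|(κ j).h 0| + (κ j).lip * (4 * |R|)) :=
      Finset.sum_nonneg fun j _ => by positivity
    linarith
  set ε' : ℝ := min 1 (ε / ((d + 1) * L ^ d)) with hε'
  have hε'0 : 0 < ε' := by positivity
  choose β hβ u huc hub hu using fun j => hM j R ε' hε'0
  refine ⟨(j : Fin d) → β j, inferInstance, fun i j => u j (i j), fun i j => huc j _, ?_, ?_⟩
  · intro z
    simp_rw [← Finset.prod_pow]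
    rw [← Fintype.piFinset_univ, ← Finset.prod_univ_sum (fun _ => Finset.univ) fun j i => u j i (z j) ^ 2,
      ← Finset.prod_mul_distrib]
    exact Finset.prod_le_prod (fun j _ => Finset.sum_nonneg fun i _ => sq_nonneg _) fun j _ => hub j (z j)
  · intro I a b ha hb
    have e : ∀ i : (j : Fin d) → β j,
        ∫ ζ, (∏ j, u j (i j) (∑ l, ζ ⟨j, l⟩ * a j l)) * (∏ j, u j (i j) (∑ l, ζ ⟨j, l⟩ * b j l))
          ∂(stdNormal (Σ j, Fin (I j)))
        = ∏ j, ∫ ζ, u j (i j) (∑ l, ζ l * a j l) * u j (i j) (∑ l, ζ l * b j l)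
          ∂(stdNormal (Fin (I j))) := by
      intro i
      rw [← integral_fintype_prod_eq_prod, ← map_piCurry_stdNormal fun j : Fin d => Fin (I j),
        integral_map_equiv]
      simp_rw [← Finset.prod_mul_distrib]
      rfl
    simp_rw [e]
    rw [← Fintype.piFinset_univ, ← Finset.prod_univ_sum (fun _ => Finset.univ) fun j i =>
      ∫ ζ, u j i (∑ l, ζ l * a j l) * u j i (∑ l, ζ l * b j l) ∂(stdNormal (Fin (I j)))]
    have h1 : ∀ j, |(κ j).eval (a j) (b j)| ≤ L - 2 := by
      intro j
      refine le_trans ?_ (hL0 j)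
      exact (κ j).abs_eval_le ((ha j).trans (le_abs_self R)) ((hb j).trans (le_abs_self R))
    have h2 := fun j => hu j (I j) (a j) (b j) (ha j) (hb j)
    have h3 := abs_prod_sub_prod_le (L := L) (ε := ε') Finset.univ (by linarith)
      (fun j _ => (h1 j).trans (by linarith))
      (fun j _ => by
        have h4 := abs_sub_abs_le_abs_sub (∑ i, ∫ ζ, u j i (∑ l, ζ l * a j l)
          * u j i (∑ l, ζ l * b j l) ∂(stdNormal (Fin (I j)))) ((κ j).eval (a j) (b j))
        rw [abs_sub_comm] at h4
        have h5 := h2 j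
        have h6 := h1 j
        have h7 : ε' ≤ 1 := min_le_left _ _
        show |∑ i, ∫ ζ, u j i (∑ l, ζ l * a j l)
          * u j i (∑ l, ζ l * b j l) ∂(stdNormal (Fin (I j)))| ≤ L
        linarith) fun j _ => h2 j
    refine h3.trans ?_
    rw [Finset.card_univ, Fintype.card_fin]
    have h8 : ε' ≤ ε / ((d + 1) * L ^ d) := min_le_right _ _
    calc (d : ℝ) * L ^ d * ε' ≤ ((d + 1) * L ^ d) * (ε / ((d + 1) * L ^ d)) := by
          gcongr; linarith
      _ = ε := by field_simp

theorem sq_dot_le {m : ℕ} (ζ : Fin m → ℝ) (a : EuclideanSpace ℝ (Fin m)) :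
    (∑ l, ζ l * a l) ^ 2 ≤ (∑ l, ζ l ^ 2) * ‖a‖ ^ 2 := by
  rw [EuclideanSpace.real_norm_sq_eq]
  exact Finset.sum_mul_sq_le_sq_mul_sq _ _ _

/-- The bound on tensor features that is inherited from the bound on the features of the modes. -/
theorem sum_sq_tensor_features_le {d r : ℕ} {β : Type*} [Fintype β] {u : β → Fin d → ℝ → ℝ} {M : ℝ}
    (hM : 0 ≤ M) (hu : ∀ z : Fin d → ℝ, ∑ i, (∏ j, u i j (z j)) ^ 2 ≤ M * ∏ j, (1 + z j ^ 2))
    {I : Fin d → ℕ} {X : CPTensor r I} {B : ℝ} (hB : 0 ≤ B) (hX : ∀ j k, ‖X j k‖ ^ 2 ≤ B)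
    (K : Finset (Fin r)) (z : Fin r → (Σ j, Fin (I j)) → ℝ) {s : ℝ} (hz : ∀ k, ∑ n, z k n ^ 2 ≤ s) :
    ∑ i, (∑ k ∈ K, ∏ j, u i j (∑ l, z k ⟨j, l⟩ * X j k l)) ^ 2 ≤ r ^ 2 * M * (1 + B * s) ^ d := by
  have hK : (K.card : ℝ) ≤ r := by
    exact_mod_cast (Finset.card_le_univ K).trans_eq (Fintype.card_fin r)
  have hk : ∀ k, ∑ i, (∏ j, u i j (∑ l, z k ⟨j, l⟩ * X j k l)) ^ 2 ≤ M * (1 + B * s) ^ d := by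
    intro k
    refine (hu _).trans ?_
    gcongr
    have h1 : ∀ j, 1 + (∑ l, z k ⟨j, l⟩ * X j k l) ^ 2 ≤ 1 + B * s := by
      intro j
      have h2 := sq_dot_le (fun l => z k ⟨j, l⟩) (X j k)
      have h3 : ∑ l, z k ⟨j, l⟩ ^ 2 ≤ s := by
        refine le_trans ?_ (hz k)
        rw [Fintype.sum_sigma]
        exact Finset.single_le_sum (f := fun j => ∑ l, z k ⟨j, l⟩ ^ 2)
          (fun j _ => Finset.sum_nonneg fun l _ => sq_nonneg _) (Finset.mem_univ j)
      have h4 : 0 ≤ ∑ l, z k ⟨j, l⟩ ^ 2 := Finset.sum_nonneg fun l _ => sq_nonneg _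
      have h5 := mul_le_mul h3 (hX j k) (sq_nonneg _) (h4.trans h3)
      linarith
    calc _ ≤ ∏ _j : Fin d, (1 + B * s) :=
          Finset.prod_le_prod (fun j _ => by positivity) fun j _ => h1 j
      _ = _ := by simp
  have hnn : 0 ≤ M * (1 + B * s) ^ d ∨ K = ∅ := by
    rcases K.eq_empty_or_nonempty with h | ⟨k, _⟩
    · exact Or.inr h
    · exact Or.inl ((Finset.sum_nonneg fun i _ => sq_nonneg _).trans (hk k))
  calc _ ≤ ∑ i, (K.card : ℝ) * ∑ k ∈ K, (∏ j, u i j (∑ l, z k ⟨j, l⟩ * X j k l)) ^ 2 :=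
        Finset.sum_le_sum fun i _ => sq_sum_le_card_mul_sum_sq
    _ = K.card * ∑ k ∈ K, ∑ i, (∏ j, u i j (∑ l, z k ⟨j, l⟩ * X j k l)) ^ 2 := by
        rw [← Finset.mul_sum, Finset.sum_comm]
    _ ≤ K.card * ∑ k ∈ K, M * (1 + B * s) ^ d := by
        gcongr with k _
        exact hk k
    _ ≤ r ^ 2 * M * (1 + B * s) ^ d := by
        rw [Finset.sum_const, nsmul_eq_mul]
        rcases hnn with h | h
        · have h1 : (K.card : ℝ) * K.card ≤ r ^ 2 := by rw [sq]; gcongr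
          nlinarith
        · subst h
          have h2 : 0 ≤ s ∨ r = 0 := by
            rcases Nat.eq_zero_or_pos r with h | h
            · exact Or.inr h
            · exact Or.inl ((Finset.sum_nonneg fun n _ => sq_nonneg _).trans (hz ⟨0, h⟩))
          rcases h2 with h2 | h2
          · simp; positivity
          · simp [h2]

/-- The tensor kernel as a second moment of tensor features. -/
theorem abs_tensorKernel_sub_le {d r : ℕ} {κ : Fin d → ModeKernel} {β : Type} [Fintype β]
    {u : β → Fin d → ℝ → ℝ} {M R ε : ℝ} (hM : 0 ≤ M) (hu : IsProductFeatures κ M R ε u)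
    {I : Fin d → ℕ} {X Y : CPTensor r I} (hR : 0 ≤ R) (hX : ∀ j k, ‖X j k‖ ^ 2 ≤ R)
    (hY : ∀ j k, ‖Y j k‖ ^ 2 ≤ R) :
    |tensorKernel κ X Y - ∑ i, ∫ ζ, (∑ k, ∏ j, u i j (∑ l, ζ ⟨j, l⟩ * X j k l))
        * (∑ k, ∏ j, u i j (∑ l, ζ ⟨j, l⟩ * Y j k l)) ∂(stdNormal (Σ j, Fin (I j)))| ≤ r ^ 2 * ε := by
  have hcont : ∀ (i : β) (Z : CPTensor r I) (k : Fin r),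
      Continuous fun ζ : (Σ j, Fin (I j)) → ℝ => ∏ j, u i j (∑ l, ζ ⟨j, l⟩ * Z j k l) := by
    intro i Z k
    refine continuous_finsetProd _ fun j _ => (hu.continuous i j).comp ?_
    fun_prop
  have hsq : ∀ (i : β) (Z : CPTensor r I) (hZ : ∀ j k, ‖Z j k‖ ^ 2 ≤ R) (k : Fin r)
      (ζ : (Σ j, Fin (I j)) → ℝ), (∏ j, u i j (∑ l, ζ ⟨j, l⟩ * Z j k l)) ^ 2
        ≤ r ^ 2 * M * (1 + R) ^ d * (1 + ∑ n, ζ n ^ 2) ^ d := by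
    intro i Z hZ k ζ
    have h1 := sum_sq_tensor_features_le hM hu.sum_sq_le hR hZ {k} (fun _ => ζ) fun _ => le_rfl
    simp only [Finset.sum_singleton] at h1
    refine (Finset.single_le_sum (f := fun i => (∏ j, u i j (∑ l, ζ ⟨j, l⟩ * Z j k l)) ^ 2)
      (fun i _ => sq_nonneg _) (Finset.mem_univ i)).trans (h1.trans ?_)
    rw [mul_assoc _ ((1 + R) ^ d), ← mul_pow]
    have h2 : 0 ≤ ∑ n, ζ n ^ 2 := Finset.sum_nonneg fun n _ => sq_nonneg _
    gcongr
    nlinarith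
  have hint : ∀ (i : β) (k l : Fin r), Integrable (fun ζ : (Σ j, Fin (I j)) → ℝ =>
      (∏ j, u i j (∑ n, ζ ⟨j, n⟩ * X j k n)) * (∏ j, u i j (∑ n, ζ ⟨j, n⟩ * Y j l n)))
      (stdNormal (Σ j, Fin (I j))) := by
    intro i k l
    refine integrable_of_abs_le_pow ((hcont i X k).mul (hcont i Y l)).measurable
      (C := r ^ 2 * M * (1 + R) ^ d) (p := d) fun ζ => ?_
    have h1 := hsq i X hX k ζ
    have h2 := hsq i Y hY l ζ
    rw [abs_le]
    constructor <;> nlinarith [sq_nonneg ((∏ j, u i j (∑ n, ζ ⟨j, n⟩ * X j k n))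
      + (∏ j, u i j (∑ n, ζ ⟨j, n⟩ * Y j l n))), sq_nonneg ((∏ j, u i j (∑ n, ζ ⟨j, n⟩ * X j k n))
      - (∏ j, u i j (∑ n, ζ ⟨j, n⟩ * Y j l n)))]
  have e : ∑ i, ∫ ζ, (∑ k, ∏ j, u i j (∑ l, ζ ⟨j, l⟩ * X j k l))
        * (∑ k, ∏ j, u i j (∑ l, ζ ⟨j, l⟩ * Y j k l)) ∂(stdNormal (Σ j, Fin (I j)))
      = ∑ k, ∑ l, ∑ i, ∫ ζ, (∏ j, u i j (∑ n, ζ ⟨j, n⟩ * X j k n))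
        * (∏ j, u i j (∑ n, ζ ⟨j, n⟩ * Y j l n)) ∂(stdNormal (Σ j, Fin (I j))) := by
    simp_rw [Finset.sum_mul_sum]
    rw [Finset.sum_congr rfl fun i _ => integral_finsetSum _ fun k _ =>
      integrable_finsetSum _ fun l _ => hint i k l]
    rw [Finset.sum_comm]
    refine Finset.sum_congr rfl fun k _ => ?_
    rw [Finset.sum_congr rfl fun i _ => integral_finsetSum _ fun l _ => hint i k l]
    rw [Finset.sum_comm]
  rw [e, tensorKernel, ← Finset.sum_sub_distrib]
  refine (Finset.abs_sum_le_sum_abs _ _).trans ?_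
  have h1 : ∀ k ∈ Finset.univ, |∑ l, ∏ j, (κ j).eval (X j k) (Y j l)
      - ∑ l, ∑ i, ∫ ζ, (∏ j, u i j (∑ n, ζ ⟨j, n⟩ * X j k n))
        * (∏ j, u i j (∑ n, ζ ⟨j, n⟩ * Y j l n)) ∂(stdNormal (Σ j, Fin (I j)))| ≤ r * ε := by
    intro k _
    rw [← Finset.sum_sub_distrib]
    refine (Finset.abs_sum_le_sum_abs _ _).trans ?_
    refine (Finset.sum_le_sum fun l _ => hu.approx I (fun j => X j k) (fun j => Y j l) (fun j => hX j k)
      fun j => hY j l).trans ?_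
    simp
  refine (Finset.sum_le_sum h1).trans ?_
  simp [sq, mul_assoc]

end TensorFeatures

/-! ### Features integrated against a test function. -/

section FeatureIntegrals

variable {Ω : Type*} [MeasurableSpace Ω] {Q : Measure Ω} [IsProbabilityMeasure Q] {d r : ℕ}
  {κ : Fin d → ModeKernel} {β : Type} {u : β → Fin d → ℝ → ℝ} {M R ε B b : ℝ}
  {I : Fin d → ℕ} {x : Ω → CPTensor r I} {φ : Ω → ℝ}

/-- The tensor feature `∑ₖ ∏_j u_j(⟨zₖ, x_k^(j)⟩)`, over the components in `K`, with a frequency for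
each component. -/
noncomputable def tensorFeature (u : β → Fin d → ℝ → ℝ) (K : Finset (Fin r)) (i : β)
    (z : Fin r → (Σ j, Fin (I j)) → ℝ) (X : CPTensor r I) : ℝ :=
  ∑ k ∈ K, ∏ j, u i j (∑ l, z k ⟨j, l⟩ * X j k l)

theorem measurable_tensorFeature {γ : Type*} [MeasurableSpace γ] (huc : ∀ i j, Continuous (u i j))
    (K : Finset (Fin r)) (i : β) {z : γ → Fin r → (Σ j, Fin (I j)) → ℝ} {y : γ → CPTensor r I}
    (hz : Measurable z) (hy : Measurable y) :
    Measurable fun w => tensorFeature u K i (z w) (y w) := by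
  have hy' : ∀ j k l, Measurable fun w => y w j k l := fun j k l =>
    (EuclideanSpace.proj (𝕜 := ℝ) l).continuous.measurable.comp
      ((measurable_pi_apply k).comp ((measurable_pi_apply j).comp hy))
  have hz' : ∀ k n, Measurable fun w => z w k n := fun k n =>
    (measurable_pi_apply n).comp ((measurable_pi_apply k).comp hz)
  unfold tensorFeature
  refine Finset.measurable_fun_sum _ fun k _ => Finset.measurable_fun_prod _ fun j _ => ?_
  refine (huc i j).measurable.comp (Finset.measurable_fun_sum _ fun l _ => ?_)
  exact (hz' k ⟨j, l⟩).mul (hy' j k l)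

variable [Fintype β]

theorem sq_tensorFeature_le (hM : 0 ≤ M)
    (hu : ∀ z : Fin d → ℝ, ∑ i, (∏ j, u i j (z j)) ^ 2 ≤ M * ∏ j, (1 + z j ^ 2)) {X : CPTensor r I}
    (hB : 0 ≤ B) (hX : ∀ j k, ‖X j k‖ ^ 2 ≤ B) (K : Finset (Fin r)) (i : β)
    (z : Fin r → (Σ j, Fin (I j)) → ℝ) {s : ℝ} (hz : ∀ k, ∑ n, z k n ^ 2 ≤ s) :
    tensorFeature u K i z X ^ 2 ≤ r ^ 2 * M * (1 + B * s) ^ d :=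
  (Finset.single_le_sum (f := fun i => tensorFeature u K i z X ^ 2) (fun i _ => sq_nonneg _)
    (Finset.mem_univ i)).trans (sum_sq_tensor_features_le hM hu hB hX K z hz)

theorem abs_tensorFeature_le (hM : 0 ≤ M)
    (hu : ∀ z : Fin d → ℝ, ∑ i, (∏ j, u i j (z j)) ^ 2 ≤ M * ∏ j, (1 + z j ^ 2)) {X : CPTensor r I}
    (hB : 0 ≤ B) (hX : ∀ j k, ‖X j k‖ ^ 2 ≤ B) (K : Finset (Fin r)) (i : β)
    (z : Fin r → (Σ j, Fin (I j)) → ℝ) {s : ℝ} (hz : ∀ k, ∑ n, z k n ^ 2 ≤ s) :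
    |tensorFeature u K i z X| ≤ 1 + r ^ 2 * M * (1 + B * s) ^ d := by
  have h := sq_tensorFeature_le hM hu hB hX K i z hz
  rw [← sq_abs] at h
  nlinarith [sq_nonneg (|tensorFeature u K i z X| - 1)]

theorem memLp_tensorFeature (hM : 0 ≤ M) (huc : ∀ i j, Continuous (u i j))
    (hu : ∀ z : Fin d → ℝ, ∑ i, (∏ j, u i j (z j)) ^ 2 ≤ M * ∏ j, (1 + z j ^ 2))
    (hB : 0 ≤ B) (hxm : Measurable x) (hx : ∀ ω j k, ‖x ω j k‖ ^ 2 ≤ B) (K : Finset (Fin r)) (i : β)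
    (z : Fin r → (Σ j, Fin (I j)) → ℝ) : MemLp (fun ω => tensorFeature u K i z (x ω)) 2 Q := by
  have hz : ∀ k, ∑ n, z k n ^ 2 ≤ ∑ k, ∑ n, z k n ^ 2 := fun k =>
    Finset.single_le_sum (f := fun k => ∑ n, z k n ^ 2)
      (fun k _ => Finset.sum_nonneg fun n _ => sq_nonneg _) (Finset.mem_univ k)
  refine MemLp.of_bound ?_ _ (Filter.Eventually.of_forall fun ω =>
    abs_tensorFeature_le hM hu hB (hx ω) K i z hz)
  exact (measurable_tensorFeature huc K i measurable_const hxm).aestronglyMeasurable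

theorem memLp_of_ae_abs_le (hφm : Measurable φ) (hφ : ∀ᵐ ω ∂Q, |φ ω| ≤ b) : MemLp φ 2 Q :=
  MemLp.of_bound hφm.aestronglyMeasurable b hφ

/-- Cauchy-Schwarz in `Ω`. The sum over all features is bounded by a polynomial in the frequency
that involves `M` but neither the number of features nor their accuracy; this later controls the
tail of the frequency. -/
theorem sum_sq_integral_tensorFeature_le (hM : 0 ≤ M) (huc : ∀ i j, Continuous (u i j))
    (hu : ∀ z : Fin d → ℝ, ∑ i, (∏ j, u i j (z j)) ^ 2 ≤ M * ∏ j, (1 + z j ^ 2))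
    (hB : 0 ≤ B) (hxm : Measurable x) (hx : ∀ ω j k, ‖x ω j k‖ ^ 2 ≤ B) (hφm : Measurable φ)
    (hφ : ∀ᵐ ω ∂Q, |φ ω| ≤ b) (K : Finset (Fin r)) (z : Fin r → (Σ j, Fin (I j)) → ℝ) {s : ℝ}
    (hz : ∀ k, ∑ n, z k n ^ 2 ≤ s) :
    ∑ i, (∫ ω, φ ω * tensorFeature u K i z (x ω) ∂Q) ^ 2
      ≤ (r ^ 2 * M * (1 + B * s) ^ d) * ∫ ω, φ ω ^ 2 ∂Q := by
  have hL := fun i => memLp_tensorFeature (Q := Q) hM huc hu hB hxm hx K i z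
  have hφ2 := memLp_of_ae_abs_le hφm hφ
  calc _ ≤ ∑ i, (∫ ω, φ ω ^ 2 ∂Q) * ∫ ω, tensorFeature u K i z (x ω) ^ 2 ∂Q :=
        Finset.sum_le_sum fun i _ => sq_integral_mul_le hφ2 (hL i)
    _ = (∫ ω, φ ω ^ 2 ∂Q) * ∫ ω, ∑ i, tensorFeature u K i z (x ω) ^ 2 ∂Q := by
        rw [integral_finsetSum _ fun i _ => (hL i).integrable_sq, Finset.mul_sum]
    _ ≤ (∫ ω, φ ω ^ 2 ∂Q) * ∫ _, r ^ 2 * M * (1 + B * s) ^ d ∂Q := by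
        refine mul_le_mul_of_nonneg_left ?_ (integral_nonneg fun ω => sq_nonneg _)
        exact integral_mono (integrable_finsetSum _ fun i _ => (hL i).integrable_sq)
          (integrable_const _) fun ω => sum_sq_tensor_features_le hM hu hB (hx ω) K z hz
    _ = _ := by simp [mul_comm]

theorem measurable_integral_tensorFeature (huc : ∀ i j, Continuous (u i j)) (hxm : Measurable x)
    (hφm : Measurable φ) (K : Finset (Fin r)) (i : β) :
    Measurable fun z : Fin r → (Σ j, Fin (I j)) → ℝ => ∫ ω, φ ω * tensorFeature u K i z (x ω) ∂Q := by
  refine StronglyMeasurable.measurable ?_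
  refine StronglyMeasurable.integral_prod_right (f := fun (z : Fin r → (Σ j, Fin (I j)) → ℝ) ω =>
    φ ω * tensorFeature u K i z (x ω)) ?_
  have h : Measurable fun w : (Fin r → (Σ j, Fin (I j)) → ℝ) × Ω =>
      tensorFeature u K i w.1 (x w.2) :=
    measurable_tensorFeature huc K i measurable_fst (hxm.comp measurable_snd)
  exact ((hφm.comp measurable_snd).mul h).stronglyMeasurable

theorem one_add_mul_pow_le {B s : ℝ} (hB : 0 ≤ B) (hs : 0 ≤ s) (d : ℕ) :
    (1 + B * s) ^ d ≤ (1 + B) ^ d * (1 + s) ^ d := by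
  rw [← mul_pow]
  gcongr
  nlinarith

/-- The quadratic form of the tensor kernel, up to an error, in terms of tensor features. -/
theorem abs_norm_integral_featureMap_sub_le (hM : 0 ≤ M) (hu : IsProductFeatures κ M R ε u)
    (hR : 0 ≤ R) (hxm : Measurable x) (hx : ∀ ω j k, ‖x ω j k‖ ^ 2 ≤ R) (hφm : Measurable φ)
    (hφ : ∀ᵐ ω ∂Q, |φ ω| ≤ b) :
    |‖∫ ω, φ ω • featureMap κ (x ω) ∂Q‖ ^ 2
      - ∑ i, ∫ ζ, (∫ ω, φ ω * tensorFeature u Finset.univ i (fun _ => ζ) (x ω) ∂Q) ^ 2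
          ∂(stdNormal (Σ j, Fin (I j)))| ≤ r ^ 2 * ε * ∫ ω, φ ω ^ 2 ∂Q := by
  have hdiag : Measurable fun ζ : (Σ j, Fin (I j)) → ℝ => fun _ : Fin r => ζ :=
    measurable_pi_lambda _ fun _ => measurable_id
  refine abs_norm_integral_sq_sub_le (κ := Real.sqrt (kernelBound r κ R))
    (U := fun i ζ ω => tensorFeature u Finset.univ i (fun _ => ζ) (x ω))
    (g := fun ζ => 1 + r ^ 2 * M * ((1 + R) ^ d * (1 + ∑ n, ζ n ^ 2) ^ d))
    ((continuous_featureMap.stronglyMeasurable).comp_measurable hxm)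
    (fun ω => norm_featureMap_le (hx ω)) hφm hφ ?_ ?_ ?_ ?_
  · intro i
    exact measurable_tensorFeature hu.continuous Finset.univ i (hdiag.comp measurable_fst)
      (hxm.comp measurable_snd)
  · refine MemLp.add (memLp_const 1) (MemLp.const_mul (MemLp.const_mul ?_ _) _)
    refine (memLp_two_iff_integrable_sq (Continuous.aestronglyMeasurable (by fun_prop))).mpr ?_
    simp_rw [← pow_mul]
    exact integrable_pow_stdNormal _ _
  · intro i ζ ω
    refine (abs_tensorFeature_le hM hu.sum_sq_le hR (hx ω) Finset.univ i (fun _ => ζ)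
      fun _ => le_rfl).trans ?_
    have := one_add_mul_pow_le hR (Finset.sum_nonneg fun n _ => sq_nonneg (ζ n) :
      0 ≤ ∑ n, ζ n ^ 2) d
    gcongr
  · intro ω ω'
    rw [inner_featureMap_featureMap]
    exact abs_tensorKernel_sub_le hM hu hR (hx ω) (hx ω')

end FeatureIntegrals

/-! ### Random projection as a linear change of frequency. -/

section Projection

variable {d r q P : ℕ} {I : Fin d → ℕ}

/-- The block matrix that acts on the vectors of all modes and all projections at once. -/
noncomputable def projBlock (A : ProjMatrices q P I) :
    Matrix (Σ _ : Fin d, Fin P) (Fin q × Σ j, Fin (I j)) ℝ :=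
  Matrix.of fun a b => if a.1 = b.2.1 then (Real.sqrt P)⁻¹ * A b.2.1 b.1 a.2 b.2.2 else 0

open Matrix in
-- The adjoint identity behind the whole comparison: a frequency acts on the projected factor as the
-- block `σ k` of its image under `(projBlock A)ᵀ` acts on the original factor.
theorem sum_mul_project (A : ProjMatrices q P I) (σ : Fin r → Fin q) (X : CPTensor r I) (j : Fin d)
    (k : Fin r) (ζ : (Σ _ : Fin d, Fin P) → ℝ) :
    ∑ p, ζ ⟨j, p⟩ * project σ A X j k p
      = ∑ l, ((projBlock A)ᵀ *ᵥ ζ) (σ k, ⟨j, l⟩) * X j k l := by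
  have h : ∀ l, ((projBlock A)ᵀ *ᵥ ζ) (σ k, ⟨j, l⟩)
      = ∑ p, (Real.sqrt P)⁻¹ * A j (σ k) p l * ζ ⟨j, p⟩ := by
    intro l
    simp only [mulVec, dotProduct, transpose_apply, projBlock, of_apply]
    rw [Fintype.sum_sigma, Finset.sum_eq_single j]
    · simp
    · intro j' _ hj
      simp [hj]
    · simp
  simp_rw [h, Finset.sum_mul]
  rw [Finset.sum_comm]
  refine Finset.sum_congr rfl fun p _ => ?_
  simp only [project, PiLp.smul_apply, smul_eq_mul, mulVec, dotProduct, of_apply, Finset.mul_sum]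
  exact Finset.sum_congr rfl fun l _ => by ring

open Matrix in
-- The factor is placed in block `(σ k, j)` of a large vector, on which the matrix is nearly an
-- isometry.
theorem norm_project_sq_le {A : ProjMatrices q P I} {τ : ℝ}
    (hA : ∀ a b, |((projBlock A)ᵀ * projBlock A - 1 :
      Matrix (Fin q × Σ j, Fin (I j)) (Fin q × Σ j, Fin (I j)) ℝ) a b| ≤ τ)
    (hτ : τ * Fintype.card (Fin q × Σ j, Fin (I j)) ≤ 1) (σ : Fin r → Fin q) (X : CPTensor r I)
    (j : Fin d) (k : Fin r) : ‖project σ A X j k‖ ^ 2 ≤ 2 * ‖X j k‖ ^ 2 := by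
  classical
  set w : (Fin q × Σ j, Fin (I j)) → ℝ := fun b =>
    if b.1 = σ k then X b.2.1 k b.2.2 * (if b.2.1 = j then 1 else 0) else 0 with hw
  set V := projBlock A with hV
  have hww : ∑ b, w b ^ 2 = ‖X j k‖ ^ 2 := by
    rw [EuclideanSpace.real_norm_sq_eq, Fintype.sum_prod_type, Finset.sum_eq_single (σ k),
      Fintype.sum_sigma, Finset.sum_eq_single j]
    · simp [hw]
    · intro j' _ hj; simp [hw, hj]
    · simp
    · intro m _ hm; simp [hw, hm]
    · simp
  have hVw : ∀ a, (V *ᵥ w) a = if a.1 = j then project σ A X j k a.2 else 0 := by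
    intro a
    simp only [mulVec, dotProduct, hV, projBlock, of_apply]
    rw [Fintype.sum_prod_type, Finset.sum_eq_single (σ k), Fintype.sum_sigma, Finset.sum_eq_single j]
    · by_cases ha : a.1 = j
      · simp only [hw, ha, if_true, mul_one, project, PiLp.smul_apply, smul_eq_mul, mulVec,
          dotProduct, of_apply, Finset.mul_sum]
        exact Finset.sum_congr rfl fun l _ => by ring
      · simp [ha]
    · intro j' _ hj; simp [hw, hj]
    · simp
    · intro m _ hm; simp [hw, hm]
    · simp
  have hVV : (V *ᵥ w) ⬝ᵥ (V *ᵥ w) = ‖project σ A X j k‖ ^ 2 := by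
    rw [EuclideanSpace.real_norm_sq_eq, dotProduct, Fintype.sum_sigma, Finset.sum_eq_single j]
    · exact Finset.sum_congr rfl fun p _ => by rw [hVw]; simp [sq]
    · intro j' _ hj
      exact Finset.sum_eq_zero fun p _ => by rw [hVw]; simp [hj]
    · simp
  have e : (V *ᵥ w) ⬝ᵥ (V *ᵥ w) = w ⬝ᵥ w + w ⬝ᵥ (Vᵀ * V - 1) *ᵥ w := by
    rw [Matrix.sub_mulVec, one_mulVec, dotProduct_sub, ← mulVec_mulVec, dotProduct_mulVec w Vᵀ,
      Matrix.vecMul_transpose]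
    ring
  have h1 := (abs_le.mp (dotProduct_mulVec_abs_le hA w w)).2
  have h2 : w ⬝ᵥ w = ∑ b, w b ^ 2 := by simp [dotProduct, sq]
  rw [Real.mul_self_sqrt (Finset.sum_nonneg fun b _ => sq_nonneg _), hww] at h1
  rw [← hVV, e, h2, hww]
  nlinarith [sq_nonneg ‖X j k‖]

end Projection

/-! ### Domination of the kernel by the projected kernel. -/

section KernelDomination

theorem measurable_project {γ : Type*} [MeasurableSpace γ] {d r q P : ℕ} {I : Fin d → ℕ}
    (σ : Fin r → Fin q) {A : γ → ProjMatrices q P I} {X : γ → CPTensor r I} (hA : Measurable A)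
    (hX : Measurable X) : Measurable fun w => project σ (A w) (X w) := by
  have hX' : ∀ j k l, Measurable fun w => X w j k l := fun j k l =>
    (EuclideanSpace.proj (𝕜 := ℝ) l).continuous.measurable.comp
      ((measurable_pi_apply k).comp ((measurable_pi_apply j).comp hX))
  have hA' : ∀ j m p l, Measurable fun w => A w j m p l := fun j m p l =>
    (measurable_pi_apply l).comp ((measurable_pi_apply p).comp
      ((measurable_pi_apply m).comp ((measurable_pi_apply j).comp hA)))
  refine measurable_pi_lambda _ fun j => measurable_pi_lambda _ fun k => ?_
  have h : Measurable fun w => (WithLp.toLp 2 ((Matrix.of (A w j (σ k))).mulVec (X w j k).ofLp) :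
      EuclideanSpace ℝ (Fin P)) := by
    refine (PiLp.continuous_toLp 2 (fun _ : Fin P => ℝ)).measurable.comp
      (measurable_pi_lambda _ fun p => ?_)
    simp only [Matrix.mulVec, dotProduct, Matrix.of_apply]
    exact Finset.measurable_fun_sum _ fun l _ => (hA' j (σ k) p l).mul (hX' j k l)
  exact (continuous_const_smul ((Real.sqrt P)⁻¹ : ℝ)).measurable.comp h

/-- On the ball the comparison of measures applies. Outside, the factor `((∑ z²) / T) ^ p ≥ 1` is
inserted, as in Markov's inequality for a high moment. -/
theorem integral_le_of_restrict_le {N : Type*} [Fintype N] {γ ν : Measure (N → ℝ)} {f w : (N → ℝ) → ℝ}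
    {T K : ℝ} {p : ℕ} (hT : 0 < T) (hK : 0 ≤ K) (hf0 : ∀ z, 0 ≤ f z) (hw0 : ∀ z, 0 ≤ w z)
    (hfγ : Integrable f γ) (hfν : Integrable f ν)
    (hw : Integrable (fun z => (∑ n, z n ^ 2) ^ p * w z) γ) (hfw : ∀ z, f z ≤ K * w z)
    (h : γ.restrict {z | ∑ n, z n ^ 2 ≤ T} ≤ (2 : ℝ≥0∞) • ν) :
    ∫ z, f z ∂γ ≤ 2 * ∫ z, f z ∂ν + K * (T ^ p)⁻¹ * ∫ z, (∑ n, z n ^ 2) ^ p * w z ∂γ := by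
  have hmeas : MeasurableSet {z : N → ℝ | ∑ n, z n ^ 2 ≤ T} :=
    measurableSet_le (Continuous.measurable (by fun_prop)) measurable_const
  rw [← integral_add_compl hmeas hfγ]
  have h1 : ∫ z in {z | ∑ n, z n ^ 2 ≤ T}, f z ∂γ ≤ 2 * ∫ z, f z ∂ν := by
    have e : 2 * ∫ z, f z ∂ν = ∫ z, f z ∂((2 : ℝ≥0∞) • ν) := by
      rw [integral_smul_measure]; simp
    rw [e]
    exact integral_mono_measure h (Filter.Eventually.of_forall hf0)
      (hfν.smul_measure ENNReal.ofNat_ne_top)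
  have h2 : ∫ z in {z | ∑ n, z n ^ 2 ≤ T}ᶜ, f z ∂γ
      ≤ ∫ z in {z | ∑ n, z n ^ 2 ≤ T}ᶜ, K * (T ^ p)⁻¹ * ((∑ n, z n ^ 2) ^ p * w z) ∂γ := by
    refine setIntegral_mono_on hfγ.integrableOn (hw.const_mul _).integrableOn hmeas.compl
      fun z hz => (hfw z).trans ?_
    have hz' : T ≤ ∑ n, z n ^ 2 := by
      by_contra hc
      exact hz (le_of_lt (not_le.mp hc))
    have h3 : 1 ≤ (T ^ p)⁻¹ * (∑ n, z n ^ 2) ^ p := by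
      rw [← inv_pow, ← mul_pow]
      refine one_le_pow₀ ?_
      rw [inv_mul_eq_div, one_le_div hT]; exact hz'
    have h4 : 0 ≤ K * w z := mul_nonneg hK (hw0 z)
    nlinarith
  have h3 : ∫ z in {z | ∑ n, z n ^ 2 ≤ T}ᶜ, K * (T ^ p)⁻¹ * ((∑ n, z n ^ 2) ^ p * w z) ∂γ
      ≤ ∫ z, K * (T ^ p)⁻¹ * ((∑ n, z n ^ 2) ^ p * w z) ∂γ :=
    setIntegral_le_integral (hw.const_mul _) (Filter.Eventually.of_forall fun z =>
      mul_nonneg (by positivity) (mul_nonneg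
        (pow_nonneg (Finset.sum_nonneg fun n _ => sq_nonneg _) _) (hw0 z)))
  have h4 := h2.trans h3
  rw [integral_const_mul (K * (T ^ p)⁻¹) fun z : N → ℝ => (∑ n, z n ^ 2) ^ p * w z] at h4
  linarith

variable {Ω : Type*} [MeasurableSpace Ω] {Q : Measure Ω} [IsProbabilityMeasure Q] {d r q : ℕ}
  {κ : Fin d → ModeKernel} {β : Type} [Fintype β] {u : β → Fin d → ℝ → ℝ} {M R ε B b : ℝ}
  {I : Fin d → ℕ} {x : Ω → CPTensor r I} {φ : Ω → ℝ}

/-- Sharing the frequencies between the groups of components costs at most a factor `r`. -/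
theorem integral_sq_tensorFeature_le (hr : 0 < r) (hM : 0 ≤ M) (huc : ∀ i j, Continuous (u i j))
    (hu : ∀ z : Fin d → ℝ, ∑ i, (∏ j, u i j (z j)) ^ 2 ≤ M * ∏ j, (1 + z j ^ 2))
    (hB : 0 ≤ B) (hxm : Measurable x) (hx : ∀ ω j k, ‖x ω j k‖ ^ 2 ≤ B) (hφm : Measurable φ)
    (hφ : ∀ᵐ ω ∂Q, |φ ω| ≤ b) (σ : Fin r → Fin q) (i : β) :
    ∫ ζ, (∫ ω, φ ω * tensorFeature u Finset.univ i (fun _ => ζ) (x ω) ∂Q) ^ 2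
        ∂(stdNormal (Σ j, Fin (I j)))
      ≤ r * ∫ ζ, (∫ ω, φ ω * tensorFeature u Finset.univ i (fun k n => ζ (σ k, n)) (x ω) ∂Q) ^ 2
        ∂(stdNormal (Fin q × Σ j, Fin (I j))) := by
  classical
  set S := Σ j, Fin (I j)
  set W : Fin q → (S → ℝ) → ℝ := fun m ζ =>
    ∫ ω, φ ω * tensorFeature u (Finset.univ.filter fun k => σ k = m) i (fun _ => ζ) (x ω) ∂Q with hW
  have hdiag : Measurable fun ζ : S → ℝ => fun _ : Fin r => ζ :=
    measurable_pi_lambda _ fun _ => measurable_id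
  have hWm : ∀ m, Measurable (W m) := fun m =>
    (measurable_integral_tensorFeature huc hxm hφm _ i).comp hdiag
  have hW2 : ∀ m, MemLp (W m) 2 (stdNormal S) := by
    intro m
    refine (memLp_two_iff_integrable_sq (hWm m).aestronglyMeasurable).mpr ?_
    refine integrable_of_abs_le_pow ((hWm m).pow_const 2) (p := d)
      (C := (r ^ 2 * M * (1 + B) ^ d) * ∫ ω, φ ω ^ 2 ∂Q) fun ζ => ?_
    rw [abs_of_nonneg (sq_nonneg _)]
    have h1 := sum_sq_integral_tensorFeature_le hM huc hu hB hxm hx hφm hφ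
      (Finset.univ.filter fun k => σ k = m) (fun _ => ζ) fun _ => le_rfl
    have h2 := Finset.single_le_sum (f := fun i => (∫ ω, φ ω * tensorFeature u
      (Finset.univ.filter fun k => σ k = m) i (fun _ => ζ) (x ω) ∂Q) ^ 2)
      (fun i _ => sq_nonneg _) (Finset.mem_univ i)
    refine (h2.trans h1).trans ?_
    have h3 := one_add_mul_pow_le hB (Finset.sum_nonneg fun n _ => sq_nonneg (ζ n) :
      0 ≤ ∑ n, ζ n ^ 2) d
    have h4 : 0 ≤ ∫ ω, φ ω ^ 2 ∂Q := integral_nonneg fun ω => sq_nonneg _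
    calc _ ≤ r ^ 2 * M * ((1 + B) ^ d * (1 + ∑ n, ζ n ^ 2) ^ d) * ∫ ω, φ ω ^ 2 ∂Q := by gcongr
      _ = _ := by ring
  have hsum : ∀ z : Fin q → S → ℝ, ∑ m, W m (z m)
      = ∫ ω, φ ω * tensorFeature u Finset.univ i (fun k => z (σ k)) (x ω) ∂Q := by
    intro z
    have hint : ∀ m, Integrable (fun ω => φ ω * tensorFeature u
        (Finset.univ.filter fun k => σ k = m) i (fun _ => z m) (x ω)) Q := fun m =>
      (memLp_of_ae_abs_le hφm hφ).integrable_mul (memLp_tensorFeature hM huc hu hB hxm hx _ i _)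
    simp only [hW]
    rw [← integral_finsetSum _ fun m _ => hint m]
    refine integral_congr_ae (Filter.Eventually.of_forall fun ω => ?_)
    simp only [← Finset.mul_sum, tensorFeature]
    congr 1
    rw [← Finset.sum_fiberwise Finset.univ σ]
    refine Finset.sum_congr rfl fun m _ => Finset.sum_congr rfl fun k hk => ?_
    rw [(Finset.mem_filter.mp hk).2]
  -- Only matrices in the image of `σ` occur, so the loss is the number `r` of components and not
  -- the number `q` of matrices.
  have h := integral_sq_sum_le_independent hWm hW2 (s := Finset.univ.image σ) (r := r)
    (fun m hm => by
      have : (Finset.univ.filter fun k => σ k = m) = ∅ := by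
        ext k
        simp only [Finset.mem_filter, Finset.mem_univ, true_and, Finset.notMem_empty, iff_false]
        rintro rfl
        exact hm (Finset.mem_image_of_mem _ (Finset.mem_univ k))
      ext ζ
      simp [hW, this, tensorFeature])
    (by exact_mod_cast hr)
    (by exact_mod_cast Finset.card_image_le.trans_eq (Fintype.card_fin r))
  have e1 : ∀ ζ : S → ℝ, ∑ m, W m ζ = _ := fun ζ => hsum fun _ => ζ
  simp_rw [e1, hsum] at h
  refine h.trans_eq ?_
  rw [← map_curry_stdNormal (Fin q) S, integral_map_equiv]
  rfl

open Matrix in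
/-- On the space of square integrable functions, the kernel is dominated by a multiple of the
kernel after projection and a small multiple of the identity, as soon as the projections are near
isometries. -/
theorem exists_kernel_domination {d r : ℕ} (hr : 0 < r) (κ : Fin d → ModeKernel) (I : Fin d → ℕ)
    (q : ℕ) {B : ℝ} (hB : 0 ≤ B) (p : ℕ) :
    ∃ τ₀ : ℝ, 0 < τ₀ ∧ ∃ C : ℝ, 0 ≤ C ∧ ∀ T : ℝ, 1 ≤ T → ∀ (P : ℕ) (A : ProjMatrices q P I),
      (∀ a b, |((projBlock A)ᵀ * projBlock A - 1 :
        Matrix (Fin q × Σ j, Fin (I j)) (Fin q × Σ j, Fin (I j)) ℝ) a b| ≤ τ₀ / T) →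
      (∀ (σ : Fin r → Fin q) (X : CPTensor r I) j k,
        ‖project σ A X j k‖ ^ 2 ≤ 2 * ‖X j k‖ ^ 2) ∧
      ∀ (σ : Fin r → Fin q) (Ω : Type) [MeasurableSpace Ω] (Q : Measure Ω) [IsProbabilityMeasure Q]
        (x : Ω → CPTensor r I), Measurable x → (∀ ω j k, ‖x ω j k‖ ^ 2 ≤ B) →
        ∀ (φ : Ω → ℝ) (b : ℝ), Measurable φ → (∀ᵐ ω ∂Q, |φ ω| ≤ b) →
        ‖∫ ω, φ ω • featureMap κ (x ω) ∂Q‖ ^ 2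
          ≤ 2 * r * ‖∫ ω, φ ω • featureMap κ (project σ A (x ω)) ∂Q‖ ^ 2
            + C * (T ^ p)⁻¹ * ∫ ω, φ ω ^ 2 ∂Q := by
  classical
  set S := Σ j, Fin (I j) with hS
  set N := Fin q × S with hN
  obtain ⟨τ₁, hτ₁, hcomp⟩ := exists_stdNormal_restrict_le N
  obtain ⟨M, hM, hfeat⟩ := exists_product_features κ
  set w : (N → ℝ) → ℝ := fun z => (1 + B * ∑ n, z n ^ 2) ^ d with hw
  set C₁ : ℝ := ∫ z, (∑ n, z n ^ 2) ^ p * w z ∂(stdNormal N) with hC₁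
  have hsq0 : ∀ z : N → ℝ, 0 ≤ ∑ n, z n ^ 2 := fun z => Finset.sum_nonneg fun n _ => sq_nonneg _
  have hw0 : ∀ z, 0 ≤ w z := fun z => by have := hsq0 z; positivity
  have hC₁0 : 0 ≤ C₁ := integral_nonneg fun z => mul_nonneg (pow_nonneg (hsq0 z) _) (hw0 z)
  have hwint : Integrable (fun z => (∑ n, z n ^ 2) ^ p * w z) (stdNormal N) := by
    refine integrable_of_abs_le_pow (C := (1 + B) ^ d) (p := p + d)
      (Continuous.measurable (by fun_prop)) fun z => ?_
    have h0 := hsq0 z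
    rw [abs_of_nonneg (mul_nonneg (pow_nonneg h0 _) (hw0 z)), pow_add]
    have h1 := one_add_mul_pow_le hB h0 d
    calc _ ≤ (1 + ∑ n, z n ^ 2) ^ p * ((1 + B) ^ d * (1 + ∑ n, z n ^ 2) ^ d) := by
          gcongr
          linarith
      _ = _ := by ring
  have hN1 : (0 : ℝ) < 1 / (Fintype.card N + 1) := by positivity
  -- In the constant, the first term is the Gaussian tail; `1` and `2 * r` come from replacing the
  -- kernel by features before and after projection. The second bound on the tolerance guarantees
  -- that projected factors at most double their squared norm.
  refine ⟨min τ₁ (1 / (Fintype.card N + 1)), lt_min hτ₁ hN1, r * (r ^ 2 * M * C₁) + 1 + 2 * r,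
    by positivity, fun T hT P A hA => ?_⟩
  have hT0 : 0 < T := by linarith
  have hproj : ∀ (σ : Fin r → Fin q) (X : CPTensor r I) j k,
      ‖project σ A X j k‖ ^ 2 ≤ 2 * ‖X j k‖ ^ 2 := by
    intro σ X j k
    refine norm_project_sq_le hA ?_ σ X j k
    have h1 : min τ₁ (1 / ((Fintype.card N : ℝ) + 1)) / T ≤ 1 / (Fintype.card N + 1) :=
      (div_le_self (by positivity) hT).trans (min_le_right _ _)
    refine (mul_le_mul_of_nonneg_right h1 (Nat.cast_nonneg _)).trans ?_
    rw [one_div, inv_mul_le_iff₀ (by positivity)]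
    linarith
  refine ⟨hproj, fun σ Ω _ Q _ x hxm hx φ b hφm hφ => ?_⟩
  have hr0 : (0 : ℝ) < r := by exact_mod_cast hr
  -- The features may depend on `T`, because `M` was fixed before the accuracy. Their error is
  -- matched to the tail; the radius `2 * B` covers the projected factors.
  set ε : ℝ := (T ^ p)⁻¹ / r ^ 2 with hε
  obtain ⟨β, _, u, hu⟩ := hfeat (2 * B) ε (by positivity)
  have hxm' : Measurable fun ω => project σ A (x ω) :=
    measurable_project σ measurable_const hxm
  have hx' : ∀ ω j k, ‖project σ A (x ω) j k‖ ^ 2 ≤ 2 * B := fun ω j k =>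
    (hproj σ (x ω) j k).trans (by linarith [hx ω j k])
  have q1 := abs_norm_integral_featureMap_sub_le hM hu (by positivity) hxm
    (fun ω j k => (hx ω j k).trans (by linarith)) hφm hφ
  have q2 := abs_norm_integral_featureMap_sub_le hM hu (by positivity) hxm' hx' hφm hφ
  set φ2 := ∫ ω, φ ω ^ 2 ∂Q with hφ2
  have hφ20 : 0 ≤ φ2 := integral_nonneg fun ω => sq_nonneg _
  have hrε : r ^ 2 * ε = (T ^ p)⁻¹ := by rw [hε]; field_simp
  rw [hrε] at q1 q2
  set f : (N → ℝ) → ℝ := fun z =>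
    ∑ i, (∫ ω, φ ω * tensorFeature u Finset.univ i (fun k n => z (σ k, n)) (x ω) ∂Q) ^ 2 with hf
  have hreg : Measurable fun z : N → ℝ => fun (k : Fin r) (n : S) => z (σ k, n) :=
    measurable_pi_lambda _ fun k => measurable_pi_lambda _ fun n => measurable_pi_apply _
  have hfim : ∀ i, Measurable fun z : N → ℝ =>
      (∫ ω, φ ω * tensorFeature u Finset.univ i (fun k n => z (σ k, n)) (x ω) ∂Q) ^ 2 := fun i =>
    ((measurable_integral_tensorFeature hu.continuous hxm hφm _ i).comp hreg).pow_const 2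
  have hfm : Measurable f := Finset.measurable_fun_sum _ fun i _ => hfim i
  have hf0 : ∀ z, 0 ≤ f z := fun z => Finset.sum_nonneg fun i _ => sq_nonneg _
  have hfw : ∀ z, f z ≤ (r ^ 2 * M * φ2) * w z := by
    intro z
    refine (sum_sq_integral_tensorFeature_le hM hu.continuous hu.sum_sq_le hB hxm hx hφm hφ
      Finset.univ (fun k n => z (σ k, n)) (s := ∑ n, z n ^ 2) fun k => ?_).trans_eq ?_
    · rw [Fintype.sum_prod_type]
      exact Finset.single_le_sum (f := fun m => ∑ n, z (m, n) ^ 2)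
        (fun m _ => Finset.sum_nonneg fun n _ => sq_nonneg _) (Finset.mem_univ (σ k))
    · simp only [hw]; ring
  have hwpow : ∀ z : N → ℝ, w z ≤ (1 + B) ^ d * (1 + ∑ n, z n ^ 2) ^ d := fun z =>
    one_add_mul_pow_le hB (hsq0 z) d
  have hfint : Integrable f (stdNormal N) := by
    refine integrable_of_abs_le_pow hfm (C := r ^ 2 * M * φ2 * (1 + B) ^ d) (p := d) fun z => ?_
    rw [abs_of_nonneg (hf0 z), mul_assoc _ ((1 + B) ^ d)]
    exact (hfw z).trans (mul_le_mul_of_nonneg_left (hwpow z) (by positivity))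
  have hfiint : ∀ i, Integrable (fun z : N → ℝ =>
      (∫ ω, φ ω * tensorFeature u Finset.univ i (fun k n => z (σ k, n)) (x ω) ∂Q) ^ 2)
      (stdNormal N) := by
    intro i
    refine hfint.mono' (hfim i).aestronglyMeasurable (Filter.Eventually.of_forall fun z => ?_)
    rw [Real.norm_of_nonneg (sq_nonneg _)]
    exact Finset.single_le_sum (f := fun i =>
      (∫ ω, φ ω * tensorFeature u Finset.univ i (fun k n => z (σ k, n)) (x ω) ∂Q) ^ 2)
      (fun i _ => sq_nonneg _) (Finset.mem_univ i)
  set Θ := Σ _ : Fin d, Fin P with hΘ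
  have hVm : Measurable fun ζ : Θ → ℝ => (projBlock A)ᵀ *ᵥ ζ :=
    (continuous_const.matrix_mulVec continuous_id).measurable
  have hfeatV : ∀ (i : β) (ζ : Θ → ℝ) (X : CPTensor r I),
      tensorFeature u Finset.univ i (fun k n => ((projBlock A)ᵀ *ᵥ ζ) (σ k, n)) X
        = tensorFeature u Finset.univ i (fun _ => ζ) (project σ A X) := by
    intro i ζ X
    unfold tensorFeature
    refine Finset.sum_congr rfl fun k _ => Finset.prod_congr rfl fun j _ => ?_
    congr 1
    exact (sum_mul_project A σ X j k ζ).symm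
  set F' : β → (Θ → ℝ) → ℝ := fun i ζ =>
    (∫ ω, φ ω * tensorFeature u Finset.univ i (fun _ => ζ) (project σ A (x ω)) ∂Q) ^ 2 with hF'
  -- The form after projection integrates the same function `f`, now under the law of `(projBlock
  -- A)ᵀ ζ`.
  have hfV : ∀ ζ : Θ → ℝ, f ((projBlock A)ᵀ *ᵥ ζ) = ∑ i, F' i ζ := by
    intro ζ
    simp only [hf, hF', hfeatV]
  have hdiag : Measurable fun ζ : Θ → ℝ => fun _ : Fin r => ζ :=
    measurable_pi_lambda _ fun _ => measurable_id
  have hF'm : ∀ i, Measurable (F' i) := fun i =>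
    ((measurable_integral_tensorFeature hu.continuous hxm' hφm _ i).comp hdiag).pow_const 2
  have hF'int : ∀ i, Integrable (F' i) (stdNormal Θ) := by
    intro i
    refine integrable_of_abs_le_pow (hF'm i) (C := r ^ 2 * M * (1 + 2 * B) ^ d * φ2) (p := d)
      fun ζ => ?_
    rw [abs_of_nonneg (sq_nonneg _)]
    refine (Finset.single_le_sum (f := fun i => F' i ζ)
      (fun i _ => sq_nonneg _) (Finset.mem_univ i)).trans ?_
    refine (sum_sq_integral_tensorFeature_le hM hu.continuous hu.sum_sq_le (by positivity) hxm' hx'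
      hφm hφ Finset.univ (fun _ => ζ) (fun _ => le_rfl)).trans ?_
    have h3 := one_add_mul_pow_le (by positivity : 0 ≤ 2 * B)
      (Finset.sum_nonneg fun n _ => sq_nonneg (ζ n) : 0 ≤ ∑ n, ζ n ^ 2) d
    calc _ ≤ r ^ 2 * M * ((1 + 2 * B) ^ d * (1 + ∑ n, ζ n ^ 2) ^ d) * φ2 := by gcongr
      _ = _ := by ring
  have hfν : Integrable f ((stdNormal Θ).map (projBlock A)ᵀ.mulVec) := by
    rw [integrable_map_measure hfm.aestronglyMeasurable hVm.aemeasurable]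
    exact (integrable_finsetSum _ fun i _ => hF'int i).congr
      (Filter.Eventually.of_forall fun ζ => (hfV ζ).symm)
  have hfν' : ∫ z, f z ∂((stdNormal Θ).map (projBlock A)ᵀ.mulVec)
      = ∑ i, ∫ ζ, F' i ζ ∂(stdNormal Θ) := by
    rw [integral_map hVm.aemeasurable hfm.aestronglyMeasurable, ← integral_finsetSum _ fun i _ => hF'int i]
    exact integral_congr_ae (Filter.Eventually.of_forall hfV)
  have hres := hcomp T hT Θ (projBlock A) fun a b => (hA a b).trans
    (div_le_div_of_nonneg_right (min_le_left _ _) hT0.le)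
  have main := integral_le_of_restrict_le hT0 (by positivity) hf0 hw0 hfint hfν hwint hfw hres
  rw [hfν'] at main
  -- Before projection all components share one frequency, whereas `N` carries an independent one
  -- for each matrix; decoupling costs the factor `r`.
  have hdec : ∑ i, ∫ ζ, (∫ ω, φ ω * tensorFeature u Finset.univ i (fun _ => ζ) (x ω) ∂Q) ^ 2
      ∂(stdNormal S) ≤ r * ∫ z, f z ∂(stdNormal N) := by
    rw [integral_finsetSum _ fun i _ => hfiint i, Finset.mul_sum]
    exact Finset.sum_le_sum fun i _ => integral_sq_tensorFeature_le hr hM hu.continuous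
      hu.sum_sq_le hB hxm hx hφm hφ σ i
  have g1 := (abs_le.mp q1).2
  have g2 := (abs_le.mp q2).1
  have g3 := mul_le_mul_of_nonneg_left main hr0.le
  have g4 : 2 * r * ∑ i, ∫ ζ, F' i ζ ∂(stdNormal Θ)
      ≤ 2 * r * (‖∫ ω, φ ω • featureMap κ (project σ A (x ω)) ∂Q‖ ^ 2 + (T ^ p)⁻¹ * φ2) := by
    refine mul_le_mul_of_nonneg_left ?_ (by positivity)
    linarith
  calc _ ≤ r * (2 * ∑ i, ∫ ζ, F' i ζ ∂(stdNormal Θ) + r ^ 2 * M * φ2 * (T ^ p)⁻¹ * C₁)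
        + (T ^ p)⁻¹ * φ2 := by linarith
    _ = 2 * r * ∑ i, ∫ ζ, F' i ζ ∂(stdNormal Θ)
        + (r * (r ^ 2 * M * C₁) + 1) * (T ^ p)⁻¹ * φ2 := by ring
    _ ≤ _ := by linarith

end KernelDomination

/-! ### The projection is nearly an isometry with high probability. -/

section NearIsometry

/-- The fourth moment of the standard normal law. -/
noncomputable def normalFourthMoment : ℝ := ∫ x, x ^ 4 ∂(gaussianReal 0 1)

theorem normalFourthMoment_nonneg : 0 ≤ normalFourthMoment :=
  integral_nonneg fun x => by positivity

theorem integrable_pow_four_gaussianReal : Integrable (fun x : ℝ => x ^ 4) (gaussianReal 0 1) := by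
  have h : MemLp (fun x : ℝ => x) ((4 : ℕ) : ℝ≥0∞) (gaussianReal 0 1) :=
    IsGaussian.memLp_id _ _ (ENNReal.natCast_ne_top _)
  refine h.integrable_norm_pow'.congr (Filter.Eventually.of_forall fun x => ?_)
  simp only [Real.norm_eq_abs]
  exact (by norm_num : Even 4).pow_abs x

/-- Chebyshev's inequality for an empirical second moment of independent standard normal
variables. -/
theorem measure_empirical_covariance_le {Ω ι : Type*} [MeasurableSpace Ω] {μ : Measure Ω}
    [IsProbabilityMeasure μ] {ξ : ι → Ω → ℝ} (hξ : iIndepFun ξ μ)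
    (hlaw : ∀ i, MeasurePreserving (ξ i) μ (gaussianReal 0 1)) {P : ℕ} (hP : 0 < P)
    {a b : Fin P → ι} (haa : ∀ p p', p ≠ p' → a p ≠ a p') (hab : ∀ p p', p ≠ p' → a p ≠ b p')
    (hbb : ∀ p p', p ≠ p' → b p ≠ b p') {δ : ℝ}
    (hδ : (∀ p, a p = b p) ∧ δ = 1 ∨ (∀ p, a p ≠ b p) ∧ δ = 0) {τ : ℝ} (hτ : 0 < τ) :
    μ {ω | τ ≤ |(P : ℝ)⁻¹ * ∑ p, ξ (a p) ω * ξ (b p) ω - δ|}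
      ≤ ENNReal.ofReal (normalFourthMoment / (P * τ ^ 2)) := by
  have hξm : ∀ i, Measurable (ξ i) := fun i => (hlaw i).measurable
  have h4 : ∀ i, Integrable (fun ω => ξ i ω ^ 4) μ := fun i =>
    (hlaw i).integrable_comp_of_integrable integrable_pow_four_gaussianReal
  have e4 : ∀ i, ∫ ω, ξ i ω ^ 4 ∂μ = normalFourthMoment := fun i => by
    rw [normalFourthMoment, ← (hlaw i).map_eq, integral_map (hξm i).aemeasurable (by fun_prop)]
  have h2 : ∀ i, MemLp (ξ i) 2 μ := fun i =>
    IsGaussian.memLp_two_id.comp_measurePreserving (hlaw i)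
  have m1 : ∀ i, ∫ ω, ξ i ω ∂μ = 0 := fun i => by
    have h := integral_id_gaussianReal (μ := 0) (v := 1)
    rw [← (hlaw i).map_eq, integral_map (hξm i).aemeasurable (by fun_prop)] at h
    exact h
  have m2 : ∀ i, ∫ ω, ξ i ω * ξ i ω ∂μ = 1 := fun i => by
    have h : Var[ξ i; μ] = 1 := by
      have h0 := variance_id_gaussianReal (μ := 0) (v := 1)
      rw [← (hlaw i).map_eq, variance_map (by fun_prop) (hξm i).aemeasurable] at h0
      simpa using h0
    rw [variance_eq_sub (h2 i), m1] at h
    simpa [sq] using h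
  set Y : Fin P → Ω → ℝ := fun p => ξ (a p) * ξ (b p) with hY
  have hYm : ∀ p, Measurable (Y p) := fun p => (hξm _).mul (hξm _)
  have hYle : ∀ p ω, Y p ω ^ 2 ≤ (ξ (a p) ω ^ 4 + ξ (b p) ω ^ 4) / 2 := fun p ω => by
    simp only [hY, Pi.mul_apply]
    nlinarith [sq_nonneg (ξ (a p) ω ^ 2 - ξ (b p) ω ^ 2)]
  have hdom : ∀ p, Integrable (fun ω => (ξ (a p) ω ^ 4 + ξ (b p) ω ^ 4) / 2) μ := fun p =>
    ((h4 _).add (h4 _)).div_const 2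
  have hYint : ∀ p, Integrable (fun ω => Y p ω ^ 2) μ := fun p =>
    (hdom p).mono' ((hYm p).pow_const 2).aestronglyMeasurable (Filter.Eventually.of_forall fun ω => by
      rw [Real.norm_of_nonneg (sq_nonneg _)]; exact hYle p ω)
  have hY2 : ∀ p, MemLp (Y p) 2 μ := fun p =>
    (memLp_two_iff_integrable_sq (hYm p).aestronglyMeasurable).mpr (hYint p)
  have hYvar : ∀ p, Var[Y p; μ] ≤ normalFourthMoment := by
    intro p
    refine (variance_le_expectation_sq (hYm p).aestronglyMeasurable).trans ?_
    refine (integral_mono (hYint p) (hdom p) fun ω => hYle p ω).trans_eq ?_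
    rw [integral_div, integral_add (h4 _) (h4 _), e4, e4]
    ring
  have hYmean : ∀ p, ∫ ω, Y p ω ∂μ = δ := by
    intro p
    simp only [hY, Pi.mul_apply]
    rcases hδ with ⟨h, rfl⟩ | ⟨h, rfl⟩
    · rw [← h p]; exact m2 _
    · rw [(hξ.indepFun (h p)).integral_fun_mul_eq_mul_integral (hξm _).aestronglyMeasurable
        (hξm _).aestronglyMeasurable, m1, zero_mul]
  -- Products from different rows involve disjoint sets of entries, so they are pairwise independent
  -- even when `a p = b p`.
  have hpair : Set.Pairwise (↑(Finset.univ : Finset (Fin P)) : Set (Fin P))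
      fun p p' => IndepFun (Y p) (Y p') μ := fun p _ p' _ hp =>
    hξ.indepFun_mul_mul hξm _ _ _ _ (haa p p' hp) (hab p p' hp)
      (fun h => hab p' p (Ne.symm hp) h.symm) (hbb p p' hp)
  have hvar : Var[∑ p, Y p; μ] ≤ P * normalFourthMoment := by
    rw [IndepFun.variance_sum (fun p _ => hY2 p) hpair]
    refine (Finset.sum_le_sum fun p _ => hYvar p).trans_eq ?_
    simp
  have hsum : MemLp (∑ p, Y p) 2 μ := memLp_finsetSum' _ fun p _ => hY2 p
  have hmean : ∫ ω, (∑ p, Y p) ω ∂μ = P * δ := by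
    simp only [Finset.sum_apply]
    rw [integral_finsetSum _ fun p _ => (hY2 p).integrable one_le_two]
    simp [hYmean]
  have hP0 : (0 : ℝ) < P := by exact_mod_cast hP
  have hch := meas_ge_le_variance_div_sq hsum (c := P * τ) (by positivity)
  rw [hmean] at hch
  refine (measure_mono fun ω hω => ?_).trans (hch.trans (ENNReal.ofReal_le_ofReal ?_))
  · simp only [Set.mem_ofPred_eq] at hω ⊢
    have e : (∑ p, Y p) ω - P * δ = P * ((P : ℝ)⁻¹ * ∑ p, ξ (a p) ω * ξ (b p) ω - δ) := by
      simp only [hY, Finset.sum_apply, Pi.mul_apply]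
      field_simp
    rw [e, abs_mul, abs_of_pos hP0]
    gcongr
  · rw [div_le_div_iff₀ (by positivity) (by positivity)]
    nlinarith [mul_le_mul_of_nonneg_right hvar (by positivity : 0 ≤ (P : ℝ) * τ ^ 2)]

theorem iIndepFun_comp_measurePreserving {Ω Ω' ι : Type*} [MeasurableSpace Ω] [MeasurableSpace Ω']
    {μ : Measure Ω} {μ' : Measure Ω'} {ξ : ι → Ω → ℝ} (hξ : iIndepFun ξ μ)
    (hξm : ∀ i, Measurable (ξ i)) {f : Ω' → Ω} (hf : MeasurePreserving f μ' μ) :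
    iIndepFun (fun i ω => ξ i (f ω)) μ' := by
  rw [iIndepFun_iff_measure_inter_preimage_eq_mul] at hξ ⊢
  intro S s hs
  have h := hξ S hs
  rw [← hf.measure_preimage (Finset.measurableSet_biInter S fun i hi =>
    hξm i (hs i hi)).nullMeasurableSet] at h
  rw [Set.preimage_iInter₂] at h
  refine h.trans (Finset.prod_congr rfl fun i hi => ?_)
  rw [← hf.measure_preimage (hξm i (hs i hi)).nullMeasurableSet]
  rfl

variable {d q P : ℕ} {I : Fin d → ℕ}

theorem iIndepFun_nested_normal (q P n : ℕ) :
    iIndepFun (fun (s : (Fin q × Fin P) × Fin n) (ω : Fin q → Fin P → Fin n → ℝ) => ω s.1.1 s.1.2 s.2)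
      (Measure.pi fun _ => Measure.pi fun _ => Measure.pi fun _ => gaussianReal 0 1) := by
  have h1 := iIndepFun_uncurry_infinitePi' (ι := Fin q) (κ := Fin P)
    (X := fun _ _ => (id : (Fin n → ℝ) → Fin n → ℝ))
    (fun _ _ => Measure.pi fun _ : Fin n => gaussianReal 0 1) fun _ _ => measurable_id
  simp only [Measure.infinitePi_eq_pi, id] at h1
  refine iIndepFun_uncurry' (ι := Fin q × Fin P) (κ := Fin n)
    (X := fun s l (ω : Fin q → Fin P → Fin n → ℝ) => ω s.1 s.2 l) (fun s l => by fun_prop) h1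
    fun s => ?_
  have hp : MeasurePreserving (fun ω : Fin q → Fin P → Fin n → ℝ => ω s.1 s.2)
      (Measure.pi fun _ => Measure.pi fun _ => Measure.pi fun _ => gaussianReal 0 1)
      (Measure.pi fun _ => gaussianReal 0 1) :=
    (measurePreserving_eval (fun _ : Fin P => Measure.pi fun _ : Fin n => gaussianReal 0 1) s.2).comp
      (measurePreserving_eval (fun _ : Fin q => Measure.pi fun _ : Fin P =>
        Measure.pi fun _ : Fin n => gaussianReal 0 1) s.1)
  have h2 := iIndepFun_infinitePi (P := fun _ : Fin n => gaussianReal 0 1) (X := fun _ => id)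
    fun _ => measurable_id
  simp only [Measure.infinitePi_eq_pi] at h2
  exact iIndepFun_comp_measurePreserving h2 measurable_pi_apply hp

/-- The projection matrices for which the blocks are within `τ` of an isometry. -/
def nearIsometries (q P : ℕ) (I : Fin d → ℕ) (τ : ℝ) : Set (ProjMatrices q P I) :=
  {A | ∀ a b, |((projBlock A).transpose * projBlock A - 1 :
    Matrix (Fin q × Σ j, Fin (I j)) (Fin q × Σ j, Fin (I j)) ℝ) a b| ≤ τ}

theorem measurable_projBlock (a b) : Measurable fun A : ProjMatrices q P I => projBlock A a b := by
  simp only [projBlock, Matrix.of_apply]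
  split_ifs
  · have h : Measurable fun A : ProjMatrices q P I => A b.2.1 b.1 a.2 b.2.2 :=
      (measurable_pi_apply _).comp ((measurable_pi_apply _).comp
        ((measurable_pi_apply _).comp (measurable_pi_apply _)))
    exact h.const_mul _
  · exact measurable_const

theorem measurableSet_nearIsometries (τ : ℝ) : MeasurableSet (nearIsometries q P I τ) := by
  have h : nearIsometries q P I τ = ⋂ a, ⋂ b, {A | |((projBlock A).transpose * projBlock A - 1 :
      Matrix (Fin q × Σ j, Fin (I j)) (Fin q × Σ j, Fin (I j)) ℝ) a b| ≤ τ} := by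
    ext A; simp [nearIsometries]
  rw [h]
  refine MeasurableSet.iInter fun a => MeasurableSet.iInter fun b => ?_
  refine measurableSet_le (Measurable.abs ?_) measurable_const
  simp only [Matrix.sub_apply, Matrix.mul_apply, Matrix.transpose_apply]
  exact (Finset.measurable_fun_sum _ fun c _ =>
    (measurable_projBlock c a).mul (measurable_projBlock c b)).sub measurable_const

theorem projBlock_gram_apply (A : ProjMatrices q P I) (m m' : Fin q) (j : Fin d) (l l' : Fin (I j)) :
    ((projBlock A).transpose * projBlock A) (m, ⟨j, l⟩) (m', ⟨j, l'⟩)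
      = (P : ℝ)⁻¹ * ∑ p, A j m p l * A j m' p l' := by
  simp only [Matrix.mul_apply, Matrix.transpose_apply, projBlock, Matrix.of_apply]
  rw [Fintype.sum_sigma, Finset.sum_eq_single j, Finset.mul_sum]
  · refine Finset.sum_congr rfl fun p _ => ?_
    have : (Real.sqrt P)⁻¹ * (Real.sqrt P)⁻¹ = (P : ℝ)⁻¹ := by
      rw [← mul_inv, Real.mul_self_sqrt (Nat.cast_nonneg P)]
    simp only [if_true]
    linear_combination A j m p l * A j m' p l' * this
  · intro j' _ hj; simp [hj]
  · simp

theorem projBlock_gram_apply_of_ne (A : ProjMatrices q P I) {a b : Fin q × Σ j, Fin (I j)}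
    (h : a.2.1 ≠ b.2.1) :
    ((projBlock A).transpose * projBlock A - 1 :
      Matrix (Fin q × Σ j, Fin (I j)) (Fin q × Σ j, Fin (I j)) ℝ) a b = 0 := by
  have hab : a ≠ b := fun e => h (by rw [e])
  rw [Matrix.sub_apply, Matrix.one_apply_ne hab, sub_zero, Matrix.mul_apply]
  refine Finset.sum_eq_zero fun c _ => ?_
  simp only [Matrix.transpose_apply, projBlock, Matrix.of_apply]
  by_cases h1 : c.1 = a.2.1
  · rw [if_neg (fun h2 : c.1 = b.2.1 => h (h1.symm.trans h2)), mul_zero]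
  · rw [if_neg h1, zero_mul]

instance (q P : ℕ) (I : Fin d → ℕ) : IsProbabilityMeasure (projLaw q P I) := by
  unfold projLaw; infer_instance

/-- A union bound over the entries of the Gram matrix. Entries of one mode are empirical covariances
of independent normals; entries between different modes vanish identically. -/
theorem measure_nearIsometries_compl_le (hP : 0 < P) {τ : ℝ} (hτ : 0 < τ) :
    projLaw q P I (nearIsometries q P I τ)ᶜ
      ≤ ENNReal.ofReal (Fintype.card (Fin q × Σ j, Fin (I j)) ^ 2
        * (normalFourthMoment / (P * τ ^ 2))) := by
  set N := Fin q × Σ j, Fin (I j) with hN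
  have hentry : ∀ a b : N, projLaw q P I {A | τ < |((projBlock A).transpose * projBlock A - 1 :
      Matrix N N ℝ) a b|} ≤ ENNReal.ofReal (normalFourthMoment / (P * τ ^ 2)) := by
    rintro ⟨m, ⟨j, l⟩⟩ ⟨m', ⟨j', l'⟩⟩
    by_cases hj : j = j'
    · subst hj
      have hpres : MeasurePreserving (fun A : ProjMatrices q P I => A j) (projLaw q P I)
          (Measure.pi fun _ => Measure.pi fun _ => Measure.pi fun _ => gaussianReal 0 1) :=
        measurePreserving_eval _ j
      have hind : iIndepFun (fun (s : (Fin q × Fin P) × Fin (I j)) (A : ProjMatrices q P I) =>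
          A j s.1.1 s.1.2 s.2) (projLaw q P I) :=
        iIndepFun_comp_measurePreserving (iIndepFun_nested_normal q P (I j))
          (fun s => (measurable_pi_apply _).comp ((measurable_pi_apply _).comp
            (measurable_pi_apply _))) hpres
      have hlaw : ∀ s : (Fin q × Fin P) × Fin (I j),
          MeasurePreserving (fun A : ProjMatrices q P I => A j s.1.1 s.1.2 s.2) (projLaw q P I)
            (gaussianReal 0 1) := fun s =>
        (measurePreserving_eval _ s.2).comp ((measurePreserving_eval _ s.1.2).comp
          ((measurePreserving_eval _ s.1.1).comp hpres))
      have h := measure_empirical_covariance_le hind hlaw hP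
        (a := fun p => ((m, p), l)) (b := fun p => ((m', p), l'))
        (fun p p' hp e => hp (by simpa using congrArg (fun s => s.1.2) e))
        (fun p p' hp e => hp (by simpa using congrArg (fun s => s.1.2) e))
        (fun p p' hp e => hp (by simpa using congrArg (fun s => s.1.2) e))
        (δ := (1 : Matrix N N ℝ) (m, ⟨j, l⟩) (m', ⟨j, l'⟩)) (by
          by_cases he : (m, l) = (m', l')
          · obtain ⟨rfl, rfl⟩ := Prod.mk.inj he
            exact Or.inl ⟨fun p => rfl, Matrix.one_apply_eq _⟩
          · refine Or.inr ⟨fun p e => he ?_, Matrix.one_apply_ne fun e => he ?_⟩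
            · simp only [Prod.mk.injEq] at e ⊢; exact ⟨e.1.1, e.2⟩
            · simp only [Prod.mk.injEq, Sigma.mk.injEq, heq_eq_eq, true_and] at e ⊢; exact e) hτ
      refine (measure_mono fun A hA => ?_).trans h
      simp only [Set.mem_ofPred_eq, Matrix.sub_apply] at hA ⊢
      rw [projBlock_gram_apply] at hA
      exact hA.le
    · have : {A : ProjMatrices q P I | τ < |((projBlock A).transpose * projBlock A - 1 :
          Matrix N N ℝ) (m, ⟨j, l⟩) (m', ⟨j', l'⟩)|} = ∅ := by
        ext A
        rw [Set.mem_ofPred_eq, projBlock_gram_apply_of_ne A hj]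
        simp [hτ.le]
      rw [this]; simp
  have hsub : (nearIsometries q P I τ)ᶜ ⊆ ⋃ s : N × N,
      {A | τ < |((projBlock A).transpose * projBlock A - 1 : Matrix N N ℝ) s.1 s.2|} := by
    intro A hA
    simp only [nearIsometries, Set.mem_compl_iff, Set.mem_ofPred_eq, not_forall, not_le] at hA
    obtain ⟨a, b, h⟩ := hA
    exact Set.mem_iUnion.mpr ⟨(a, b), h⟩
  refine (measure_mono hsub).trans ((measure_iUnion_le _).trans ?_)
  rw [tsum_fintype]
  refine (Finset.sum_le_sum fun s _ => hentry s.1 s.2).trans_eq ?_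
  rw [Finset.sum_const, Finset.card_univ, Fintype.card_prod, nsmul_eq_mul,
    ENNReal.ofReal_mul (by positivity), ← sq]
  congr 1
  rw [ENNReal.ofReal_pow (Nat.cast_nonneg _), ENNReal.ofReal_natCast, Nat.cast_pow]

end NearIsometry

/-! ### Gradient noise at the minimizer of the population risk. -/

section Minimizers

variable {H : Type*} [NormedAddCommGroup H] [InnerProductSpace ℝ H] {Ω : Type*} {Y : Ω → ℝ}
  {Φ : Ω → H} {κ lam : ℝ} {g : H}

/-- The gradients of the summands of the regularized risk at `g`. -/
noncomputable def gradSummand (Y : Ω → ℝ) (Φ : Ω → H) (lam : ℝ) (g : H) (z : Ω) : H :=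
  sqHingeDeriv (Y z) (inner ℝ (Φ z) g) • Φ z + (2 * lam) • g

theorem norm_gradSummand_le {z : Ω} (hκ : 1 ≤ κ) (hlam : 0 < lam) (hlam1 : lam ≤ 1)
    (hg : Real.sqrt lam * ‖g‖ ≤ 1) (hY : |Y z| ≤ 1) (hΦ : ‖Φ z‖ ≤ κ) :
    ‖gradSummand Y Φ lam g z‖ ≤ 6 * κ ^ 2 / Real.sqrt lam := by
  set l := Real.sqrt lam
  have hl : 0 < l := Real.sqrt_pos.mpr hlam
  have hl1 : l ≤ 1 := Real.sqrt_le_one.mpr hlam1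
  have hll : l * l = lam := Real.mul_self_sqrt hlam.le
  have h1 := norm_sqHingeDeriv_smul_le (g := g) hY hΦ
  have h2 : ‖(2 * lam) • g‖ = 2 * lam * ‖g‖ := by
    rw [norm_smul, Real.norm_of_nonneg (by positivity)]
  have h3 := norm_add_le (sqHingeDeriv (Y z) (inner ℝ (Φ z) g) • Φ z) ((2 * lam) • g)
  have hn := norm_nonneg g
  unfold gradSummand
  rw [le_div_iff₀ hl]
  refine (mul_le_mul_of_nonneg_right h3 hl.le).trans ?_
  rw [h2]
  have h4 : ‖sqHingeDeriv (Y z) (inner ℝ (Φ z) g) • Φ z‖ * l ≤ 2 * (1 + κ * ‖g‖) * κ * l := by gcongr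
  have h5 : 2 * (1 + κ * ‖g‖) * κ * l = 2 * κ * l + 2 * κ ^ 2 * (l * ‖g‖) := by ring
  have h6 : 2 * κ ^ 2 * (l * ‖g‖) ≤ 2 * κ ^ 2 * 1 := by gcongr
  have h7 : 2 * lam * ‖g‖ * l = 2 * lam * (l * ‖g‖) := by ring
  have h8 : 2 * lam * (l * ‖g‖) ≤ 2 * 1 * 1 := by gcongr
  have h9 : κ * l ≤ κ * 1 := by gcongr
  nlinarith

variable [MeasurableSpace Ω] {ρ : Measure Ω}

theorem regRisk_zero [IsProbabilityMeasure ρ] : regRisk ρ Y Φ lam 0 = 1 := by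
  simp [regRisk, sqHinge_zero]

theorem mul_norm_sq_le_regRisk : lam * ‖g‖ ^ 2 ≤ regRisk ρ Y Φ lam g :=
  le_add_of_nonneg_left (integral_nonneg fun _ => sqHinge_nonneg _ _)

theorem stronglyMeasurable_gradSummand (hYm : Measurable Y) (hΦm : StronglyMeasurable Φ) :
    StronglyMeasurable (gradSummand Y Φ lam g) :=
  (stronglyMeasurable_sqHingeDeriv_smul hYm hΦm g).add stronglyMeasurable_const

variable [CompleteSpace H]

theorem regRisk_add_le_of_grad_eq_zero [IsFiniteMeasure ρ] (hYm : Measurable Y)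
    (hΦm : StronglyMeasurable Φ) (hY : ∀ᵐ z ∂ρ, |Y z| ≤ 1) (hΦ : ∀ᵐ z ∂ρ, ‖Φ z‖ ≤ κ)
    (hg : regRiskGrad ρ Y Φ lam g = 0) (g' : H) :
    regRisk ρ Y Φ lam g + lam * ‖g' - g‖ ^ 2 ≤ regRisk ρ Y Φ lam g' := by
  have h := regRisk_lower hYm hΦm hY hΦ lam g g'
  rwa [hg, inner_zero_left, add_zero] at h

theorem regRisk_le_one_of_grad_eq_zero [IsProbabilityMeasure ρ] (hlam : 0 < lam)
    (hYm : Measurable Y) (hΦm : StronglyMeasurable Φ) (hY : ∀ᵐ z ∂ρ, |Y z| ≤ 1)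
    (hΦ : ∀ᵐ z ∂ρ, ‖Φ z‖ ≤ κ) (hg : regRiskGrad ρ Y Φ lam g = 0) : regRisk ρ Y Φ lam g ≤ 1 := by
  have h := regRisk_add_le_of_grad_eq_zero hYm hΦm hY hΦ hg 0
  rw [regRisk_zero] at h
  have : 0 ≤ lam * ‖0 - g‖ ^ 2 := by positivity
  linarith

theorem sqrt_mul_norm_le_one_of_grad_eq_zero [IsProbabilityMeasure ρ] (hlam : 0 < lam)
    (hYm : Measurable Y) (hΦm : StronglyMeasurable Φ) (hY : ∀ᵐ z ∂ρ, |Y z| ≤ 1)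
    (hΦ : ∀ᵐ z ∂ρ, ‖Φ z‖ ≤ κ) (hg : regRiskGrad ρ Y Φ lam g = 0) : Real.sqrt lam * ‖g‖ ≤ 1 := by
  have h := (mul_norm_sq_le_regRisk (ρ := ρ) (Y := Y) (Φ := Φ)).trans
    (regRisk_le_one_of_grad_eq_zero hlam hYm hΦm hY hΦ hg)
  have h2 : (Real.sqrt lam * ‖g‖) ^ 2 ≤ 1 := by rwa [mul_pow, Real.sq_sqrt hlam.le]
  exact (sq_le_one_iff₀ (by positivity)).mp h2

theorem integral_gradSummand [IsProbabilityMeasure ρ] (hYm : Measurable Y)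
    (hΦm : StronglyMeasurable Φ) (hY : ∀ᵐ z ∂ρ, |Y z| ≤ 1) (hΦ : ∀ᵐ z ∂ρ, ‖Φ z‖ ≤ κ) :
    ∫ z, gradSummand Y Φ lam g z ∂ρ = regRiskGrad ρ Y Φ lam g := by
  unfold gradSummand regRiskGrad
  rw [integral_add (integrable_sqHingeDeriv_smul hYm hΦm hY hΦ g) (integrable_const _)]
  simp

/-- The self-bounding derivative bounds the variance by the risk, and the regularized risk at the
minimizer is at most its value `1` at zero. Hence no power of `1 / lam` appears. -/
theorem integral_norm_gradSummand_sq_le [IsProbabilityMeasure ρ] (hκ : 1 ≤ κ) (hlam : 0 < lam)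
    (hlam1 : lam ≤ 1) (hYm : Measurable Y) (hΦm : StronglyMeasurable Φ) (hY : ∀ᵐ z ∂ρ, |Y z| ≤ 1)
    (hΦ : ∀ᵐ z ∂ρ, ‖Φ z‖ ≤ κ) (hg : regRiskGrad ρ Y Φ lam g = 0) :
    ∫ z, ‖gradSummand Y Φ lam g z‖ ^ 2 ∂ρ ≤ 16 * κ ^ 2 := by
  have hr := regRisk_le_one_of_grad_eq_zero hlam hYm hΦm hY hΦ hg
  have hint := integrable_sqHinge_inner hYm hΦm hY hΦ g
  have hb : ∀ᵐ z ∂ρ, ‖gradSummand Y Φ lam g z‖ ^ 2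
      ≤ 8 * κ ^ 2 * sqHinge (Y z) (inner ℝ (Φ z) g) + 8 * lam ^ 2 * ‖g‖ ^ 2 := by
    filter_upwards [hY, hΦ] with z h1 h2
    have h3 : ‖gradSummand Y Φ lam g z‖ ≤ |sqHingeDeriv (Y z) (inner ℝ (Φ z) g)| * κ
        + 2 * lam * ‖g‖ := by
      refine (norm_add_le _ _).trans ?_
      rw [norm_smul, norm_smul, Real.norm_eq_abs, Real.norm_of_nonneg (by positivity : 0 ≤ 2 * lam)]
      gcongr
    have h4 := sqHingeDeriv_sq (Y z) (inner ℝ (Φ z) g)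
    have h5 : Y z ^ 2 ≤ 1 := by rw [← sq_abs]; exact pow_le_one₀ (abs_nonneg _) h1
    have h6 : sqHingeDeriv (Y z) (inner ℝ (Φ z) g) ^ 2 ≤ 4 * sqHinge (Y z) (inner ℝ (Φ z) g) := by
      rw [h4]
      nlinarith [sqHinge_nonneg (Y z) (inner ℝ (Φ z) g)]
    rw [← sq_abs] at h6
    set D := |sqHingeDeriv (Y z) (inner ℝ (Φ z) g)|
    calc ‖gradSummand Y Φ lam g z‖ ^ 2 ≤ (D * κ + 2 * lam * ‖g‖) ^ 2 := by gcongr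
      _ ≤ 2 * κ ^ 2 * D ^ 2 + 8 * lam ^ 2 * ‖g‖ ^ 2 := by
          nlinarith [sq_nonneg (D * κ - 2 * lam * ‖g‖)]
      _ ≤ 2 * κ ^ 2 * (4 * sqHinge (Y z) (inner ℝ (Φ z) g)) + 8 * lam ^ 2 * ‖g‖ ^ 2 := by gcongr
      _ = _ := by ring
  refine (integral_mono_of_nonneg (Filter.Eventually.of_forall fun z => sq_nonneg _)
    ((hint.const_mul _).add (integrable_const _)) hb).trans ?_
  have e := integral_add (μ := ρ) (hint.const_mul (8 * κ ^ 2))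
    (integrable_const (8 * lam ^ 2 * ‖g‖ ^ 2))
  refine e.trans_le ?_
  rw [integral_const_mul, integral_const, probReal_univ, one_smul]
  unfold regRisk at hr
  set R := ∫ z, sqHinge (Y z) (inner ℝ (Φ z) g) ∂ρ
  have hR : 0 ≤ R := integral_nonneg fun z => sqHinge_nonneg _ _
  have hlg : 0 ≤ lam * ‖g‖ ^ 2 := by positivity
  have hκ2 : 1 ≤ κ ^ 2 := one_le_pow₀ hκ
  nlinarith

/-- Here `u` is the distance of the minimizers and `l = √lam`. The a priori bound `l * u ≤ 2` trades
powers of `l * u` against the deviation bound: one power if the variance term dominates, three after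
squaring if the boundedness term does. Both regimes then give the same rate. -/
theorem sq_le_of_deviation {u q l : ℝ} (hκ : 0 ≤ κ) (hl : 0 < l) (hq : 0 ≤ q) (hu : 0 ≤ u)
    (h1 : l ^ 2 * u ≤ 8 * κ * q + 6 * κ ^ 2 * q ^ 2 / l) (h2 : l * u ≤ 2) :
    u ^ 2 * l ^ 3 ≤ 32 * κ * q := by
  have h0 : 0 ≤ l * u := by positivity
  rcases le_total (6 * κ ^ 2 * q ^ 2 / l) (8 * κ * q) with h | h
  · have h3 : l ^ 2 * u ≤ 16 * κ * q := by linarith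
    calc u ^ 2 * l ^ 3 = (l ^ 2 * u) * (l * u) := by ring
      _ ≤ (16 * κ * q) * 2 := by gcongr
      _ = _ := by ring
  · have h3 : l ^ 3 * u ≤ 12 * κ ^ 2 * q ^ 2 := by
      have h4 : l ^ 2 * u ≤ 12 * κ ^ 2 * q ^ 2 / l := by
        refine h1.trans ?_
        have : 12 * κ ^ 2 * q ^ 2 / l = 2 * (6 * κ ^ 2 * q ^ 2 / l) := by ring
        linarith
      rw [le_div_iff₀ hl] at h4
      linarith
    refine le_of_sq_le_sq ?_ (by positivity)
    calc (u ^ 2 * l ^ 3) ^ 2 = (l ^ 3 * u) * (l * u) ^ 3 := by ring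
      _ ≤ (12 * κ ^ 2 * q ^ 2) * 2 ^ 3 := by gcongr
      _ ≤ _ := by nlinarith [sq_nonneg (κ * q)]

/-- A Bernstein bound for the gradient of the empirical risk at the minimizer of the risk. -/
theorem measure_gradSummand_ge_le [IsProbabilityMeasure ρ] (hκ : 1 ≤ κ) (hlam : 0 < lam)
    (hlam1 : lam ≤ 1) (hYm : Measurable Y) (hΦm : StronglyMeasurable Φ) (hY : ∀ᵐ z ∂ρ, |Y z| ≤ 1)
    (hΦ : ∀ᵐ z ∂ρ, ‖Φ z‖ ≤ κ) (hg : regRiskGrad ρ Y Φ lam g = 0) {n : ℕ} {δ q : ℝ} (hn : 1 ≤ n)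
    (hδ : 0 < δ) (hδ1 : δ < 1) (hq : 0 < q) (hqn : n * q ^ 2 = Real.log (2 / δ)) :
    (Measure.pi fun _ : Fin n => ρ) {T | n * (8 * κ * q + 6 * κ ^ 2 * q ^ 2 / Real.sqrt lam)
        ≤ ‖∑ i, gradSummand Y Φ lam g (T i)‖} ≤ ENNReal.ofReal δ := by
  set l := Real.sqrt lam
  have hl : 0 < l := Real.sqrt_pos.mpr hlam
  set b := 6 * κ ^ 2 / l with hb
  have hb0 : 0 < b := by positivity
  have hκ0 : 0 < κ := by linarith
  -- The two regimes of Bernstein's inequality: the value `q / (4 * κ)` suited to the variance `16 *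
  -- κ ^ 2`, capped at `1 / b` so that the scaled vectors have norm at most one.
  set s := min (q / (4 * κ)) (1 / b) with hs
  have hs0 : 0 < s := by positivity
  have hsb : s * b ≤ 1 := by
    calc s * b ≤ 1 / b * b := by gcongr; exact min_le_right _ _
      _ = 1 := by field_simp
  have hgn := sqrt_mul_norm_le_one_of_grad_eq_zero hlam hYm hΦm hY hΦ hg
  have h := measure_norm_sum_ge_le (ρ := ρ) (stronglyMeasurable_gradSummand (lam := lam) (g := g)
    hYm hΦm) hs0 (b := b) (by
      filter_upwards [hY, hΦ] with z h1 h2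
      exact norm_gradSummand_le hκ hlam hlam1 hgn h1 h2) hsb
    (by rw [integral_gradSummand hYm hΦm hY hΦ, hg])
    (integral_norm_gradSummand_sq_le hκ hlam hlam1 hYm hΦm hY hΦ hg) n
    (n * (8 * κ * q + 6 * κ ^ 2 * q ^ 2 / l))
  refine h.trans (ENNReal.ofReal_le_ofReal ?_)
  have hn0 : (1 : ℝ) ≤ n := by exact_mod_cast hn
  have key : (n : ℝ) * (s ^ 2 * (16 * κ ^ 2)) - s * (n * (8 * κ * q + 6 * κ ^ 2 * q ^ 2 / l))
      ≤ -Real.log (2 / δ) := by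
    have e1 : s * (n * (8 * κ * q + 6 * κ ^ 2 * q ^ 2 / l)) = s * (8 * κ * n * q + b * (n * q ^ 2)) := by
      rw [hb]; ring
    rw [e1, ← hqn]
    have h1 : s * (4 * κ) ≤ q := by
      calc s * (4 * κ) ≤ q / (4 * κ) * (4 * κ) := by gcongr; exact min_le_left _ _
        _ = q := by field_simp
    have h2 : (n : ℝ) * (s ^ 2 * (16 * κ ^ 2)) ≤ n * (s * (4 * κ)) * q := by
      have : (n : ℝ) * (s ^ 2 * (16 * κ ^ 2)) = n * (s * (4 * κ)) * (s * (4 * κ)) := by ring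
      rw [this]; gcongr
    have h3 : (n : ℝ) * q ^ 2 ≤ s * (4 * κ * n * q + b * (n * q ^ 2)) := by
      rcases min_choice (q / (4 * κ)) (1 / b) with h | h
      · have e : s = q / (4 * κ) := h
        have : s * (4 * κ * n * q) = n * q ^ 2 := by rw [e]; field_simp
        have h4 : 0 ≤ s * (b * (n * q ^ 2)) := by positivity
        linarith
      · have e : s = 1 / b := h
        have : s * (b * (n * q ^ 2)) = n * q ^ 2 := by rw [e]; field_simp
        have h4 : 0 ≤ s * (4 * κ * n * q) := by positivity
        linarith
    nlinarith
  calc 2 * Real.exp _ ≤ 2 * Real.exp (-Real.log (2 / δ)) := by gcongr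
    _ = δ := by rw [Real.exp_neg, Real.exp_log (by positivity)]; field_simp

end Minimizers

/-! ### The empirical minimizer, as the minimizer for the uniform law on the sample. -/

section EmpiricalMinimizer

variable {H : Type*} [NormedAddCommGroup H] [InnerProductSpace ℝ H] [CompleteSpace H] {Ω : Type*}
  [MeasurableSpace Ω] {Y : Ω → ℝ} {Φ : Ω → H} {κ lam : ℝ} {n : ℕ}

/-- The uniform distribution on `Fin n`. -/
noncomputable def uniformFin (n : ℕ) : Measure (Fin n) := (n : ℝ≥0∞)⁻¹ • Measure.count

theorem isProbabilityMeasure_uniformFin (hn : 1 ≤ n) : IsProbabilityMeasure (uniformFin n) :=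
  ⟨by
    simp only [uniformFin, Measure.smul_apply, Measure.count_univ, smul_eq_mul]
    rw [ENat.card_eq_coe_fintype_card, Fintype.card_fin]
    exact ENNReal.inv_mul_cancel (by simp; omega) (by simp)⟩

theorem integral_uniformFin {E : Type*} [NormedAddCommGroup E] [NormedSpace ℝ E] [CompleteSpace E]
    (f : Fin n → E) : ∫ i, f i ∂(uniformFin n) = (1 / (n : ℝ)) • ∑ i, f i := by
  rw [uniformFin, integral_smul_measure, integral_count]
  simp

/-- The empirical minimizer exists, is unique, and is close to any element of small empirical
gradient. -/
theorem exists_empirical_minimizer (hn : 1 ≤ n) (hlam : 0 < lam) (Y : Fin n → ℝ) (Φ : Fin n → H)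
    (hY : ∀ i, |Y i| ≤ 1) (hΦ : ∀ i, ‖Φ i‖ ≤ κ) :
    ∃ g : H, (∀ g', g' ≠ g →
        1 / (n : ℝ) * ∑ i, sqHinge (Y i) (inner ℝ (Φ i) g) + lam * ‖g‖ ^ 2
          < 1 / (n : ℝ) * ∑ i, sqHinge (Y i) (inner ℝ (Φ i) g') + lam * ‖g'‖ ^ 2) ∧
      Real.sqrt lam * ‖g‖ ≤ 1 ∧
      ∀ g₀, n * (lam * ‖g - g₀‖) ≤ ‖∑ i, gradSummand Y Φ lam g₀ i‖ := by
  have := isProbabilityMeasure_uniformFin hn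
  have hYm : Measurable Y := measurable_of_finite Y
  have hΦm : StronglyMeasurable Φ := StronglyMeasurable.of_discrete
  have hY' := Filter.Eventually.of_forall (f := ae (uniformFin n)) hY
  have hΦ' := Filter.Eventually.of_forall (f := ae (uniformFin n)) hΦ
  have e : ∀ g, regRisk (uniformFin n) Y Φ lam g
      = 1 / (n : ℝ) * ∑ i, sqHinge (Y i) (inner ℝ (Φ i) g) + lam * ‖g‖ ^ 2 := by
    intro g
    rw [regRisk, integral_uniformFin, smul_eq_mul]
  obtain ⟨g, hg⟩ := exists_regRiskGrad_eq_zero hYm hΦm hY' hΦ' hlam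
  have hmin := regRisk_add_le_of_grad_eq_zero hYm hΦm hY' hΦ' hg
  refine ⟨g, fun g' hne => ?_, sqrt_mul_norm_le_one_of_grad_eq_zero hlam hYm hΦm hY' hΦ' hg,
    fun g₀ => ?_⟩
  · rw [← e, ← e]
    have h1 := hmin g'
    have h2 : 0 < lam * ‖g' - g‖ ^ 2 := by
      have := norm_pos_iff.mpr (sub_ne_zero.mpr hne)
      positivity
    linarith
  · have h1 : regRisk (uniformFin n) Y Φ lam g ≤ regRisk (uniformFin n) Y Φ lam g₀ := by
      have h2 := hmin g₀
      have h3 : 0 ≤ lam * ‖g₀ - g‖ ^ 2 := by positivity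
      linarith
    have h2 := norm_sub_le_norm_gradient (regRisk_lower hYm hΦm hY' hΦ' lam) h1
    rw [← integral_gradSummand hYm hΦm hY' hΦ', integral_uniformFin, norm_smul,
      Real.norm_of_nonneg (by positivity)] at h2
    have hn0 : (0 : ℝ) < n := by exact_mod_cast hn
    calc n * (lam * ‖g - g₀‖) ≤ n * (1 / (n : ℝ) * ‖∑ i, gradSummand Y Φ lam g₀ i‖) := by gcongr
      _ = _ := by field_simp

end EmpiricalMinimizer

/-! ### Joint probability over the random features and the sample. -/

section RandomFeatures

variable {H : Type*} [NormedAddCommGroup H] [InnerProductSpace ℝ H] [CompleteSpace H] {Ω 𝒜 : Type*}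
  [MeasurableSpace Ω] {Q : Measure Ω} [IsProbabilityMeasure Q] {Y : Ω → ℝ} {Φ : 𝒜 → Ω → H}
  {κ lam : ℝ} {S : Set Ω}

/-- By stability the distance of the minimizers at `A'` and `A` is controlled by the gradient for
`A'` at the minimizer for `A`, which tends to zero by dominated convergence. Continuity makes the
exceptional set measurable, so that Fubini applies. -/
theorem continuous_minimizer [TopologicalSpace 𝒜] [FirstCountableTopology 𝒜] (hlam : 0 < lam)
    (hYm : Measurable Y) (hΦm : ∀ A, StronglyMeasurable (Φ A)) (hΦc : ∀ ω, Continuous fun A => Φ A ω)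
    (hS : ∀ᵐ ω ∂Q, ω ∈ S) (hY : ∀ ω ∈ S, |Y ω| ≤ 1)
    (hloc : ∀ A, ∃ K, ∀ᶠ A' in nhds A, ∀ ω ∈ S, ‖Φ A' ω‖ ≤ K) {g : 𝒜 → H}
    (hg : ∀ A, regRiskGrad Q Y (Φ A) lam (g A) = 0) : Continuous g := by
  have hY' : ∀ᵐ ω ∂Q, |Y ω| ≤ 1 := hS.mono hY
  refine continuous_iff_continuousAt.mpr fun A => ?_
  obtain ⟨K, hK⟩ := hloc A
  have hgrad : ContinuousAt (fun A' => regRiskGrad Q Y (Φ A') lam (g A)) A := by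
    unfold regRiskGrad
    refine ContinuousAt.add ?_ continuousAt_const
    refine continuousAt_of_dominated (bound := fun _ => 2 * (1 + K * ‖g A‖) * K)
      (Filter.Eventually.of_forall fun A' =>
        (stronglyMeasurable_sqHingeDeriv_smul hYm (hΦm A') (g A)).aestronglyMeasurable) ?_
      (integrable_const _) (Filter.Eventually.of_forall fun ω => ?_)
    · filter_upwards [hK] with A' hA'
      filter_upwards [hS] with ω hω using norm_sqHingeDeriv_smul_le (hY ω hω) (hA' ω hω)
    · have h1 : Continuous fun A' => sqHingeDeriv (Y ω) (inner ℝ (Φ A' ω) (g A)) :=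
        continuous_sqHingeDeriv.comp
          (continuous_const.prodMk ((hΦc ω).inner continuous_const))
      exact (h1.smul (hΦc ω)).continuousAt
  have hle : ∀ᶠ A' in nhds A, ‖g A' - g A‖ ≤ lam⁻¹ * ‖regRiskGrad Q Y (Φ A') lam (g A)‖ := by
    filter_upwards [hK] with A' hA'
    have hΦ' : ∀ᵐ ω ∂Q, ‖Φ A' ω‖ ≤ K := hS.mono hA'
    have h1 := regRisk_add_le_of_grad_eq_zero hYm (hΦm A') hY' hΦ' (hg A') (g A)
    have h2 : 0 ≤ lam * ‖g A - g A'‖ ^ 2 := by positivity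
    have h3 := norm_sub_le_norm_gradient (regRisk_lower hYm (hΦm A') hY' hΦ' lam)
      (g₀ := g A) (g := g A') (by linarith)
    rw [inv_mul_eq_div, le_div_iff₀ hlam]
    linarith
  have hlim : Filter.Tendsto (fun A' => lam⁻¹ * ‖regRiskGrad Q Y (Φ A') lam (g A)‖) (nhds A)
      (nhds 0) := by
    have h := (hgrad.norm.tendsto).const_mul lam⁻¹
    rw [hg A, norm_zero, mul_zero] at h
    exact h
  exact tendsto_iff_norm_sub_tendsto_zero.mpr (squeeze_zero' (Filter.Eventually.of_forall fun _ =>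
    norm_nonneg _) hle hlim)

/-- Conditionally on `A` the failure probability is at most `δ` on `G` and at most `1` off `G`; the
total is at most `δ + (1 - δ) * β`, the complement of the product of the success probabilities. -/
theorem measure_prod_compl_le {𝒯 : Type*} [MeasurableSpace 𝒜] [MeasurableSpace 𝒯] {π : Measure 𝒜}
    [IsProbabilityMeasure π] {ν : Measure 𝒯} [IsProbabilityMeasure ν] {G : Set 𝒜}
    (hG : MeasurableSet G) {β δ : ℝ} (hδ0 : 0 ≤ δ) (hδ1 : δ ≤ 1) (hβ0 : 0 ≤ β)
    (hβ : π Gᶜ ≤ ENNReal.ofReal β) {F : Set (𝒜 × 𝒯)} (hF : MeasurableSet F)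
    (hFG : ∀ A ∈ G, ν {T | (A, T) ∈ F} ≤ ENNReal.ofReal δ) :
    (π.prod ν) {p | p.1 ∈ G ∧ p ∉ F}ᶜ ≤ ENNReal.ofReal (1 - (1 - δ) * (1 - β)) := by
  have hE : MeasurableSet {p : 𝒜 × 𝒯 | p.1 ∈ G ∧ p ∉ F} := (measurable_fst hG).inter hF.compl
  rw [Measure.prod_apply hE.compl]
  have hpt : ∀ A, ν (Prod.mk A ⁻¹' {p : 𝒜 × 𝒯 | p.1 ∈ G ∧ p ∉ F}ᶜ)
      ≤ Gᶜ.indicator (fun _ => ENNReal.ofReal (1 - δ)) A + ENNReal.ofReal δ := by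
    intro A
    by_cases hA : A ∈ G
    · rw [Set.indicator_of_notMem (by simpa using hA), zero_add]
      refine le_trans (measure_mono fun T hT => ?_) (hFG A hA)
      by_contra hc
      exact hT ⟨hA, hc⟩
    · rw [Set.indicator_of_mem (by simpa using hA), ← ENNReal.ofReal_add (by linarith) hδ0]
      simpa using prob_le_one
  refine (lintegral_mono hpt).trans ?_
  rw [lintegral_add_right _ measurable_const, lintegral_indicator_const hG.compl, lintegral_const,
    measure_univ, mul_one]
  have h1 : ENNReal.ofReal (1 - δ) * π Gᶜ ≤ ENNReal.ofReal (1 - δ) * ENNReal.ofReal β := by gcongr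
  refine (add_le_add_left h1 _).trans ?_
  rw [← ENNReal.ofReal_mul (by linarith), ← ENNReal.ofReal_add (by nlinarith) hδ0]
  exact ENNReal.ofReal_le_ofReal (by linarith)

theorem measure_prod_inter_ae_compl [MeasurableSpace 𝒜] {π : Measure 𝒜}
    [IsProbabilityMeasure π] {n : ℕ} (hS : ∀ᵐ ω ∂Q, ω ∈ S) (E : Set (𝒜 × (Fin n → Ω))) :
    (π.prod (Measure.pi fun _ : Fin n => Q)) {p | p ∈ E ∧ ∀ i, p.2 i ∈ S}ᶜ
      ≤ (π.prod (Measure.pi fun _ : Fin n => Q)) Eᶜ := by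
  refine measure_mono_ae ?_
  have h1 : ∀ᵐ T ∂(Measure.pi fun _ : Fin n => Q), ∀ i, T i ∈ S := by
    rw [ae_all_iff]
    exact fun i => (Measure.quasiMeasurePreserving_eval (fun _ : Fin n => Q) i).ae hS
  filter_upwards [Measure.quasiMeasurePreserving_snd.ae h1] with p hp hpc hE
  exact hpc ⟨hE, hp⟩

/-- With high probability, the empirical gradient is small at the minimizer of the risk,
simultaneously over the random features and the sample. -/
theorem exists_minimizer_measure_compl_le [TopologicalSpace 𝒜] [SecondCountableTopology 𝒜]
    [MeasurableSpace 𝒜] [OpensMeasurableSpace 𝒜] {π : Measure 𝒜} [IsProbabilityMeasure π]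
    (hκ : 1 ≤ κ) (hlam : 0 < lam) (hlam1 : lam ≤ 1) (hYm : Measurable Y)
    (hΦm : StronglyMeasurable (Function.uncurry Φ)) (hΦc : ∀ ω, Continuous fun A => Φ A ω)
    (hS : ∀ᵐ ω ∂Q, ω ∈ S) (hY : ∀ ω ∈ S, |Y ω| ≤ 1)
    (hloc : ∀ A, ∃ K, ∀ᶠ A' in nhds A, ∀ ω ∈ S, ‖Φ A' ω‖ ≤ K) {G : Set 𝒜} (hG : MeasurableSet G)
    (hΦ : ∀ A ∈ G, ∀ ω ∈ S, ‖Φ A ω‖ ≤ κ) {β δ q : ℝ} {n : ℕ} (hn : 1 ≤ n) (hδ : 0 < δ) (hδ1 : δ < 1)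
    (hβ0 : 0 ≤ β) (hβ : π Gᶜ ≤ ENNReal.ofReal β) (hq : 0 < q)
    (hqn : n * q ^ 2 = Real.log (2 / δ)) :
    ∃ g : 𝒜 → H, (∀ A, regRiskGrad Q Y (Φ A) lam (g A) = 0) ∧
      (π.prod (Measure.pi fun _ : Fin n => Q)) {p | (p.1 ∈ G ∧
        ‖∑ i, gradSummand Y (Φ p.1) lam (g p.1) (p.2 i)‖
          < n * (8 * κ * q + 6 * κ ^ 2 * q ^ 2 / Real.sqrt lam)) ∧ ∀ i, p.2 i ∈ S}ᶜ
        ≤ ENNReal.ofReal (1 - (1 - δ) * (1 - β)) := by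
  have hΦm' : ∀ A, StronglyMeasurable (Φ A) := fun A =>
    hΦm.comp_measurable (measurable_const.prodMk measurable_id)
  have hY' : ∀ᵐ ω ∂Q, |Y ω| ≤ 1 := hS.mono hY
  have hex : ∀ A, ∃ g, regRiskGrad Q Y (Φ A) lam g = 0 := fun A => by
    obtain ⟨K, hK⟩ := hloc A
    exact exists_regRiskGrad_eq_zero hYm (hΦm' A) hY' (hS.mono hK.self_of_nhds) hlam
  choose g hg using hex
  have hgc : Continuous g := continuous_minimizer hlam hYm hΦm' hΦc hS hY hloc hg
  refine ⟨g, hg, (measure_prod_inter_ae_compl hS {p : 𝒜 × (Fin n → Ω) | p.1 ∈ G ∧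
    ‖∑ i, gradSummand Y (Φ p.1) lam (g p.1) (p.2 i)‖
      < n * (8 * κ * q + 6 * κ ^ 2 * q ^ 2 / Real.sqrt lam)}).trans ?_⟩
  set F : Set (𝒜 × (Fin n → Ω)) := {p | n * (8 * κ * q + 6 * κ ^ 2 * q ^ 2 / Real.sqrt lam)
    ≤ ‖∑ i, gradSummand Y (Φ p.1) lam (g p.1) (p.2 i)‖} with hF
  have hm : StronglyMeasurable fun p : 𝒜 × (Fin n → Ω) =>
      ∑ i, gradSummand Y (Φ p.1) lam (g p.1) (p.2 i) := by
    refine Finset.stronglyMeasurable_fun_sum _ fun i _ => ?_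
    have hi : Measurable fun p : 𝒜 × (Fin n → Ω) => p.2 i :=
      (measurable_pi_apply i).comp measurable_snd
    have h1 : StronglyMeasurable fun p : 𝒜 × (Fin n → Ω) => Φ p.1 (p.2 i) :=
      hΦm.comp_measurable (measurable_fst.prodMk hi)
    have h2 : StronglyMeasurable fun p : 𝒜 × (Fin n → Ω) => g p.1 :=
      hgc.stronglyMeasurable.comp_measurable measurable_fst
    have h3 : StronglyMeasurable fun p : 𝒜 × (Fin n → Ω) => Y (p.2 i) :=
      hYm.stronglyMeasurable.comp_measurable hi
    exact ((continuous_sqHingeDeriv.comp_stronglyMeasurable (h3.prodMk (h1.inner h2))).smul h1).add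
      (h2.const_smul (2 * lam))
  have hFm : MeasurableSet F := measurableSet_le measurable_const hm.norm.measurable
  have h := measure_prod_compl_le (π := π) (ν := Measure.pi fun _ : Fin n => Q) hG hδ.le hδ1.le hβ0
    hβ hFm fun A hA => measure_gradSummand_ge_le hκ hlam hlam1 hYm (hΦm' A) hY'
      (hS.mono (hΦ A hA)) (hg A) hn hδ hδ1 hq hqn
  refine le_trans (measure_mono (Set.compl_subset_compl.mpr fun p hp => ?_)) h
  exact ⟨hp.1, not_le.mp hp.2⟩

end RandomFeatures

/-! ### The bias and the effect of the deviation on the risk. -/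

section Excess

variable {d r q P : ℕ} {κ : Fin d → ModeKernel} {I : Fin d → ℕ} {σ : Fin r → Fin q}
  {Q : Measure (CPTensor r I × ℝ)} [IsProbabilityMeasure Q] {A : ProjMatrices q P I} {K lam : ℝ}

/-- The feature of a projected tensor. -/
noncomputable def projFeature (κ : Fin d → ModeKernel) (σ : Fin r → Fin q) (A : ProjMatrices q P I)
    (z : CPTensor r I × ℝ) : TensorRKHS r κ (fun _ : Fin d => P) :=
  featureMap κ (project σ A z.1)

theorem stronglyMeasurable_projFeature :
    StronglyMeasurable (Function.uncurry (projFeature (P := P) κ σ (I := I))) :=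
  (continuous_featureMap (κ := κ) (I := fun _ : Fin d => P)).stronglyMeasurable.comp_measurable
    (measurable_project σ measurable_fst (measurable_fst.comp measurable_snd))

theorem stronglyMeasurable_projFeature_right (A : ProjMatrices q P I) :
    StronglyMeasurable (projFeature (r := r) κ σ A) :=
  (continuous_featureMap (κ := κ) (I := fun _ : Fin d => P)).stronglyMeasurable.comp_measurable
    (measurable_project σ measurable_const measurable_fst)

theorem measurable_comp_project (A : ProjMatrices q P I) (g : TensorRKHS r κ (fun _ : Fin d => P)) :
    Measurable fun X : CPTensor r I => g (project σ A X) :=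
  (TensorRKHS.continuous g).measurable.comp (measurable_project σ measurable_const measurable_id)

theorem inner_projFeature (z : CPTensor r I × ℝ) (g : TensorRKHS r κ (fun _ : Fin d => P)) :
    inner ℝ (projFeature κ σ A z) g = g (project σ A z.1) := inner_featureMap _ _

theorem risk_comp_project (hlab : ∀ᵐ z ∂Q, z.2 = 1 ∨ z.2 = -1)
    (hK : ∀ᵐ z ∂Q, ‖projFeature κ σ A z‖ ≤ K) (g : TensorRKHS r κ (fun _ : Fin d => P)) :
    risk Q (fun X => g (project σ A X))
      = ENNReal.ofReal (∫ z, sqHinge z.2 (inner ℝ (projFeature κ σ A z) g) ∂Q) := by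
  have hY : ∀ᵐ z ∂Q, |z.2| ≤ 1 := hlab.mono fun z h => by rcases h with h | h <;> rw [h] <;> norm_num
  rw [ofReal_integral_eq_lintegral_ofReal (integrable_sqHinge_inner measurable_snd
    (stronglyMeasurable_projFeature_right A) hY hK g)
    (Filter.Eventually.of_forall fun z => sqHinge_nonneg _ _)]
  simp only [inner_projFeature, risk]

/-- Finiteness allows the Bayes risk to be cancelled in extended nonnegative reals. -/
theorem bayesRisk_ne_top (hlab : ∀ᵐ z ∂Q, z.2 = 1 ∨ z.2 = -1)
    (hK : ∀ᵐ z ∂Q, ‖projFeature κ σ A z‖ ≤ K) : bayesRisk Q ≠ ∞ := by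
  refine ne_top_of_le_ne_top ?_ (bayesRisk_le (measurable_comp_project (κ := κ) (σ := σ) A 0))
  rw [risk_comp_project hlab hK]
  exact ENNReal.ofReal_ne_top

theorem lintegral_sq_inner_projFeature_le (hK : ∀ᵐ z ∂Q, ‖projFeature κ σ A z‖ ≤ K)
    (g : TensorRKHS r κ (fun _ : Fin d => P)) :
    ∫⁻ z, ENNReal.ofReal (g (project σ A z.1) ^ 2) ∂Q ≤ ENNReal.ofReal (K ^ 2 * ‖g‖ ^ 2) := by
  calc _ ≤ ∫⁻ _, ENNReal.ofReal (K ^ 2 * ‖g‖ ^ 2) ∂Q := by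
        refine lintegral_mono_ae (hK.mono fun z hz => ENNReal.ofReal_le_ofReal ?_)
        have h := abs_inner_le_of_norm_le (g := g) hz
        rw [inner_projFeature] at h
        rw [← sq_abs, ← mul_pow]
        gcongr
    _ = _ := by simp

/-- The excess risk of a function close to another one. -/
theorem risk_le_of_norm_sub_le (hlab : ∀ᵐ z ∂Q, z.2 = 1 ∨ z.2 = -1)
    (hK : ∀ᵐ z ∂Q, ‖projFeature κ σ A z‖ ≤ K) {g₀ g : TensorRKHS r κ (fun _ : Fin d => P)} {e : ℝ}
    (he : 0 ≤ e) (h₀ : risk Q (fun X => g₀ (project σ A X)) ≤ bayesRisk Q + ENNReal.ofReal e) :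
    risk Q (fun X => g (project σ A X))
      ≤ bayesRisk Q + ENNReal.ofReal (2 * e + 2 * (K ^ 2 * ‖g - g₀‖ ^ 2)) := by
  have h := risk_add_le hlab (measurable_comp_project (σ := σ) A g₀)
    (measurable_comp_project (σ := σ) A (g - g₀))
  have e1 : (fun X : CPTensor r I => g₀ (project σ A X) + (g - g₀) (project σ A X))
      = fun X => g (project σ A X) := by
    ext X
    simp
  rw [e1] at h
  have h2 := lintegral_sq_inner_projFeature_le hK (g - g₀)
  have hb := bayesRisk_ne_top hlab hK
  have h3 : risk Q (fun X => g (project σ A X)) + bayesRisk Q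
      ≤ (bayesRisk Q + ENNReal.ofReal (2 * e + 2 * (K ^ 2 * ‖g - g₀‖ ^ 2))) + bayesRisk Q := by
    refine h.trans ?_
    calc _ ≤ 2 * (bayesRisk Q + ENNReal.ofReal e)
          + 2 * ENNReal.ofReal (K ^ 2 * ‖g - g₀‖ ^ 2) := by gcongr
      _ = _ := by
          rw [ENNReal.ofReal_add (by positivity) (by positivity), ENNReal.ofReal_mul zero_le_two,
            ENNReal.ofReal_mul zero_le_two, ENNReal.ofReal_ofNat]
          ring
  exact (ENNReal.add_le_add_iff_right hb).mp h3

/-- The risk of the minimizer of the regularized risk of projected tensors. -/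
theorem risk_minimizer_le (hr : 0 < r) {B c η : ℝ} (hQ : DataAssumptions κ B c η Q)
    (hlam : 0 < lam) (hlam1 : lam ≤ 1) (hK : ∀ᵐ z ∂Q, ‖projFeature κ σ A z‖ ≤ K)
    (hK' : ∀ᵐ z ∂Q, ‖featureMap κ z.1‖ ≤ K)
    (dom : ∀ (φ : CPTensor r I × ℝ → ℝ) (b : ℝ), Measurable φ → (∀ᵐ z ∂Q, |φ z| ≤ b) →
      ‖∫ z, φ z • featureMap κ z.1 ∂Q‖ ^ 2
        ≤ 2 * r * (‖∫ z, φ z • projFeature κ σ A z ∂Q‖ ^ 2 + lam * ∫ z, φ z ^ 2 ∂Q))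
    {g₀ : TensorRKHS r κ (fun _ : Fin d => P)}
    (hg₀ : regRiskGrad Q Prod.snd (projFeature κ σ A) lam g₀ = 0) :
    risk Q (fun X => g₀ (project σ A X))
      ≤ bayesRisk Q + ENNReal.ofReal (4 * r * ((|c| + 1) * lam ^ η)) := by
  have hlab := hQ.label
  have hY : ∀ᵐ z ∂Q, |z.2| ≤ 1 := hlab.mono fun z h => by rcases h with h | h <;> rw [h] <;> norm_num
  have hΨm := stronglyMeasurable_projFeature_right (κ := κ) (σ := σ) (r := r) A
  have hΦm : StronglyMeasurable fun z : CPTensor r I × ℝ => featureMap κ z.1 :=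
    continuous_featureMap.stronglyMeasurable.comp_measurable measurable_fst
  have hpow : 0 < lam ^ η := Real.rpow_pos_of_pos hlam η
  -- The infimum need not be attained; enlarging `c` to `|c| + 1` makes the inequality strict and
  -- provides a near-optimal `f`.
  have hlt : approxError κ Q lam < ENNReal.ofReal ((|c| + 1) * lam ^ η) := by
    refine (hQ.approx lam hlam hlam1).trans_lt ?_
    rw [ENNReal.ofReal_lt_ofReal_iff (by positivity)]
    have := le_abs_self c
    gcongr
    linarith
  obtain ⟨f, hf⟩ := iInf_lt_iff.mp hlt
  have hr1 : (1 : ℝ) ≤ r := by exact_mod_cast hr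
  obtain ⟨g, hg⟩ := exists_approximation hlam (by positivity) hΦm hΨm hK' hK dom f
  simp only [inner_projFeature, inner_featureMap] at hg
  have hfm : Measurable (f : CPTensor r I → ℝ) := (TensorRKHS.continuous f).measurable
  have hδm : Measurable fun X : CPTensor r I => g (project σ A X) - f X :=
    (measurable_comp_project A g).sub hfm
  have h1 := risk_add_le hlab hfm hδm
  have e1 : (fun X : CPTensor r I => f X + (g (project σ A X) - f X))
      = fun X => g (project σ A X) := by
    ext X; ring
  rw [e1] at h1
  have hint : Integrable (fun z : CPTensor r I × ℝ => (g (project σ A z.1) - f z.1) ^ 2) Q := by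
    refine Integrable.of_bound (C := (K * ‖g‖ + K * ‖f‖) ^ 2)
      ((hδm.comp measurable_fst).pow_const 2).aestronglyMeasurable ?_
    filter_upwards [hK, hK'] with z h2 h3
    have h4 := abs_inner_le_of_norm_le (g := g) h2
    have h5 := abs_inner_le_of_norm_le (g := f) h3
    rw [inner_projFeature] at h4
    rw [inner_featureMap] at h5
    rw [Real.norm_of_nonneg (sq_nonneg _), ← sq_abs]
    gcongr
    exact (abs_sub _ _).trans (add_le_add h4 h5)
  set s := ∫ z, (g (project σ A z.1) - f z.1) ^ 2 ∂Q with hs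
  have hs0 : 0 ≤ s := integral_nonneg fun z => sq_nonneg _
  have e2 : ∫⁻ z, ENNReal.ofReal ((g (project σ A z.1) - f z.1) ^ 2) ∂Q = ENNReal.ofReal s :=
    (ofReal_integral_eq_lintegral_ofReal hint (Filter.Eventually.of_forall fun z => sq_nonneg _)).symm
  rw [e2] at h1
  have h6 : risk Q (fun X => g₀ (project σ A X))
      ≤ risk Q (fun X => g (project σ A X)) + ENNReal.ofReal (lam * ‖g‖ ^ 2) := by
    rw [risk_comp_project hlab hK, risk_comp_project hlab hK,
      ← ENNReal.ofReal_add (integral_nonneg fun z => sqHinge_nonneg _ _) (by positivity)]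
    refine ENNReal.ofReal_le_ofReal ?_
    have h7 := regRisk_add_le_of_grad_eq_zero measurable_snd hΨm hY hK hg₀ g
    unfold regRisk at h7
    have h8 : 0 ≤ lam * ‖g - g₀‖ ^ 2 := by positivity
    have h9 : 0 ≤ lam * ‖g₀‖ ^ 2 := by positivity
    linarith
  set a := risk Q f - bayesRisk Q with ha
  have h7 : risk Q f ≤ bayesRisk Q + a := le_add_tsub
  have hb := bayesRisk_ne_top hlab hK
  refine (ENNReal.add_le_add_iff_right hb).mp ?_
  have e3 : (4 * r : ℝ≥0∞) = ENNReal.ofReal (4 * r) := by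
    rw [ENNReal.ofReal_mul (by norm_num)]; simp
  -- The approximation error and the penalty of `g` are both paid by the penalty of `f`, which is
  -- already part of the approximation error `D`.
  have h8 : 2 * ENNReal.ofReal s + ENNReal.ofReal (lam * ‖g‖ ^ 2)
      ≤ 4 * r * ENNReal.ofReal (lam * ‖f‖ ^ 2) := by
    have e4 : (2 : ℝ≥0∞) = ENNReal.ofReal 2 := by simp
    rw [e3, e4, ← ENNReal.ofReal_mul zero_le_two, ← ENNReal.ofReal_mul (by positivity),
      ← ENNReal.ofReal_add (by positivity) (by positivity)]
    refine ENNReal.ofReal_le_ofReal ?_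
    have : 0 ≤ lam * ‖g‖ ^ 2 := by positivity
    linarith
  have h9 : (2 : ℝ≥0∞) * a ≤ 4 * r * a := by
    gcongr
    have : (1 : ℝ≥0∞) ≤ r := by exact_mod_cast hr
    calc (2 : ℝ≥0∞) ≤ 4 * 1 := by norm_num
      _ ≤ 4 * r := by gcongr
  calc risk Q (fun X => g₀ (project σ A X)) + bayesRisk Q
      ≤ (risk Q (fun X => g (project σ A X)) + ENNReal.ofReal (lam * ‖g‖ ^ 2)) + bayesRisk Q := by
        gcongr
    _ = (risk Q (fun X => g (project σ A X)) + bayesRisk Q) + ENNReal.ofReal (lam * ‖g‖ ^ 2) := by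
        ring
    _ ≤ (2 * (bayesRisk Q + a) + 2 * ENNReal.ofReal s) + ENNReal.ofReal (lam * ‖g‖ ^ 2) := by
        exact add_le_add (h1.trans (by gcongr)) le_rfl
    _ = 2 * bayesRisk Q + 2 * a + (2 * ENNReal.ofReal s + ENNReal.ofReal (lam * ‖g‖ ^ 2)) := by ring
    _ ≤ 2 * bayesRisk Q + 4 * r * a + 4 * r * ENNReal.ofReal (lam * ‖f‖ ^ 2) := by gcongr
    _ = 2 * bayesRisk Q + 4 * r * (a + ENNReal.ofReal (lam * ‖f‖ ^ 2)) := by ring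
    _ ≤ 2 * bayesRisk Q + 4 * r * ENNReal.ofReal ((|c| + 1) * lam ^ η) := by gcongr
    _ = _ := by
        rw [ENNReal.ofReal_mul (by positivity : (0 : ℝ) ≤ 4 * r), ← e3]
        ring

end Excess

/-! ### Bounds for the exceptional event, with and without a rate. -/

section GoodEvent

variable {d r q P n : ℕ} {κ : Fin d → ModeKernel} {I : Fin d → ℕ} {σ : Fin r → Fin q}
  {Q : Measure (CPTensor r I × ℝ)} [IsProbabilityMeasure Q] {lam : ℝ}

/-- The sum of the squares of all entries of the projection matrices. -/
noncomputable def sumSqEntries (A : ProjMatrices q P I) : ℝ := ∑ j, ∑ m, ∑ p, ∑ l, A j m p l ^ 2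

theorem continuous_sumSqEntries : Continuous (sumSqEntries (q := q) (P := P) (I := I)) := by
  unfold sumSqEntries
  fun_prop

/-- A crude bound valid for all matrices. It serves for local boundedness in `A` and for small
samples, where near isometry is not available. -/
theorem norm_project_sq_le_sumSqEntries (A : ProjMatrices q P I) (X : CPTensor r I) (j : Fin d)
    (k : Fin r) : ‖project σ A X j k‖ ^ 2 ≤ sumSqEntries A * ‖X j k‖ ^ 2 := by
  have h1 : ∀ p, project σ A X j k p ^ 2 ≤ (∑ l, A j (σ k) p l ^ 2) * ‖X j k‖ ^ 2 := by
    intro p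
    have h2 : project σ A X j k p = (Real.sqrt P)⁻¹ * ∑ l, A j (σ k) p l * X j k l := by
      simp [project, Matrix.mulVec, dotProduct]
    have h3 : (Real.sqrt P)⁻¹ ^ 2 ≤ 1 := by
      rw [inv_pow, Real.sq_sqrt (Nat.cast_nonneg P)]
      exact Nat.cast_inv_le_one P
    rw [h2, mul_pow]
    exact (mul_le_of_le_one_left (sq_nonneg _) h3).trans (sq_dot_le _ _)
  rw [EuclideanSpace.real_norm_sq_eq]
  refine (Finset.sum_le_sum fun p _ => h1 p).trans ?_
  rw [← Finset.sum_mul]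
  refine mul_le_mul_of_nonneg_right ?_ (sq_nonneg _)
  have h4 : ∑ p, ∑ l, A j (σ k) p l ^ 2 ≤ ∑ m, ∑ p, ∑ l, A j m p l ^ 2 :=
    Finset.single_le_sum (f := fun m => ∑ p, ∑ l, A j m p l ^ 2)
      (fun m _ => by positivity) (Finset.mem_univ _)
  exact h4.trans (Finset.single_le_sum (f := fun j => ∑ m, ∑ p, ∑ l, A j m p l ^ 2)
    (fun j _ => by positivity) (Finset.mem_univ j))

theorem norm_projFeature_le {A : ProjMatrices q P I} {z : CPTensor r I × ℝ} {B M : ℝ} (hM : 0 ≤ M)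
    (hz : ∀ j k, ‖z.1 j k‖ ^ 2 ≤ B) (hA : ∀ j k, ‖project σ A z.1 j k‖ ^ 2 ≤ M * ‖z.1 j k‖ ^ 2) :
    ‖projFeature κ σ A z‖ ≤ Real.sqrt (kernelBound r κ (M * B)) :=
  norm_featureMap_le fun j k => (hA j k).trans (by gcongr; exact hz j k)

/-- The labelled tensors with label `±1` and factors of squared norm at most `B`. -/
def dataSupport (I : Fin d → ℕ) (r : ℕ) (B : ℝ) : Set (CPTensor r I × ℝ) :=
  {z | (z.2 = 1 ∨ z.2 = -1) ∧ ∀ j k, ‖z.1 j k‖ ^ 2 ≤ B}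

theorem abs_label_le {B : ℝ} {z : CPTensor r I × ℝ} (hz : z ∈ dataSupport I r B) : |z.2| ≤ 1 := by
  rcases hz.1 with h | h <;> rw [h] <;> norm_num

theorem exists_regEmpRisk_minimizer {B K : ℝ} (hn : 1 ≤ n) (hlam : 0 < lam) {A : ProjMatrices q P I}
    {T : Fin n → CPTensor r I × ℝ} (hT : ∀ i, T i ∈ dataSupport I r B)
    (hK : ∀ z ∈ dataSupport I r B, ‖projFeature κ σ A z‖ ≤ K) :
    ∃ g : TensorRKHS r κ (fun _ : Fin d => P),
      (∀ g', g' ≠ g → regEmpRisk κ σ lam A T g < regEmpRisk κ σ lam A T g') ∧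
      Real.sqrt lam * ‖g‖ ≤ 1 ∧
      ∀ g₀, n * (lam * ‖g - g₀‖)
        ≤ ‖∑ i, gradSummand Prod.snd (projFeature κ σ A) lam g₀ (T i)‖ := by
  obtain ⟨g, h1, h2, h3⟩ := exists_empirical_minimizer hn hlam (fun i => (T i).2)
    (fun i => projFeature κ σ A (T i)) (fun i => abs_label_le (hT i)) fun i => hK _ (hT i)
  refine ⟨g, fun g' hne => ?_, h2, h3⟩
  have h := h1 g' hne
  simp only [inner_projFeature] at h
  exact h

/-- The assembly for large samples. The term `16 * r * (|c| + 1)` is the bias, doubled by the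
comparison of risks and again to absorb `1 ≤ 2 * √Λ`; `64 * K ^ 3` is the deviation. The number `2 *
max B 0` bounds the squared norms of the projected factors. -/
theorem measure_goodEvent_compl_le (hr : 0 < r) {B c η : ℝ} (hQ : DataAssumptions κ B c η Q)
    (hn : 1 ≤ n) (hlam : 0 < lam) (hlam1 : lam ≤ 1)
    (hrate : Real.sqrt (1 / n) ≤ lam ^ η * Real.sqrt lam ^ 3) {K : ℝ}
    (hK : K = Real.sqrt (kernelBound r κ (2 * max B 0)) + 1) {G : Set (ProjMatrices q P I)}
    (hG : MeasurableSet G) {β δ : ℝ} (hβ0 : 0 ≤ β) (hβ : projLaw q P I Gᶜ ≤ ENNReal.ofReal β)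
    (hδ : 0 < δ) (hδ1 : δ < 1)
    (hproj : ∀ A ∈ G, ∀ (X : CPTensor r I) j k, ‖project σ A X j k‖ ^ 2 ≤ 2 * ‖X j k‖ ^ 2)
    (dom : ∀ A ∈ G, ∀ (φ : CPTensor r I × ℝ → ℝ) (b : ℝ), Measurable φ → (∀ᵐ z ∂Q, |φ z| ≤ b) →
      ‖∫ z, φ z • featureMap κ z.1 ∂Q‖ ^ 2
        ≤ 2 * r * (‖∫ z, φ z • projFeature κ σ A z ∂Q‖ ^ 2 + lam * ∫ z, φ z ^ 2 ∂Q))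
    {b : ℝ} (hb : (16 * r * (|c| + 1) + 64 * K ^ 3) * Real.sqrt (Real.log (2 / δ)) * lam ^ η ≤ b) :
    ((projLaw q P I).prod (Measure.pi fun _ : Fin n => Q)) (goodEvent κ σ Q P n lam b)ᶜ
      ≤ ENNReal.ofReal (1 - (1 - δ) * (1 - β)) := by
  have hB0 : 0 ≤ max B 0 := le_max_right _ _
  have hKB := kernelBound_nonneg (r := r) (κ := κ) (by positivity : 0 ≤ 2 * max B 0)
  have hK1 : 1 ≤ K := by rw [hK]; linarith [Real.sqrt_nonneg (kernelBound r κ (2 * max B 0))]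
  set S := dataSupport I r (max B 0) with hSdef
  have hS : ∀ᵐ z ∂Q, z ∈ S := by
    filter_upwards [hQ.label, hQ.bounded] with z h1 h2
    exact ⟨h1, fun j k => (h2 j k).trans (le_max_left _ _)⟩
  have hΦ : ∀ A ∈ G, ∀ z ∈ S, ‖projFeature κ σ A z‖ ≤ K := fun A hA z hz =>
    (norm_projFeature_le zero_le_two hz.2 fun j k => hproj A hA z.1 j k).trans (by rw [hK]; linarith)
  have hloc : ∀ A : ProjMatrices q P I, ∃ K', ∀ᶠ A' in nhds A, ∀ z ∈ S,
      ‖projFeature κ σ A' z‖ ≤ K' := by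
    intro A
    refine ⟨Real.sqrt (kernelBound r κ ((sumSqEntries A + 1) * max B 0)), ?_⟩
    have h0 : 0 ≤ sumSqEntries A := by unfold sumSqEntries; positivity
    filter_upwards [continuous_sumSqEntries.continuousAt.eventually_lt continuousAt_const
      (lt_add_one (sumSqEntries A))] with A' hA' z hz
    refine norm_projFeature_le (by linarith) hz.2 fun j k =>
      (norm_project_sq_le_sumSqEntries A' z.1 j k).trans ?_
    gcongr
  have hΦc : ∀ z : CPTensor r I × ℝ, Continuous fun A : ProjMatrices q P I => projFeature κ σ A z :=
    fun z => continuous_featureMap.comp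
      ((continuous_project σ).comp (continuous_id.prodMk continuous_const))
  set Λ := Real.log (2 / δ) with hΛ
  have hΛ2 : 1 / 4 ≤ Λ := by
    have h1 : Real.log 2 ≤ Λ := Real.log_le_log (by norm_num) (by
      rw [le_div_iff₀ hδ]; linarith)
    linarith [Real.log_two_gt_d9]
  have hn0 : (0 : ℝ) < n := by exact_mod_cast hn
  set w := Real.sqrt (Λ / n) with hw
  have hw0 : 0 < w := Real.sqrt_pos.mpr (by positivity)
  have hwn : n * w ^ 2 = Λ := by
    rw [hw, Real.sq_sqrt (by positivity)]; field_simp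
  obtain ⟨g₀, hg₀, hmeas⟩ := exists_minimizer_measure_compl_le (Q := Q) (π := projLaw q P I) hK1
    hlam hlam1 measurable_snd stronglyMeasurable_projFeature hΦc hS (fun z hz => abs_label_le hz) hloc
    hG hΦ hn hδ hδ1 hβ0 hβ hw0 hwn
  refine le_trans (measure_mono (Set.compl_subset_compl.mpr ?_)) hmeas
  rintro ⟨A, T⟩ ⟨⟨hA, hdev⟩, hT⟩
  obtain ⟨g, hmin, hgn, hgd⟩ := exists_regEmpRisk_minimizer hn hlam hT (hΦ A hA)
  refine ⟨g, hmin, ?_⟩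
  have hKA : ∀ᵐ z ∂Q, ‖projFeature κ σ A z‖ ≤ K := hS.mono (hΦ A hA)
  have hKA' : ∀ᵐ z ∂Q, ‖featureMap κ z.1‖ ≤ K := hS.mono fun z hz =>
    (norm_featureMap_le (B := 2 * max B 0) fun j k => (hz.2 j k).trans (by linarith)).trans
      (by rw [hK]; linarith)
  have hpow : 0 < lam ^ η := Real.rpow_pos_of_pos hlam η
  have h0 := risk_minimizer_le hr hQ hlam hlam1 hKA hKA' (dom A hA) (hg₀ A)
  have h1 := risk_le_of_norm_sub_le hQ.label hKA (g := g) (by positivity) h0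
  refine h1.trans ?_
  gcongr
  refine le_trans ?_ hb
  set l := Real.sqrt lam with hl
  have hl0 : 0 < l := Real.sqrt_pos.mpr hlam
  have hll : l ^ 2 = lam := Real.sq_sqrt hlam.le
  have hg₀n := sqrt_mul_norm_le_one_of_grad_eq_zero hlam measurable_snd
    (stronglyMeasurable_projFeature_right A) (hS.mono fun z hz => abs_label_le hz) hKA (hg₀ A)
  -- The first requirement combines the stability of the empirical minimizer with the concentration
  -- of the gradient, the second the norms of both minimizers.
  have hu : ‖g - g₀ A‖ ^ 2 * l ^ 3 ≤ 32 * K * w := by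
    refine sq_le_of_deviation (by linarith) hl0 hw0.le (norm_nonneg _) ?_ ?_
    · rw [hll]
      have h2 := (hgd (g₀ A)).trans hdev.le
      exact le_of_mul_le_mul_left h2 hn0
    · calc l * ‖g - g₀ A‖ ≤ l * (‖g‖ + ‖g₀ A‖) := by gcongr; exact norm_sub_le _ _
        _ ≤ 2 := by rw [mul_add]; linarith
  have hww : w ≤ Real.sqrt Λ * (lam ^ η * l ^ 3) := by
    have e : w = Real.sqrt Λ * Real.sqrt (1 / n) := by
      rw [hw, ← Real.sqrt_mul (by linarith)]; congr 1; ring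
    rw [e]; gcongr
  have hu2 : ‖g - g₀ A‖ ^ 2 ≤ 32 * K * (Real.sqrt Λ * lam ^ η) := by
    have hl3 : 0 < l ^ 3 := by positivity
    refine le_of_mul_le_mul_right (hu.trans ?_) hl3
    calc 32 * K * w ≤ 32 * K * (Real.sqrt Λ * (lam ^ η * l ^ 3)) := by gcongr
      _ = _ := by ring
  have hsΛ : 1 ≤ 2 * Real.sqrt Λ := by
    have : (1 : ℝ) / 2 ≤ Real.sqrt Λ := Real.le_sqrt_of_sq_le (by norm_num; linarith)
    linarith
  have h5 : 2 * (4 * r * ((|c| + 1) * lam ^ η))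
      ≤ 2 * (4 * r * ((|c| + 1) * lam ^ η)) * (2 * Real.sqrt Λ) :=
    le_mul_of_one_le_right (by positivity) hsΛ
  have h6 : K ^ 2 * ‖g - g₀ A‖ ^ 2 ≤ K ^ 2 * (32 * K * (Real.sqrt Λ * lam ^ η)) := by gcongr
  calc _ ≤ 2 * (4 * r * ((|c| + 1) * lam ^ η)) * (2 * Real.sqrt Λ)
        + 2 * (K ^ 2 * (32 * K * (Real.sqrt Λ * lam ^ η))) := by linarith
    _ = _ := by ring

/-- A bound without any rate, by the size of the minimizer. -/
theorem measure_goodEvent_compl_le_of_sumSqEntries_le {B c η : ℝ} (hQ : DataAssumptions κ B c η Q)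
    (hn : 1 ≤ n) (hlam : 0 < lam) {M β δ : ℝ} (hM : 0 ≤ M) (hβ0 : 0 ≤ β)
    (hβ : projLaw q P I {A | sumSqEntries A ≤ M}ᶜ ≤ ENNReal.ofReal β) (hδ : 0 < δ) (hδ1 : δ < 1)
    {b : ℝ} (hb : (1 + Real.sqrt (kernelBound r κ (M * max B 0)) / Real.sqrt lam) ^ 2 ≤ b) :
    ((projLaw q P I).prod (Measure.pi fun _ : Fin n => Q)) (goodEvent κ σ Q P n lam b)ᶜ
      ≤ ENNReal.ofReal (1 - (1 - δ) * (1 - β)) := by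
  set S := dataSupport I r (max B 0) with hSdef
  have hS : ∀ᵐ z ∂Q, z ∈ S := by
    filter_upwards [hQ.label, hQ.bounded] with z h1 h2
    exact ⟨h1, fun j k => (h2 j k).trans (le_max_left _ _)⟩
  have hG : MeasurableSet {A : ProjMatrices q P I | sumSqEntries A ≤ M} :=
    measurableSet_le continuous_sumSqEntries.measurable measurable_const
  have h := (measure_prod_inter_ae_compl (π := projLaw q P I) (n := n) hS
    {p | p.1 ∈ {A : ProjMatrices q P I | sumSqEntries A ≤ M} ∧ p ∉ (∅ : Set _)}).trans
    (measure_prod_compl_le (ν := Measure.pi fun _ : Fin n => Q) hG hδ.le hδ1.le hβ0 hβ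
      MeasurableSet.empty fun A _ => by simp)
  refine le_trans (measure_mono (Set.compl_subset_compl.mpr ?_)) h
  rintro ⟨A, T⟩ ⟨⟨hA, -⟩, hT⟩
  have hΦ : ∀ z ∈ S, ‖projFeature κ σ A z‖ ≤ Real.sqrt (kernelBound r κ (M * max B 0)) := fun z hz =>
    norm_projFeature_le hM hz.2 fun j k => (norm_project_sq_le_sumSqEntries A z.1 j k).trans
      (mul_le_mul_of_nonneg_right hA (sq_nonneg _))
  obtain ⟨g, hmin, hgn, -⟩ := exists_regEmpRisk_minimizer hn hlam hT hΦ
  refine ⟨g, hmin, le_trans ?_ le_add_self⟩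
  have hl0 : 0 < Real.sqrt lam := Real.sqrt_pos.mpr hlam
  have hg1 : ‖g‖ ≤ 1 / Real.sqrt lam := by rw [le_div_iff₀ hl0]; linarith
  calc risk Q (fun X => g (project σ A X)) ≤ ∫⁻ _, ENNReal.ofReal b ∂Q := by
        refine lintegral_mono_ae (hS.mono fun z hz => ENNReal.ofReal_le_ofReal ?_)
        refine (sqHinge_le (abs_label_le hz)).trans (le_trans ?_ hb)
        have h2 := abs_inner_le_of_norm_le (g := g) (hΦ z hz)
        rw [inner_projFeature] at h2
        gcongr
        refine h2.trans ?_
        rw [div_eq_mul_one_div]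
        gcongr
    _ = ENNReal.ofReal b := by simp

end GoodEvent

/-! ### The choice of parameters for large samples. -/

section Rates

/-- Tightness: the superlevel sets decrease to the empty set. -/
theorem exists_measure_gt_le {Ω : Type*} [MeasurableSpace Ω] (π : Measure Ω) [IsProbabilityMeasure π]
    {f : Ω → ℝ} (hf : Measurable f) {ε : ℝ} (hε : 0 < ε) :
    ∃ M : ℝ, 0 ≤ M ∧ π {ω | f ω ≤ M}ᶜ ≤ ENNReal.ofReal ε := by
  have hm : ∀ k : ℕ, MeasurableSet {ω | f ω ≤ k} := fun k => measurableSet_le hf measurable_const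
  have h := tendsto_measure_iInter_atTop (μ := π) (s := fun k : ℕ => {ω | f ω ≤ k}ᶜ)
    (fun k => (hm k).compl.nullMeasurableSet)
    (fun k l hkl => Set.compl_subset_compl.mpr fun ω (hω : f ω ≤ k) =>
      hω.trans (by exact_mod_cast hkl)) ⟨0, measure_ne_top _ _⟩
  have he : ⋂ k : ℕ, {ω | f ω ≤ k}ᶜ = (∅ : Set Ω) := by
    refine Set.eq_empty_of_forall_notMem fun ω hω => ?_
    obtain ⟨k, hk⟩ := exists_nat_ge (f ω)
    exact Set.mem_iInter.mp hω k hk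
  rw [he, measure_empty] at h
  obtain ⟨k, hk⟩ := (h.eventually_lt_const (ENNReal.ofReal_pos.mpr hε)).exists
  exact ⟨k, Nat.cast_nonneg k, hk.le⟩

/-- This lower bound is the only property of the projected dimension that enters the rate. Because
`δ₁ < 1 / 2`, the logarithm exceeds `1 / 3`, which the factor `3` compensates. -/
theorem rpow_le_projDim {d r n : ℕ} (hd : 0 < d) (hr : 0 < r) (hn : 1 ≤ n) (μ : ℝ) {δ₁ : ℝ}
    (h0 : 0 < δ₁) (h1 : δ₁ < 1 / 2) :
    (n : ℝ) ^ (μ / d) ≤ projDim d r ((1 / (n : ℝ)) ^ (μ / (2 * d))) n δ₁ := by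
  have hn0 : (1 : ℝ) ≤ n := by exact_mod_cast hn
  have hd0 : (1 : ℝ) ≤ d := by exact_mod_cast hd
  have hr0 : (1 : ℝ) ≤ r := by exact_mod_cast hr
  have e1 : (((1 / (n : ℝ)) ^ (μ / (2 * d))) ^ 2)⁻¹ = (n : ℝ) ^ (μ / d) := by
    rw [← Real.rpow_natCast, ← Real.rpow_mul (by positivity), one_div, Real.inv_rpow (by positivity),
      inv_inv]
    congr 1
    push_cast
    field_simp
  have hL : 1 / 3 ≤ Real.log (n / δ₁) := by
    have h2 : Real.log 2 ≤ Real.log (n / δ₁) := Real.log_le_log (by norm_num) (by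
      rw [le_div_iff₀ h0]; linarith)
    linarith [Real.log_two_gt_d9]
  have h3 : 1 ≤ 3 * Real.log (n / δ₁) ^ (1 / (d : ℝ)) := by
    have hd1 : 1 / (d : ℝ) ≤ 1 := by rw [div_le_one (by positivity)]; exact hd0
    have h4 : ((1 : ℝ) / 3) ^ (1 : ℝ) ≤ ((1 : ℝ) / 3) ^ (1 / (d : ℝ)) :=
      Real.rpow_le_rpow_of_exponent_ge (by norm_num) (by norm_num) hd1
    have h5 : ((1 : ℝ) / 3) ^ (1 / (d : ℝ)) ≤ Real.log (n / δ₁) ^ (1 / (d : ℝ)) :=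
      Real.rpow_le_rpow (by norm_num) hL (by positivity)
    rw [Real.rpow_one] at h4
    linarith
  have h6 : 1 ≤ (r : ℝ) ^ (2 / (d : ℝ)) := Real.one_le_rpow hr0 (by positivity)
  unfold projDim
  rw [e1]
  push_cast
  have h7 : (n : ℝ) ^ (μ / d) ≤ 3 * (r : ℝ) ^ (2 / (d : ℝ)) * (n : ℝ) ^ (μ / d)
      * Real.log (n / δ₁) ^ (1 / (d : ℝ)) := by
    have h8 : 1 ≤ (r : ℝ) ^ (2 / (d : ℝ)) * (3 * Real.log (n / δ₁) ^ (1 / (d : ℝ))) :=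
      one_le_mul_of_one_le_of_one_le h6 h3
    calc (n : ℝ) ^ (μ / d) ≤ (n : ℝ) ^ (μ / d)
          * ((r : ℝ) ^ (2 / (d : ℝ)) * (3 * Real.log (n / δ₁) ^ (1 / (d : ℝ)))) :=
          le_mul_of_one_le_right (by positivity) h8
      _ = _ := by ring
  have h8 := Nat.le_ceil (3 * (r : ℝ) ^ (2 / (d : ℝ)) * (n : ℝ) ^ (μ / d)
      * Real.log (n / δ₁) ^ (1 / (d : ℝ)))
  linarith

theorem projDim_pos (d r n : ℕ) (ε δ₁ : ℝ) : 0 < projDim d r ε n δ₁ := Nat.succ_pos _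

/-- For large samples there is a likely event for the projection matrices on which the kernel is
dominated by the kernel after projection. -/
theorem exists_good_projections {d r : ℕ} (hd : 0 < d) (hr : 0 < r) (κ : Fin d → ModeKernel)
    {B η μ : ℝ} (hB : 0 ≤ B) (hη₀ : 0 < η) (hμ₀ : 0 < μ) (I : Fin d → ℕ) (q : ℕ) {δ₁ : ℝ}
    (h0 : 0 < δ₁) (h1 : δ₁ < 1 / 2) :
    ∃ N : ℕ, 1 ≤ N ∧ ∀ n : ℕ, N ≤ n →
      ∃ G : Set (ProjMatrices q (projDim d r ((1 / (n : ℝ)) ^ (μ / (2 * d))) n δ₁) I),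
        MeasurableSet G ∧ projLaw q _ I Gᶜ ≤ ENNReal.ofReal (2 * δ₁) ∧ ∀ A ∈ G,
          (∀ (σ : Fin r → Fin q) (X : CPTensor r I) j k,
            ‖project σ A X j k‖ ^ 2 ≤ 2 * ‖X j k‖ ^ 2) ∧
          ∀ (σ : Fin r → Fin q) (Q : Measure (CPTensor r I × ℝ)) [IsProbabilityMeasure Q],
            (∀ᵐ z ∂Q, ∀ j k, ‖z.1 j k‖ ^ 2 ≤ B) → ∀ (φ : CPTensor r I × ℝ → ℝ) (b : ℝ),
            Measurable φ → (∀ᵐ z ∂Q, |φ z| ≤ b) →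
            ‖∫ z, φ z • featureMap κ z.1 ∂Q‖ ^ 2
              ≤ 2 * r * (‖∫ z, φ z • projFeature κ σ A z ∂Q‖ ^ 2
                + (1 / (n : ℝ)) ^ (μ / (2 * η + 3)) * ∫ z, φ z ^ 2 ∂Q) := by
  classical
  -- With `T` of order `P ^ (1 / 4)`, the moment `4 * d` turns the tail into `P⁻ᵈ`, which is at most
  -- `n ^ (-μ)`.
  obtain ⟨τ₀, hτ₀, C, hC, hdom⟩ := exists_kernel_domination hr κ I q hB (4 * d)
  set k : ℝ := (Fintype.card (Fin q × Σ j, Fin (I j)) : ℝ) ^ 2 * normalFourthMoment with hk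
  have hk0 : 0 ≤ k := mul_nonneg (by positivity) normalFourthMoment_nonneg
  -- The three bounds on `y` are needed for `1 ≤ y`, for `1 ≤ T`, and for a failure probability of
  -- at most `2 * δ₁`.
  set Y : ℝ := max 1 (max (1 / τ₀) (k / (2 * δ₁))) with hY
  have hY1 : 1 ≤ Y := le_max_left _ _
  have hd0 : (0 : ℝ) < d := by exact_mod_cast hd
  have hr1 : (1 : ℝ) ≤ r := by exact_mod_cast hr
  have ev1 : ∀ᶠ n : ℕ in Filter.atTop, Y ^ 4 ≤ (n : ℝ) ^ (μ / d) :=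
    ((tendsto_rpow_atTop (by positivity : 0 < μ / d)).comp
      tendsto_natCast_atTop_atTop).eventually_ge_atTop _
  -- The gap between the remainder of order `n ^ (-μ)` and the lower bound `n ^ (-μ / 3)` for the
  -- regularization swallows the constant.
  have ev2 : ∀ᶠ n : ℕ in Filter.atTop, C * (τ₀ ^ (4 * d))⁻¹ ≤ (n : ℝ) ^ (2 * μ / 3) :=
    ((tendsto_rpow_atTop (by positivity : 0 < 2 * μ / 3)).comp
      tendsto_natCast_atTop_atTop).eventually_ge_atTop _
  obtain ⟨N, hN⟩ := Filter.eventually_atTop.mp (ev1.and ev2)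
  refine ⟨max N 1, le_max_right _ _, fun n hn => ?_⟩
  obtain ⟨hn1, hn2⟩ := hN n ((le_max_left _ _).trans hn)
  have hn1' : 1 ≤ n := (le_max_right _ _).trans hn
  have hn0 : (1 : ℝ) ≤ n := by exact_mod_cast hn1'
  have hP := rpow_le_projDim hd hr hn1' μ h0 h1
  set P := projDim d r ((1 / (n : ℝ)) ^ (μ / (2 * d))) n δ₁ with hPdef
  have hP0 : 0 < P := projDim_pos _ _ _ _ _
  have hPr : (0 : ℝ) < P := by exact_mod_cast hP0
  -- The tolerance `1 / y = P ^ (-1 / 4)` tends to zero while Chebyshev's bound, of order `1 / (P *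
  -- (1 / y) ^ 2) = 1 / y ^ 2`, does too.
  set y : ℝ := Real.sqrt (Real.sqrt P) with hy
  have hy4 : y ^ 4 = P := by
    have : y ^ 4 = (y ^ 2) ^ 2 := by ring
    rw [this, hy, Real.sq_sqrt (Real.sqrt_nonneg _), Real.sq_sqrt hPr.le]
  have hyY : Y ≤ y := by
    refine Real.le_sqrt_of_sq_le (Real.le_sqrt_of_sq_le ?_)
    have e : (Y ^ 2) ^ 2 = Y ^ 4 := by ring
    rw [e]
    exact hn1.trans hP
  have hy1 : 1 ≤ y := hY1.trans hyY
  have hy0 : 0 < y := by linarith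
  have hyτ : 1 / τ₀ ≤ y := (le_max_left _ _).trans ((le_max_right _ _).trans hyY)
  have hyk : k / (2 * δ₁) ≤ y := (le_max_right _ _).trans ((le_max_right _ _).trans hyY)
  have hT : 1 ≤ τ₀ * y := by
    rw [div_le_iff₀ hτ₀] at hyτ; linarith
  have hTτ : τ₀ / (τ₀ * y) = 1 / y := by field_simp
  refine ⟨nearIsometries q P I (1 / y), measurableSet_nearIsometries _, ?_, fun A hA => ?_⟩
  · refine (measure_nearIsometries_compl_le hP0 (by positivity)).trans (ENNReal.ofReal_le_ofReal ?_)
    have e : (Fintype.card (Fin q × Σ j, Fin (I j)) : ℝ) ^ 2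
        * (normalFourthMoment / (P * (1 / y) ^ 2)) = k / y ^ 2 := by
      rw [← hy4, hk]; field_simp
    rw [e, div_le_iff₀ (by positivity)]
    rw [div_le_iff₀ (by positivity)] at hyk
    have h2 : y ≤ y ^ 2 := by nlinarith
    calc k ≤ y * (2 * δ₁) := hyk
      _ ≤ y ^ 2 * (2 * δ₁) := by gcongr
      _ = _ := by ring
  · obtain ⟨hpr, hd2⟩ := hdom (τ₀ * y) hT P A (by rw [hTτ]; exact hA)
    refine ⟨hpr, fun σ Q _ hQB φ b hφm hφ => ?_⟩
    set D : Set (CPTensor r I × ℝ) := {z | ∀ j k, ‖z.1 j k‖ ^ 2 ≤ B} with hD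
    have hDm : MeasurableSet D := by
      have hDi : D = ⋂ j, ⋂ k, {z : CPTensor r I × ℝ | ‖z.1 j k‖ ^ 2 ≤ B} := by
        ext z; simp [hD]
      rw [hDi]
      refine MeasurableSet.iInter fun j => MeasurableSet.iInter fun k =>
        measurableSet_le ?_ measurable_const
      have hjk : Measurable fun z : CPTensor r I × ℝ => z.1 j k :=
        (measurable_pi_apply k).comp ((measurable_pi_apply j).comp measurable_fst)
      exact hjk.norm.pow_const 2
    -- The domination asks for bounded tensors everywhere, the data are bounded almost surely; a
    -- modification on a null set leaves the integrals unchanged.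
    set x : CPTensor r I × ℝ → CPTensor r I := fun z => if z ∈ D then z.1 else 0 with hx
    have hxm : Measurable x := Measurable.ite hDm measurable_fst measurable_const
    have hxB : ∀ z j k, ‖x z j k‖ ^ 2 ≤ B := by
      intro z j k
      by_cases hz : z ∈ D
      · simp only [hx, if_pos hz]; exact hz j k
      · simp only [hx, if_neg hz]
        simpa using hB
    have hxe : ∀ᵐ z ∂Q, x z = z.1 := hQB.mono fun z hz => if_pos hz
    have h2 := hd2 σ _ Q x hxm hxB φ b hφm hφ
    have e1 : ∫ z, φ z • featureMap κ (x z) ∂Q = ∫ z, φ z • featureMap κ z.1 ∂Q :=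
      integral_congr_ae (hxe.mono fun z hz => by simp only [hz])
    have e2 : ∫ z, φ z • featureMap κ (project σ A (x z)) ∂Q = ∫ z, φ z • projFeature κ σ A z ∂Q :=
      integral_congr_ae (hxe.mono fun z hz => by simp only [hz, projFeature])
    rw [e1, e2] at h2
    refine h2.trans ?_
    have hφ0 : 0 ≤ ∫ z, φ z ^ 2 ∂Q := integral_nonneg fun z => sq_nonneg _
    have hx1 : 1 / (n : ℝ) ≤ 1 := by rw [div_le_one (by positivity)]; exact hn0
    have hlam : (1 / (n : ℝ)) ^ (μ / 3) ≤ (1 / (n : ℝ)) ^ (μ / (2 * η + 3)) := by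
      refine Real.rpow_le_rpow_of_exponent_ge (by positivity) hx1 ?_
      gcongr
      linarith
    have hPd : (n : ℝ) ^ μ ≤ (P : ℝ) ^ d := by
      calc (n : ℝ) ^ μ = ((n : ℝ) ^ (μ / d)) ^ d := by
            rw [← Real.rpow_mul_natCast (by positivity)]; congr 1; field_simp
        _ ≤ _ := by gcongr
    have hsmall : C * ((τ₀ * y) ^ (4 * d))⁻¹ ≤ 2 * r * (1 / (n : ℝ)) ^ (μ / (2 * η + 3)) := by
      have e3 : (τ₀ * y) ^ (4 * d) = τ₀ ^ (4 * d) * (P : ℝ) ^ d := by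
        rw [mul_pow, pow_mul y, hy4]
      have hnμ : 0 < (n : ℝ) ^ μ := by positivity
      have hl0 : 0 < (1 / (n : ℝ)) ^ (μ / (2 * η + 3)) := by positivity
      calc C * ((τ₀ * y) ^ (4 * d))⁻¹ = C * (τ₀ ^ (4 * d))⁻¹ * ((P : ℝ) ^ d)⁻¹ := by
            rw [e3, mul_inv]; ring
        _ ≤ (n : ℝ) ^ (2 * μ / 3) * ((n : ℝ) ^ μ)⁻¹ := by gcongr
        _ = (1 / (n : ℝ)) ^ (μ / 3) := by
            rw [← Real.rpow_neg (by positivity), ← Real.rpow_add (by positivity), one_div,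
              Real.inv_rpow (by positivity), ← Real.rpow_neg (by positivity)]
            congr 1; ring
        _ ≤ (1 / (n : ℝ)) ^ (μ / (2 * η + 3)) := hlam
        _ ≤ _ := le_mul_of_one_le_left hl0.le (by linarith)
    have h3 := mul_le_mul_of_nonneg_right hsmall hφ0
    linarith

/-- The right side is the regularization parameter to the power `η + 3 / 2`, that is `n ^ (-μ / 2)`.
This balance is what fixes the exponent `μ / (2 * η + 3)`. -/
theorem sqrt_one_div_le {n : ℕ} (hn : 1 ≤ n) {η μ : ℝ} (hη₀ : 0 < η) (hμ₁ : μ < 1) :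
    Real.sqrt (1 / n) ≤ ((1 / (n : ℝ)) ^ (μ / (2 * η + 3))) ^ η
      * Real.sqrt ((1 / (n : ℝ)) ^ (μ / (2 * η + 3))) ^ 3 := by
  have hn0 : (1 : ℝ) ≤ n := by exact_mod_cast hn
  have hx0 : (0 : ℝ) < 1 / n := by positivity
  have hx1 : 1 / (n : ℝ) ≤ 1 := by rw [div_le_one (by positivity)]; exact hn0
  rw [Real.sqrt_eq_rpow, Real.sqrt_eq_rpow, ← Real.rpow_natCast, ← Real.rpow_mul hx0.le,
    ← Real.rpow_mul hx0.le, ← Real.rpow_mul hx0.le, ← Real.rpow_add hx0]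
  refine Real.rpow_le_rpow_of_exponent_ge hx0 hx1 ?_
  have e : μ / (2 * η + 3) * η + μ / (2 * η + 3) * (1 / 2) * (3 : ℕ) = μ / 2 := by
    push_cast; field_simp
  rw [e]; linarith

end Rates

/-! ### Large and small samples combined. -/

theorem mainTheorem5 {d r : ℕ} (hd : 0 < d) (hr : 0 < r) (κ : Fin d → ModeKernel)
    (B c η μ : ℝ) (hη₀ : 0 < η) (hη₁ : η ≤ 1) (hμ₀ : 0 < μ) (hμ₁ : μ < 1) :
    (∀ (I : Fin d → ℕ) (q : ℕ) (σ : Fin r → Fin q) (δ₁ : ℝ), 0 < δ₁ → δ₁ < 1 / 2 →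
      ∃ C : ℝ, 0 < C ∧
        ∀ (Q : Measure (CPTensor r I × ℝ)) [IsProbabilityMeasure Q], DataAssumptions κ B c η Q →
          ∀ n : ℕ, 1 ≤ n → ∀ δ₂ : ℝ, 0 < δ₂ → δ₂ < 1 → RateBound κ σ Q η μ n δ₁ δ₂ C) ∧
    (∃ C : ℝ, 0 < C ∧
      ∀ (I : Fin d → ℕ) (q : ℕ) (σ : Fin r → Fin q) (δ₁ : ℝ), 0 < δ₁ → δ₁ < 1 / 2 →
        ∃ N : ℕ, 1 ≤ N ∧
          ∀ (Q : Measure (CPTensor r I × ℝ)) [IsProbabilityMeasure Q], DataAssumptions κ B c η Q →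
            ∀ n : ℕ, N ≤ n → ∀ δ₂ : ℝ, 0 < δ₂ → δ₂ < 1 → RateBound κ σ Q η μ n δ₁ δ₂ C) := by
  set K := Real.sqrt (kernelBound r κ (2 * max B 0)) + 1 with hK
  have hK0 : 0 < K := by positivity
  set C₂ : ℝ := 16 * r * (|c| + 1) + 64 * K ^ 3 with hC₂
  have hC₂0 : 0 < C₂ := by positivity
  have hx : ∀ n : ℕ, 1 ≤ n → (0 : ℝ) < 1 / n ∧ 1 / (n : ℝ) ≤ 1 := fun n hn => by
    have hn0 : (1 : ℝ) ≤ n := by exact_mod_cast hn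
    exact ⟨by positivity, by rw [div_le_one (by positivity)]; exact hn0⟩
  have hpow : ∀ n : ℕ, 1 ≤ n → ((1 / (n : ℝ)) ^ (μ / (2 * η + 3))) ^ η
      = (1 / (n : ℝ)) ^ (μ * η / (2 * η + 3)) := fun n hn => by
    rw [← Real.rpow_mul (hx n hn).1.le]; congr 1; ring
  -- The constant `C₂` is fixed before the sizes, the matrices and `δ₁`; these only influence the
  -- threshold `N`. Allowing every larger `C` serves both claims.
  have large : ∀ (I : Fin d → ℕ) (q : ℕ) (σ : Fin r → Fin q) (δ₁ : ℝ), 0 < δ₁ → δ₁ < 1 / 2 →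
      ∃ N : ℕ, 1 ≤ N ∧ ∀ C, C₂ ≤ C →
        ∀ (Q : Measure (CPTensor r I × ℝ)) [IsProbabilityMeasure Q], DataAssumptions κ B c η Q →
          ∀ n : ℕ, N ≤ n → ∀ δ₂ : ℝ, 0 < δ₂ → δ₂ < 1 → RateBound κ σ Q η μ n δ₁ δ₂ C := by
    intro I q σ δ₁ h0 h1
    obtain ⟨N, hN1, hN⟩ := exists_good_projections hd hr κ (le_max_right B 0) hη₀ hμ₀ I q h0 h1
    refine ⟨N, hN1, fun C hC Q _ hQ n hn δ₂ h2 h3 => ?_⟩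
    have hn1 := hN1.trans hn
    obtain ⟨hx0, hx1⟩ := hx n hn1
    obtain ⟨G, hG, hβ, hGA⟩ := hN n hn
    refine measure_goodEvent_compl_le hr hQ hn1 (Real.rpow_pos_of_pos hx0 _)
      (Real.rpow_le_one hx0.le hx1 (by positivity)) (sqrt_one_div_le hn1 hη₀ hμ₁) hK hG
      (by positivity) hβ h2 h3 (fun A hA => (hGA A hA).1 σ)
      (fun A hA => (hGA A hA).2 σ Q (hQ.bounded.mono fun z hz j k =>
        (hz j k).trans (le_max_left _ _))) ?_
    rw [hpow n hn1]
    gcongr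
  refine ⟨fun I q σ δ₁ h0 h1 => ?_, C₂, hC₂0, fun I q σ δ₁ h0 h1 => ?_⟩
  · obtain ⟨N, hN1, hN⟩ := large I q σ δ₁ h0 h1
    -- For the finitely many remaining `n` the matrices are merely bounded, with probability at
    -- least `1 - 2 * δ₁`.
    choose M hM0 hM using fun n : ℕ =>
      exists_measure_gt_le (projLaw q (projDim d r ((1 / (n : ℝ)) ^ (μ / (2 * d))) n δ₁) I)
        continuous_sumSqEntries.measurable (by positivity : 0 < 2 * δ₁)
    -- The crude risk bound divided by the rate; the factor `2` offsets `√(log (2 / δ₂)) ≥ 1 / 2`,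
    -- so that `E n` does not depend on `δ₂` or on `Q`.
    set E : ℕ → ℝ := fun n => 2 * (1 + Real.sqrt (kernelBound r κ (M n * max B 0))
      / Real.sqrt ((1 / (n : ℝ)) ^ (μ / (2 * η + 3)))) ^ 2
      / (1 / (n : ℝ)) ^ (μ * η / (2 * η + 3)) with hE
    have hE0 : ∀ n, 0 ≤ E n := fun n => by positivity
    have hs0 : 0 ≤ ∑ n ∈ Finset.range N, E n := Finset.sum_nonneg fun n _ => hE0 n
    refine ⟨C₂ + ∑ n ∈ Finset.range N, E n, by positivity, fun Q _ hQ n hn δ₂ h2 h3 => ?_⟩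
    rcases le_or_gt N n with hNn | hNn
    · exact hN _ (by linarith) Q hQ n hNn δ₂ h2 h3
    · obtain ⟨hx0, hx1⟩ := hx n hn
      refine measure_goodEvent_compl_le_of_sumSqEntries_le hQ hn (Real.rpow_pos_of_pos hx0 _)
        (hM0 n) (by positivity) (hM n) h2 h3 ?_
      have hle : E n ≤ C₂ + ∑ n ∈ Finset.range N, E n := by
        have := Finset.single_le_sum (f := E) (fun n _ => hE0 n) (Finset.mem_range.mpr hNn)
        linarith
      have hsΛ : 1 / 2 ≤ Real.sqrt (Real.log (2 / δ₂)) := by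
        refine Real.le_sqrt_of_sq_le ?_
        have h4 : Real.log 2 ≤ Real.log (2 / δ₂) := Real.log_le_log (by norm_num) (by
          rw [le_div_iff₀ h2]; linarith)
        linarith [Real.log_two_gt_d9]
      have hp : 0 < (1 / (n : ℝ)) ^ (μ * η / (2 * η + 3)) := Real.rpow_pos_of_pos hx0 _
      calc _ = E n * (1 / 2) * (1 / (n : ℝ)) ^ (μ * η / (2 * η + 3)) := by
            simp only [hE]; field_simp
        _ ≤ _ := by gcongr
  · obtain ⟨N, hN1, hN⟩ := large I q σ δ₁ h0 h1
    exact ⟨N, hN1, hN C₂ le_rfl⟩
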